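/- **Definitions.** A *virtual link diagram* is a closed oriented 1-manifold immersed in $\mathbb R^2$ whose singularities are transverse double points, each marked as a positive, negative or virtual crossing (positive and negative crossings are called real, and correspond to the usual over/under information); diagrams are considered up to isotopy of $\mathbb R^2$. Two virtual link diagrams are *equivalent (as virtual links)* if they are related by a finite sequence of virtual Reidemeister moves: the classical Reidemeister moves RI, RII, RIII on real crossings, the same three moves with all crossings virtual, and the mixed move in which a strand having only virtual crossings passes across a real crossing (all orientations of the strands allowed). Let $m\ge 1$. A *virtual braid diagram of degree $m$* is a diagram of $m$ descending strands whose crossings (positive, negative or virtual) lie at distinct heights, i.e. a word in letters $\sigma_i,\sigma_i^{-1},\tau_i$ ($1\le i\le m-1$), which stand for a positive, negative, virtual crossing of the $i$-th and $(i+1)$-st strands. The *virtual braid group* $VB_m$ is the group obtained from the monoid of these words by imposing $$\sigma_i\sigma_i^{-1}=\sigma_i^{-1}\sigma_i=1,\quad \sigma_i\sigma_j=\sigma_j\sigma_i\ (|i-j|>1),\quad \sigma_i\sigma_{i+1}\sigma_i=\sigma_{i+1}\sigma_i\sigma_{i+1},$$ $$\tau_i^2=1,\quad \tau_i\tau_j=\tau_j\tau_i\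 (|i-j|>1),\quad \tau_i\tau_{i+1}\tau_i=\tau_{i+1}\tau_i\tau_{i+1},$$ $$\sigma_i\tau_j=\tau_j\sigma_i\ (|i-j|>1),\quad \sigma_i\tau_{i+1}\tau_i=\tau_{i+1}\tau_i\sigma_{i+1}.$$ Its elements are the *virtual braids of degree $m$*. The *closure* of a virtual braid diagram is the virtual link diagram obtained by joining its bottom and top end points at equal places by parallel arcs without further crossings beside the braid; the closure of a virtual braid is the virtual link type of the closure of any diagram representing it. Let $\iota_s^t$ denote the operation of adding $s$ trivial strands on the left and $t$ on the right, both for diagrams and for virtual braids, $\iota_s^t\colon VB_m\to VB_{m+s+t}$. **Theorem 3.2.** Two virtual braids, of possibly different degrees $\ge 1$, have equivalent closures as virtual links if and only if they are related by a finite sequence of the following moves (VM1)–(VM3) and their inverses. Two virtual braid diagrams, of possibly different degrees $\ge 1$, have equivalent closures as virtual links if and only if they are related by a finite sequence of the following moves (VM0)–(VM3) and their inverses. * (VM0) A braid move: replacing, inside a virtual braid diagram, one side of a defining relation of $VB_m$ by the other. * (VM1) A conjugation: $b\mapsto g^{-1}bg$, with $b,g$ of the same degree (for diagrams, $g^{-1}$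 is the formal inverse word, with $\tau_i^{-1}=\tau_i$). * (VM2) A right stabilization of positive, negative or virtual type: $b\mapsto \iota_0^1(b)\sigma_m$, $b\mapsto\iota_0^1(b)\sigma_m^{-1}$ or $b\mapsto\iota_0^1(b)\tau_m$, where $b$ has degree $m$. * (VM3) A right virtual exchange move $\iota_0^1(b_1)\sigma_m^{-1}\iota_0^1(b_2)\sigma_m\leftrightarrow\iota_0^1(b_1)\tau_m\iota_0^1(b_2)\tau_m$, or a left virtual exchange move $\iota_1^0(b_1)\sigma_1^{-1}\iota_1^0(b_2)\sigma_1\leftrightarrow\iota_1^0(b_1)\tau_1\iota_1^0(b_2)\tau_1$, where $b_1,b_2$ have degree $m$. -/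

import Mathlib

namespace VirtualKnot

/-! ### Virtual braid diagrams and virtual braid groups -/

/-- The letters of degree `m`: with `i` counted from `0`, `σ i`, `σinv i` and `τ i` are a
positive, a negative and a virtual crossing between the strands at the (adjacent) places
`i` and `i + 1` of `m` strands, the places being numbered `0, …, m - 1` from left to right. -/
inductive BraidLetter (m : ℕ) : Type
  | σ (i : ℕ) (h : i + 1 < m)
  | σinv (i : ℕ) (h : i + 1 < m)
  | τ (i : ℕ) (h : i + 1 < m)

/-- The formal inverse of a letter; `τ` is its own inverse. -/
def BraidLetter.inv {m : ℕ} : BraidLetter m → BraidLetter m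
  | .σ i h => .σinv i h
  | .σinv i h => .σ i h
  | .τ i h => .τ i h

/-- The letter obtained by adding `s` trivial strands on the left and `t` on the right. -/
def BraidLetter.shift {m : ℕ} (s t : ℕ) : BraidLetter m → BraidLetter (m + s + t)
  | .σ i h => .σ (i + s) (by omega)
  | .σinv i h => .σinv (i + s) (by omega)
  | .τ i h => .τ (i + s) (by omega)

/-- Virtual braid diagrams of degree `m`, up to deformation through such diagrams.  The crossings
lie at distinct heights, so a diagram is the word of its crossings read from top to bottom, and
the concatenation product is the product of the free monoid. -/
abbrev BraidDiagram (m : ℕ) : Type := FreeMonoid (BraidLetter m)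

namespace BraidDiagram

/-- The one-crossing diagram `σ_{i+1}`. -/
def σ {m : ℕ} (i : ℕ) (h : i + 1 < m) : BraidDiagram m := FreeMonoid.of (.σ i h)

/-- The one-crossing diagram `σ_{i+1}⁻¹`. -/
def σinv {m : ℕ} (i : ℕ) (h : i + 1 < m) : BraidDiagram m := FreeMonoid.of (.σinv i h)

/-- The one-crossing diagram `τ_{i+1}`. -/
def τ {m : ℕ} (i : ℕ) (h : i + 1 < m) : BraidDiagram m := FreeMonoid.of (.τ i h)

/-- The formal inverse of a diagram: reverse the word and invert each letter. -/
def inv {m : ℕ} (b : BraidDiagram m) : BraidDiagram m :=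
  FreeMonoid.ofList ((FreeMonoid.toList b).map BraidLetter.inv).reverse

/-- `ι s t b` adds `s` trivial strands on the left and `t` on the right of `b`. -/
def ι {m : ℕ} (s t : ℕ) : BraidDiagram m →* BraidDiagram (m + s + t) :=
  FreeMonoid.map (BraidLetter.shift s t)

end BraidDiagram

open BraidDiagram in
/-- The defining relations of the virtual braid group of degree `m`. -/
inductive BraidRel (m : ℕ) : BraidDiagram m → BraidDiagram m → Prop
  | σ_σinv (i : ℕ) (h : i + 1 < m) : BraidRel m (σ i h * σinv i h) 1
  | σinv_σ (i : ℕ) (h : i + 1 < m) : BraidRel m (σinv i h * σ i h) 1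
  | σ_comm (i j : ℕ) (hi : i + 1 < m) (hj : j + 1 < m) (hij : i + 1 < j ∨ j + 1 < i) :
      BraidRel m (σ i hi * σ j hj) (σ j hj * σ i hi)
  | σ_braid (i : ℕ) (h : i + 1 < m) (h' : i + 1 + 1 < m) :
      BraidRel m (σ i h * σ (i + 1) h' * σ i h) (σ (i + 1) h' * σ i h * σ (i + 1) h')
  | τ_sq (i : ℕ) (h : i + 1 < m) : BraidRel m (τ i h * τ i h) 1
  | τ_comm (i j : ℕ) (hi : i + 1 < m) (hj : j + 1 < m) (hij : i + 1 < j ∨ j + 1 < i) :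
      BraidRel m (τ i hi * τ j hj) (τ j hj * τ i hi)
  | τ_braid (i : ℕ) (h : i + 1 < m) (h' : i + 1 + 1 < m) :
      BraidRel m (τ i h * τ (i + 1) h' * τ i h) (τ (i + 1) h' * τ i h * τ (i + 1) h')
  | σ_τ_comm (i j : ℕ) (hi : i + 1 < m) (hj : j + 1 < m) (hij : i + 1 < j ∨ j + 1 < i) :
      BraidRel m (σ i hi * τ j hj) (τ j hj * σ i hi)
  | mixed (i : ℕ) (h : i + 1 < m) (h' : i + 1 + 1 < m) :
      BraidRel m (σ i h * τ (i + 1) h' * τ i h) (τ (i + 1) h' * τ i h * σ (i + 1) h')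

/-- The virtual braid group of degree `m`: the monoid of virtual braid diagrams modulo the
congruence generated by the defining relations. -/
def VB (m : ℕ) : Type := (conGen (BraidRel m)).Quotient

namespace VB

instance instMonoidVB (m : ℕ) : Monoid (VB m) :=
  inferInstanceAs (Monoid (conGen (BraidRel m)).Quotient)

/-- The virtual braid represented by a virtual braid diagram. -/
def mk {m : ℕ} : BraidDiagram m →* VB m := (conGen (BraidRel m)).mk'

theorem mk_surjective {m : ℕ} : Function.Surjective (mk (m := m)) := Con.mk'_surjective

theorem mk_eq_of_rel {m : ℕ} {u v : BraidDiagram m} (h : BraidRel m u v) : mk u = mk v :=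
  ((conGen (BraidRel m)).eq).2 (ConGen.Rel.of _ _ h)

/-- The generator `σ_{i+1}`. -/
def σ {m : ℕ} (i : ℕ) (h : i + 1 < m) : VB m := mk (BraidDiagram.σ i h)

/-- The generator `τ_{i+1}`. -/
def τ {m : ℕ} (i : ℕ) (h : i + 1 < m) : VB m := mk (BraidDiagram.τ i h)

theorem isUnit {m : ℕ} (b : VB m) : IsUnit b := by
  obtain ⟨w, rfl⟩ := mk_surjective b
  induction w using FreeMonoid.inductionOn' with
  | one => simp
  | of_mul l w ih =>
    rw [map_mul]
    refine IsUnit.mul ?_ ih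
    cases l with
    | σ i h =>
      have h1 := mk_eq_of_rel (BraidRel.σ_σinv i h)
      have h2 := mk_eq_of_rel (BraidRel.σinv_σ i h)
      rw [map_mul, map_one] at h1 h2
      exact ⟨⟨_, _, h1, h2⟩, rfl⟩
    | σinv i h =>
      have h1 := mk_eq_of_rel (BraidRel.σ_σinv i h)
      have h2 := mk_eq_of_rel (BraidRel.σinv_σ i h)
      rw [map_mul, map_one] at h1 h2
      exact ⟨⟨_, _, h2, h1⟩, rfl⟩
    | τ i h =>
      have h1 := mk_eq_of_rel (BraidRel.τ_sq i h)
      rw [map_mul, map_one] at h1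
      exact ⟨⟨_, _, h1, h1⟩, rfl⟩

noncomputable instance instGroupVB (m : ℕ) : Group (VB m) := groupOfIsUnit isUnit

theorem rel_shift {m : ℕ} (s t : ℕ) {u v : BraidDiagram m} (h : BraidRel m u v) :
    BraidRel (m + s + t) (BraidDiagram.ι s t u) (BraidDiagram.ι s t v) := by
  have e (i : ℕ) : i + 1 + s = i + s + 1 := by omega
  cases h with
  | σ_σinv i h => exact .σ_σinv (i + s) (by omega)
  | σinv_σ i h => exact .σinv_σ (i + s) (by omega)
  | σ_comm i j hi hj hij => exact .σ_comm (i + s) (j + s) (by omega) (by omega) (by omega)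
  | σ_braid i h h' =>
    have := BraidRel.σ_braid (m := m + s + t) (i + s) (by omega) (by omega)
    simpa [BraidDiagram.ι, BraidDiagram.σ, BraidLetter.shift, e] using this
  | τ_sq i h => exact .τ_sq (i + s) (by omega)
  | τ_comm i j hi hj hij => exact .τ_comm (i + s) (j + s) (by omega) (by omega) (by omega)
  | τ_braid i h h' =>
    have := BraidRel.τ_braid (m := m + s + t) (i + s) (by omega) (by omega)
    simpa [BraidDiagram.ι, BraidDiagram.τ, BraidLetter.shift, e] using this
  | σ_τ_comm i j hi hj hij => exact .σ_τ_comm (i + s) (j + s) (by omega) (by omega) (by omega)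
  | mixed i h h' =>
    have := BraidRel.mixed (m := m + s + t) (i + s) (by omega) (by omega)
    simpa [BraidDiagram.ι, BraidDiagram.σ, BraidDiagram.τ, BraidLetter.shift, e] using this

/-- The homomorphism `VB m → VB (m + s + t)` adding `s` trivial strands on the left and `t`
on the right. -/
def ι {m : ℕ} (s t : ℕ) : VB m →* VB (m + s + t) :=
  (conGen (BraidRel m)).lift (mk.comp (BraidDiagram.ι s t)) <|
    Con.conGen_le.2 fun _ _ h => mk_eq_of_rel (rel_shift s t h)

end VB

/-! ### Markov moves

A move relation below lists the moves in one direction; a finite sequence of moves and inverse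
moves is expressed in the theorem by `Relation.EqvGen`.  The condition `i + 1 = m` says that `i`
is the last of the places `0, …, m - 1`, so that `σ i` in degree `m + 1` is the generator `σ_m`. -/

open VB in
/-- The moves on virtual braids (of arbitrary degrees). -/
inductive BraidMove : (Σ m, VB m) → (Σ m, VB m) → Prop
  /-- conjugation -/
  | conj {m : ℕ} (b g : VB m) : BraidMove ⟨m, b⟩ ⟨m, g⁻¹ * b * g⟩
  /-- right stabilization of positive type -/
  | stab_pos {m : ℕ} (i : ℕ) (hi : i + 1 = m) (b : VB m) :
      BraidMove ⟨m, b⟩ ⟨m + 1, ι 0 1 b * σ i (by omega)⟩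
  /-- right stabilization of negative type -/
  | stab_neg {m : ℕ} (i : ℕ) (hi : i + 1 = m) (b : VB m) :
      BraidMove ⟨m, b⟩ ⟨m + 1, ι 0 1 b * (σ i (by omega))⁻¹⟩
  /-- right stabilization of virtual type -/
  | stab_virt {m : ℕ} (i : ℕ) (hi : i + 1 = m) (b : VB m) :
      BraidMove ⟨m, b⟩ ⟨m + 1, ι 0 1 b * τ i (by omega)⟩
  /-- right virtual exchange move -/
  | exchange_right {m : ℕ} (i : ℕ) (hi : i + 1 = m) (b₁ b₂ : VB m) :
      BraidMove ⟨m + 1, ι 0 1 b₁ * (σ i (by omega))⁻¹ * ι 0 1 b₂ * σ i (by omega)⟩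
        ⟨m + 1, ι 0 1 b₁ * τ i (by omega) * ι 0 1 b₂ * τ i (by omega)⟩
  /-- left virtual exchange move -/
  | exchange_left {m : ℕ} (hm : 0 < m) (b₁ b₂ : VB m) :
      BraidMove ⟨m + 1, ι 1 0 b₁ * (σ 0 (by omega))⁻¹ * ι 1 0 b₂ * σ 0 (by omega)⟩
        ⟨m + 1, ι 1 0 b₁ * τ 0 (by omega) * ι 1 0 b₂ * τ 0 (by omega)⟩

open BraidDiagram in
/-- The moves on virtual braid diagrams (of arbitrary degrees). -/
inductive BraidDiagramMove : (Σ m, BraidDiagram m) → (Σ m, BraidDiagram m) → Prop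
  /-- braid move: replace one side of a defining relation, inside a diagram, by the other -/
  | braid {m : ℕ} (x y u v : BraidDiagram m) (h : BraidRel m u v) :
      BraidDiagramMove ⟨m, x * u * y⟩ ⟨m, x * v * y⟩
  /-- conjugation -/
  | conj {m : ℕ} (b g : BraidDiagram m) : BraidDiagramMove ⟨m, b⟩ ⟨m, g.inv * b * g⟩
  /-- right stabilization of positive type -/
  | stab_pos {m : ℕ} (i : ℕ) (hi : i + 1 = m) (b : BraidDiagram m) :
      BraidDiagramMove ⟨m, b⟩ ⟨m + 1, ι 0 1 b * σ i (by omega)⟩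
  /-- right stabilization of negative type -/
  | stab_neg {m : ℕ} (i : ℕ) (hi : i + 1 = m) (b : BraidDiagram m) :
      BraidDiagramMove ⟨m, b⟩ ⟨m + 1, ι 0 1 b * σinv i (by omega)⟩
  /-- right stabilization of virtual type -/
  | stab_virt {m : ℕ} (i : ℕ) (hi : i + 1 = m) (b : BraidDiagram m) :
      BraidDiagramMove ⟨m, b⟩ ⟨m + 1, ι 0 1 b * τ i (by omega)⟩
  /-- right virtual exchange move -/
  | exchange_right {m : ℕ} (i : ℕ) (hi : i + 1 = m) (b₁ b₂ : BraidDiagram m) :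
      BraidDiagramMove ⟨m + 1, ι 0 1 b₁ * σinv i (by omega) * ι 0 1 b₂ * σ i (by omega)⟩
        ⟨m + 1, ι 0 1 b₁ * τ i (by omega) * ι 0 1 b₂ * τ i (by omega)⟩
  /-- left virtual exchange move -/
  | exchange_left {m : ℕ} (hm : 0 < m) (b₁ b₂ : BraidDiagram m) :
      BraidDiagramMove ⟨m + 1, ι 1 0 b₁ * σinv 0 (by omega) * ι 1 0 b₂ * σ 0 (by omega)⟩
        ⟨m + 1, ι 1 0 b₁ * τ 0 (by omega) * ι 1 0 b₂ * τ 0 (by omega)⟩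

/-! ### Virtual link diagrams

An oriented virtual link diagram in the plane is put in general position with respect to the
height: crossings, local maxima and local minima lie at distinct heights.  It is then cut by
horizontal lines into slices, each with exactly one crossing, maximum or minimum between
otherwise vertical strands, and is recorded, read from top to bottom, as the list of its slices.
Isotopy of the plane is generated on such sliced diagrams by the moves `IsotopyMove` below. -/

/-- The direction of an oriented strand where it meets a horizontal line. -/
inductive Dir
  | down
  | up

/-- The opposite direction. -/
def Dir.opp : Dir → Dir
  | down => up
  | up => down

/-- Crossing information.  Both strands run monotonically in height; the *falling* strand joins the
upper left to the lower right, the *rising* strand joins the lower left to the upper right.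
At a real crossing one of them is the over-strand. -/
inductive Crossing
  | fallingOver
  | risingOver
  | virt

/-- The crossing with the roles of the falling and the rising strand interchanged. -/
def Crossing.flip : Crossing → Crossing
  | fallingOver => risingOver
  | risingOver => fallingOver
  | virt => virt

/-- The singular part of a slice: a crossing, a local maximum (which, read downwards, creates two
strands, the left one with direction `d` and the right one with direction `d.opp`) or a local
minimum (which, read downwards, ends two adjacent strands of opposite directions). -/
inductive Piece
  | crossing (t : Crossing)
  | max (d : Dir)
  | min

/-- The number of strands of the piece at its top. -/
def Piece.top : Piece → ℕ
  | crossing _ => 2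
  | max _ => 0
  | min => 2

/-- The number of strands of the piece at its bottom. -/
def Piece.bot : Piece → ℕ
  | crossing _ => 2
  | max _ => 2
  | min => 0

/-- A slice: a piece with exactly `pos` vertical strands to its left (and any number of vertical
strands to its right). -/
structure Slice where
  piece : Piece
  pos : ℕ

/-- `Slice.Step s c s'`: the slice `c` fits below a horizontal line that meets the diagram in
strands of directions `s` (from left to right), and the strands on its lower line have
directions `s'`. -/
inductive Slice.Step : List Dir → Slice → List Dir → Prop
  | crossing (l r : List Dir) (a b : Dir) (t : Crossing) :
      Step (l ++ a :: b :: r) ⟨.crossing t, l.length⟩ (l ++ b :: a :: r)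
  | max (l r : List Dir) (d : Dir) :
      Step (l ++ r) ⟨.max d, l.length⟩ (l ++ d :: d.opp :: r)
  | min (l r : List Dir) (d : Dir) :
      Step (l ++ d :: d.opp :: r) ⟨.min, l.length⟩ (l ++ r)

/-- `Run s w s'`: the slices of `w`, read from top to bottom, fit together to an oriented tangle
diagram with directions `s` on the top line and `s'` on the bottom line. -/
inductive Run : List Dir → List Slice → List Dir → Prop
  | nil (s : List Dir) : Run s [] s
  | cons {s s' s'' : List Dir} {c : Slice} {w : List Slice} (h : c.Step s s') (hw : Run s' w s'') :
      Run s (c :: w) s''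

theorem Run.append {s s' s'' : List Dir} {u v : List Slice} (hu : Run s u s') (hv : Run s' v s'') :
    Run s (u ++ v) s'' := by
  induction hu with
  | nil s => exact hv
  | cons h _ ih => exact .cons h (ih hv)

/-- An oriented virtual link diagram: slices that fit together, with no free ends. -/
def LinkDiagram : Type := {w : List Slice // Run [] w []}

/-- The local moves of isotopy of the plane. -/
inductive IsotopyMove : List Slice → List Slice → Prop
  /-- two pieces side by side exchange their heights (`k` strands pass between them) -/
  | heights (p q : Piece) (i k : ℕ) :
      IsotopyMove [⟨p, i⟩, ⟨q, i + p.bot + k⟩] [⟨q, i + p.top + k⟩, ⟨p, i⟩]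
  /-- a minimum and a maximum on one strand cancel -/
  | zigzag_left (i : ℕ) (d : Dir) : IsotopyMove [⟨.max d, i + 1⟩, ⟨.min, i⟩] []
  | zigzag_right (i : ℕ) (d : Dir) : IsotopyMove [⟨.max d, i⟩, ⟨.min, i + 1⟩] []
  /-- a crossing slides along an arc through the minimum, or the maximum, of the arc -/
  | crossing_min (i : ℕ) (t : Crossing) :
      IsotopyMove [⟨.crossing t, i⟩, ⟨.min, i + 1⟩] [⟨.crossing t.flip, i + 1⟩, ⟨.min, i⟩]
  | crossing_max (i : ℕ) (d : Dir) (t : Crossing) :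
      IsotopyMove [⟨.max d, i⟩, ⟨.crossing t, i + 1⟩] [⟨.max d, i + 1⟩, ⟨.crossing t.flip, i⟩]

/-- Admissible crossings of a triangle formed by strands `1, 2, 3` (numbered from left to right
at the top): `a`, `b`, `c` are the crossings of the strands `1, 2`, of `1, 3` and of `2, 3`, at
each of which the strand of smaller number is the falling one.  Not admissible are
the triangles of real crossings without a top strand, and those with exactly one virtual crossing. -/
inductive Triangle : Crossing → Crossing → Crossing → Prop
  /-- all crossings real, the over-strand at two of them being the strand `1`, `2`, `3` -/
  | real₁ (c : Crossing) (hc : c ≠ .virt) : Triangle .fallingOver .fallingOver c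
  | real₂ (b : Crossing) (hb : b ≠ .virt) : Triangle .risingOver b .fallingOver
  | real₃ (a : Crossing) (ha : a ≠ .virt) : Triangle a .risingOver .risingOver
  /-- the strand `1`, `2`, `3` has only virtual crossings with the other two strands, the crossing
  of which is arbitrary -/
  | virt₁ (c : Crossing) : Triangle .virt .virt c
  | virt₂ (b : Crossing) : Triangle .virt b .virt
  | virt₃ (a : Crossing) : Triangle a .virt .virt

/-- The virtual Reidemeister moves, for all orientations of the strands.  `kink_left` and
`kink_right` are RI (for a real crossing) and VI (for a virtual one), `bigon` is RII (the same
strand is over at both crossings) and VII, and `triangle` is RIII, VIII and MI. -/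
inductive ReidemeisterMove : List Slice → List Slice → Prop
  | kink_right (i : ℕ) (d : Dir) (t : Crossing) :
      ReidemeisterMove [⟨.max d, i + 1⟩, ⟨.crossing t, i⟩, ⟨.min, i + 1⟩] []
  | kink_left (i : ℕ) (d : Dir) (t : Crossing) :
      ReidemeisterMove [⟨.max d, i⟩, ⟨.crossing t, i + 1⟩, ⟨.min, i⟩] []
  | bigon (i : ℕ) (t : Crossing) :
      ReidemeisterMove [⟨.crossing t, i⟩, ⟨.crossing t.flip, i⟩] []
  | triangle (i : ℕ) (a b c : Crossing) (h : Triangle a b c) :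
      ReidemeisterMove [⟨.crossing a, i⟩, ⟨.crossing b, i + 1⟩, ⟨.crossing c, i⟩]
        [⟨.crossing c, i + 1⟩, ⟨.crossing b, i⟩, ⟨.crossing a, i + 1⟩]

/-- Two diagrams differ by one local move: they agree except for a part `u`, respectively `v`,
and `u`, `v` have the same strands, with the same directions, on their top and bottom lines. -/
def LinkDiagram.Move (K K' : LinkDiagram) : Prop :=
  ∃ (x u v y : List Slice) (s s' : List Dir), (IsotopyMove u v ∨ ReidemeisterMove u v) ∧
    Run [] x s ∧ Run s u s' ∧ Run s v s' ∧ Run s' y [] ∧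
    K.1 = x ++ u ++ y ∧ K'.1 = x ++ v ++ y

/-- Equivalence of virtual link diagrams: finite sequences of isotopies of the plane and virtual
Reidemeister moves (and their inverses). -/
def LinkDiagram.setoid : Setoid LinkDiagram := Relation.EqvGen.setoid LinkDiagram.Move

/-- A virtual link (type): an equivalence class of virtual link diagrams. -/
def VirtualLink : Type := Quotient LinkDiagram.setoid

/-- The virtual link represented by a diagram. -/
def LinkDiagram.link (K : LinkDiagram) : VirtualLink := Quotient.mk LinkDiagram.setoid K

/-! ### Closures -/

/-- A crossing of a braid, both strands being oriented downwards: it is positive if the over-strand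
joins the upper right to the lower left. -/
def BraidLetter.slice {m : ℕ} : BraidLetter m → Slice
  | .σ i _ => ⟨.crossing .risingOver, i⟩
  | .σinv i _ => ⟨.crossing .fallingOver, i⟩
  | .τ i _ => ⟨.crossing .virt, i⟩

namespace BraidDiagram

/-- The slices of a braid diagram. -/
def slices {m : ℕ} (b : BraidDiagram m) : List Slice :=
  (FreeMonoid.toList b).map BraidLetter.slice

theorem slices_mul {m : ℕ} (b b' : BraidDiagram m) : (b * b').slices = b.slices ++ b'.slices := by
  simp [slices]

/-- `m` nested maxima, creating `m` downward strands and, to their right, `m` upward ones. -/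
def maxima (m : ℕ) : List Slice := (List.range m).map fun i => ⟨.max .down, i⟩

/-- `m` nested minima, joining `m` downward strands with `m` upward ones to their right. -/
def minima (m : ℕ) : List Slice := ((List.range m).map fun i => ⟨.min, i⟩).reverse

/-- The directions of the `2 * m` strands beside a braid diagram in its closure. -/
def strands (m : ℕ) : List Dir := List.replicate m .down ++ List.replicate m .up

theorem strands_succ (m : ℕ) :
    strands (m + 1) = List.replicate m .down ++ Dir.down :: Dir.up :: List.replicate m .up := by
  rw [strands, List.replicate_succ' (a := Dir.down), List.replicate_succ (a := Dir.up)]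
  simp

theorem run_maxima (m : ℕ) : Run [] (maxima m) (strands m) := by
  induction m with
  | zero => exact .nil _
  | succ m ih =>
    rw [maxima, List.range_succ, List.map_append, strands_succ]
    refine ih.append (.cons ?_ (.nil _))
    simpa [strands, Dir.opp] using Slice.Step.max (List.replicate m .down) (List.replicate m .up) .down

theorem run_minima (m : ℕ) : Run (strands m) (minima m) [] := by
  induction m with
  | zero => exact .nil _
  | succ m ih =>
    rw [minima, List.range_succ, List.map_append, List.reverse_append, strands_succ]
    refine .cons ?_ ih
    simpa [strands, Dir.opp] using Slice.Step.min (List.replicate m .down) (List.replicate m .up) .down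

theorem step_crossing {m : ℕ} (i : ℕ) (h : i + 1 < m) (t : Crossing) :
    Slice.Step (strands m) ⟨.crossing t, i⟩ (strands m) := by
  have e : strands m = List.replicate i .down ++
      .down :: .down :: (List.replicate (m - (i + 2)) .down ++ List.replicate m .up) := by
    obtain ⟨k, rfl⟩ : ∃ k, m = i + (2 + k) := ⟨m - (i + 2), by omega⟩
    have : i + (2 + k) - (i + 2) = k := by omega
    rw [this, strands, List.replicate_add i, List.replicate_add 2 k]
    simp [List.replicate_succ]
  have := Slice.Step.crossing (List.replicate i .down)
    (List.replicate (m - (i + 2)) .down ++ List.replicate m .up) .down .down t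
  rwa [← e, List.length_replicate] at this

theorem run_slices {m : ℕ} (b : BraidDiagram m) : Run (strands m) b.slices (strands m) := by
  induction b using FreeMonoid.inductionOn' with
  | one => exact .nil _
  | of_mul l w ih =>
    rw [slices_mul]
    refine Run.append (.cons ?_ (.nil _)) ih
    cases l with
    | σ i h => exact step_crossing i h _
    | σinv i h => exact step_crossing i h _
    | τ i h => exact step_crossing i h _

/-- The closure of a virtual braid diagram: the bottom end at each place is joined with the top
end at the same place by an arc on the right of the braid diagram, these `m` arcs being nested. -/
def closure {m : ℕ} (b : BraidDiagram m) : LinkDiagram :=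
  ⟨maxima m ++ b.slices ++ minima m, ((run_maxima m).append (run_slices b)).append (run_minima m)⟩

theorem closure_move {m : ℕ} (x y u v : BraidDiagram m)
    (h : IsotopyMove u.slices v.slices ∨ ReidemeisterMove u.slices v.slices) :
    (closure (x * u * y)).link = (closure (x * v * y)).link := by
  refine Quotient.sound (Relation.EqvGen.rel _ _
    ⟨maxima m ++ x.slices, u.slices, v.slices, y.slices ++ minima m, strands m, strands m, h,
      (run_maxima m).append (run_slices x), run_slices u, run_slices v,
      (run_slices y).append (run_minima m), ?_, ?_⟩)
  all_goals simp [closure, slices_mul]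

theorem heights_move (i j : ℕ) (hij : i + 1 < j) (t t' : Crossing) :
    IsotopyMove [⟨.crossing t, i⟩, ⟨.crossing t', j⟩] [⟨.crossing t', j⟩, ⟨.crossing t, i⟩] := by
  have := IsotopyMove.heights (.crossing t) (.crossing t') i (j - (i + 2))
  have e : i + 2 + (j - (i + 2)) = j := by omega
  simpa [Piece.top, Piece.bot, e] using this

/-- Diagrams that differ by a defining relation have equivalent closures. -/
theorem closure_rel {m : ℕ} (x y u v : BraidDiagram m) (h : BraidRel m u v) :
    (closure (x * u * y)).link = (closure (x * v * y)).link := by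
  cases h with
  | σ_σinv i h => exact closure_move _ _ _ _ (.inr (.bigon i .risingOver))
  | σinv_σ i h => exact closure_move _ _ _ _ (.inr (.bigon i .fallingOver))
  | σ_comm i j hi hj hij =>
    rcases hij with hij | hij
    · exact closure_move _ _ _ _ (.inl (heights_move i j hij _ _))
    · refine (closure_move _ _ _ _ (.inl ?_)).symm
      exact heights_move j i hij _ _
  | σ_braid i h h' =>
    exact closure_move _ _ _ _ (.inr (.triangle i _ _ _ (.real₃ .risingOver (by simp))))
  | τ_sq i h => exact closure_move _ _ _ _ (.inr (.bigon i .virt))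
  | τ_comm i j hi hj hij =>
    rcases hij with hij | hij
    · exact closure_move _ _ _ _ (.inl (heights_move i j hij _ _))
    · refine (closure_move _ _ _ _ (.inl ?_)).symm
      exact heights_move j i hij _ _
  | τ_braid i h h' => exact closure_move _ _ _ _ (.inr (.triangle i _ _ _ (.virt₁ .virt)))
  | σ_τ_comm i j hi hj hij =>
    rcases hij with hij | hij
    · exact closure_move _ _ _ _ (.inl (heights_move i j hij _ _))
    · refine (closure_move _ _ _ _ (.inl ?_)).symm
      exact heights_move j i hij _ _
  | mixed i h h' =>
    exact closure_move _ _ _ _ (.inr (.triangle i _ _ _ (.virt₃ .risingOver)))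

/-- The congruence of diagrams that are interchangeable in closures. -/
def closureCon (m : ℕ) : Con (BraidDiagram m) where
  r u v := ∀ x y, (closure (x * u * y)).link = (closure (x * v * y)).link
  iseqv := ⟨fun _ _ _ => rfl, fun h x y => (h x y).symm, fun h h' x y => (h x y).trans (h' x y)⟩
  mul' {u v u' v'} h h' x y := by
    have h1 := h x (u' * y)
    have h2 := h' (x * v) y
    simp only [mul_assoc] at h1 h2 ⊢
    exact h1.trans h2

theorem closure_congr {m : ℕ} (u v : BraidDiagram m) (h : conGen (BraidRel m) u v) :
    (closure u).link = (closure v).link := by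
  have hle : conGen (BraidRel m) ≤ closureCon m :=
    Con.conGen_le.2 fun u v huv x y => closure_rel x y u v huv
  simpa using hle h 1 1

end BraidDiagram

/-- The closure of a virtual braid, a virtual link: the class of the closure of any diagram. -/
def VB.closure {m : ℕ} (b : VB m) : VirtualLink :=
  Quotient.lift (fun w : BraidDiagram m => w.closure.link) BraidDiagram.closure_congr b

theorem VB.closure_mk {m : ℕ} (b : BraidDiagram m) : (VB.mk b).closure = b.closure.link := rfl

end VirtualKnot

/-!
A Markov class, here an element of `MarkovClass`, is a class of virtual braids of arbitrary degrees
under the moves; the task is to show that closure induces a bijection from Markov classes to their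
closures, i.e. that it is well defined and injective on them.

**Equivalent closures imply related braids.** A Markov class is attached to every sliced link
diagram in a way that does not depend on choices and is the class of `b` for the closure of `b`. The
virtual crossings are forgotten: cutting the diagram at every maximum and on both strands below
every real crossing labels its parts (`trace`), and what is recorded is which label follows which
along the orientation, and the list of real crossings, each with its two labels, its sign and the
information which label is over. A class `c` has these Gauss data (`Reps`) if some
`word D * (ofPerm ν)⁻¹` represents it, where `word D` is the product of the recorded crossings, made
between arbitrary strands of a braid by detours with virtual crossings, and the permutation braid
`(ofPerm ν)⁻¹` joins every label to its successor. That such products make sense is due to two facts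
about `VB m`: the symmetric group embeds as the subgroup of braids without real crossings
(`VB.ofPerm`), and by the mixed relation the real crossing `VB.x p q` between the strands at places
`p` and `q` does not depend on the detours. Every diagram has a class (`exists_reps`), which is
unique because renumbering the strands is a conjugation (`Reps.unique`).

The class does not change under the moves on diagrams (`LinkDiagram.HasClass.move`). As the data do
not see virtual crossings, the isotopies, the purely virtual moves and the mixed move only rename
labels, merge consecutive ones, which is a virtual stabilization, or reorder crossings of disjoint
pairs of strands, which commute. The classical moves come down to conjugations, stabilizations and
exchange moves between arbitrary strands. A crossing slides along a strand from a label to the next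
one (`VB.cl_slide`), which reduces RI to a stabilization (`VB.cl_kink`) and RIII to the braid
relation (`VB.cl_triangle`), if the directions of the three strands order the crossings acyclically.
In RII two crossings with opposite signs, adjacent on one strand but not necessarily in the braid,
cancel by an exchange move (`VB.cl_bigon`); inserting such a pair reduces the cyclic case of RIII to
the acyclic one (`VB.cl_triangle_cyclic`).

**Related braids have equivalent closures.** Each move is realized by isotopies and Reidemeister
moves of sliced diagrams (`closure_eq_of_braidMove`). For a conjugation a crossing travels through
the closing arcs (`link_closure_of_mul`), and a stabilization is a kink (`link_closure_stab`). In a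
right exchange move, the two crossings slide to the other sides of the maximum and the minimum of
the innermost closing arc, where they form a bigon, real or virtual. In a left exchange move the arc
that closes the leftmost strand is first swept virtually across the diagram to the left of it
(`tangleEquiv_close_left`).

The statement on diagrams follows from the one on braids, since braid moves connect any two diagrams
of a braid (`eqvGen_toBraid_iff`).
-/

namespace VirtualKnot

/-! ### Relations between the generators -/

namespace VB

variable {m : ℕ}

theorem mk_σinv (i : ℕ) (h : i + 1 < m) : mk (BraidDiagram.σinv i h) = (σ i h)⁻¹ := by
  have h1 := mk_eq_of_rel (BraidRel.σinv_σ i h)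
  rw [map_mul, map_one] at h1
  exact eq_inv_of_mul_eq_one_left h1

theorem σ_mul_σ_comm (i j : ℕ) (hi : i + 1 < m) (hj : j + 1 < m) (hij : i + 1 < j ∨ j + 1 < i) :
    σ i hi * σ j hj = σ j hj * σ i hi := by
  have e := mk_eq_of_rel (BraidRel.σ_comm i j hi hj hij)
  simp only [map_mul] at e
  exact e

theorem σ_braid (i : ℕ) (h : i + 1 < m) (h' : i + 1 + 1 < m) :
    σ i h * σ (i + 1) h' * σ i h = σ (i + 1) h' * σ i h * σ (i + 1) h' := by
  have e := mk_eq_of_rel (BraidRel.σ_braid i h h')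
  simp only [map_mul] at e
  exact e

theorem τ_mul_self (i : ℕ) (h : i + 1 < m) : τ i h * τ i h = 1 := by
  have e := mk_eq_of_rel (BraidRel.τ_sq i h)
  simp only [map_mul, map_one] at e
  exact e

theorem τ_inv (i : ℕ) (h : i + 1 < m) : (τ i h)⁻¹ = τ i h :=
  inv_eq_of_mul_eq_one_left (τ_mul_self i h)

theorem τ_mul_τ_comm (i j : ℕ) (hi : i + 1 < m) (hj : j + 1 < m) (hij : i + 1 < j ∨ j + 1 < i) :
    τ i hi * τ j hj = τ j hj * τ i hi := by
  have e := mk_eq_of_rel (BraidRel.τ_comm i j hi hj hij)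
  simp only [map_mul] at e
  exact e

theorem τ_braid (i : ℕ) (h : i + 1 < m) (h' : i + 1 + 1 < m) :
    τ i h * τ (i + 1) h' * τ i h = τ (i + 1) h' * τ i h * τ (i + 1) h' := by
  have e := mk_eq_of_rel (BraidRel.τ_braid i h h')
  simp only [map_mul] at e
  exact e

theorem σ_mul_τ_comm (i j : ℕ) (hi : i + 1 < m) (hj : j + 1 < m) (hij : i + 1 < j ∨ j + 1 < i) :
    σ i hi * τ j hj = τ j hj * σ i hi := by
  have e := mk_eq_of_rel (BraidRel.σ_τ_comm i j hi hj hij)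
  simp only [map_mul] at e
  exact e

theorem mixed (i : ℕ) (h : i + 1 < m) (h' : i + 1 + 1 < m) :
    σ i h * τ (i + 1) h' * τ i h = τ (i + 1) h' * τ i h * σ (i + 1) h' := by
  have e := mk_eq_of_rel (BraidRel.mixed i h h')
  simp only [map_mul] at e
  exact e

/-- A subset of the virtual braid group that contains `1` and absorbs, on the left, all generators
and the inverses of the `σ`'s, is everything. -/
theorem induction_left {P : VB m → Prop} (one : P 1) (hσ : ∀ i h b, P b → P (σ i h * b))
    (hσ' : ∀ i h b, P b → P ((σ i h)⁻¹ * b)) (hτ : ∀ i h b, P b → P (τ i h * b)) (b : VB m) :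
    P b := by
  obtain ⟨w, rfl⟩ := mk_surjective b
  induction w using FreeMonoid.inductionOn' with
  | one => simpa using one
  | of_mul l w ih =>
    rw [map_mul]
    cases l with
    | σ i h => exact hσ i h _ ih
    | σinv i h =>
      have := hσ' i h _ ih
      rwa [← mk_σinv] at this
    | τ i h => exact hτ i h _ ih

/-! ### Adding a strand -/

/-- Adding one trivial strand on the right. -/
def addRight (m : ℕ) : VB m →* VB (m + 1) := ι 0 1

/-- Adding one trivial strand on the left. -/
def addLeft (m : ℕ) : VB m →* VB (m + 1) := ι 1 0

theorem addRight_σ (i : ℕ) (h : i + 1 < m) :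
    addRight m (σ i h) = σ i (Nat.lt_succ_of_lt h) := rfl

theorem addRight_τ (i : ℕ) (h : i + 1 < m) :
    addRight m (τ i h) = τ i (Nat.lt_succ_of_lt h) := rfl

theorem addLeft_σ (i : ℕ) (h : i + 1 < m) :
    addLeft m (σ i h) = σ (i + 1) (Nat.succ_lt_succ h) := rfl

theorem addLeft_τ (i : ℕ) (h : i + 1 < m) :
    addLeft m (τ i h) = τ (i + 1) (Nat.succ_lt_succ h) := rfl

end VB

/-! ### The permutation braids -/

/-- The transposition of the adjacent places `i` and `i + 1`. -/
def adjSwap {m : ℕ} (i : ℕ) (h : i + 1 < m) : Equiv.Perm (Fin m) :=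
  Equiv.swap ⟨i, Nat.lt_of_succ_lt h⟩ ⟨i + 1, h⟩

theorem adjSwap_val {m : ℕ} (i : ℕ) (h : i + 1 < m) (k : Fin m) :
    (adjSwap i h k : ℕ) = if (k : ℕ) = i then i + 1 else if (k : ℕ) = i + 1 then i else k := by
  unfold adjSwap
  rw [Equiv.swap_apply_def]
  simp only [Fin.ext_iff]
  split_ifs <;> rfl

/-- The transposition of places underlying a letter. -/
def BraidLetter.perm {m : ℕ} : BraidLetter m → Equiv.Perm (Fin m)
  | .σ i h => adjSwap i h
  | .σinv i h => adjSwap i h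
  | .τ i h => adjSwap i h

namespace VB

variable {m : ℕ}

theorem perm_rel {u v : BraidDiagram m} (h : BraidRel m u v) :
    FreeMonoid.lift BraidLetter.perm u = FreeMonoid.lift BraidLetter.perm v := by
  have sq (i : ℕ) (h : i + 1 < m) : adjSwap i h * adjSwap i h = 1 := by simp [adjSwap]
  have comm (i j : ℕ) (hi : i + 1 < m) (hj : j + 1 < m) (hij : i + 1 < j ∨ j + 1 < i) :
      adjSwap i hi * adjSwap j hj = adjSwap j hj * adjSwap i hi := by
    ext k
    simp only [Equiv.Perm.mul_apply, adjSwap_val]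
    split_ifs <;> omega
  have braid (i : ℕ) (h : i + 1 < m) (h' : i + 1 + 1 < m) :
      adjSwap i h * adjSwap (i + 1) h' * adjSwap i h
        = adjSwap (i + 1) h' * adjSwap i h * adjSwap (i + 1) h' := by
    have h1 : (⟨i, by omega⟩ : Fin m) ≠ ⟨i + 1, h⟩ := by simp
    have h2 : (⟨i, by omega⟩ : Fin m) ≠ ⟨i + 1 + 1, h'⟩ := by simp [Fin.ext_iff]; omega
    have h3 : (⟨i + 1 + 1, h'⟩ : Fin m) ≠ ⟨i + 1, h⟩ := by simp
    have key (a b c : Fin m) (hab : a ≠ b) (hac : a ≠ c) (hcb : c ≠ b) :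
        Equiv.swap a b * Equiv.swap b c * Equiv.swap a b
          = Equiv.swap b c * Equiv.swap a b * Equiv.swap b c := by
      rw [Equiv.swap_mul_swap_mul_swap hab hac, Equiv.swap_comm a b, Equiv.swap_comm b c,
        Equiv.swap_mul_swap_mul_swap hcb hac.symm, Equiv.swap_comm]
    exact key _ _ _ h1 h2 h3
  cases h <;>
    simp only [BraidDiagram.σ, BraidDiagram.σinv, BraidDiagram.τ, map_mul, map_one,
      FreeMonoid.lift_eval_of, BraidLetter.perm]
  all_goals first | apply sq | (apply comm; assumption) | apply braid

/-- The permutation underlying a virtual braid. -/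
def perm : VB m →* Equiv.Perm (Fin m) :=
  (conGen (BraidRel m)).lift (FreeMonoid.lift BraidLetter.perm) <|
    Con.conGen_le.2 fun _ _ h => perm_rel h

theorem perm_σ (i : ℕ) (h : i + 1 < m) : perm (σ i h) = adjSwap i h := rfl

theorem perm_τ (i : ℕ) (h : i + 1 < m) : perm (τ i h) = adjSwap i h := rfl

/-- The subgroup of virtual braids without real crossings. -/
noncomputable def virtSubgroup (m : ℕ) : Subgroup (VB m) :=
  Subgroup.closure {b | ∃ i h, b = τ i h}

theorem τ_mem (i : ℕ) (h : i + 1 < m) : τ i h ∈ virtSubgroup m :=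
  Subgroup.subset_closure ⟨i, h, rfl⟩

/-- The virtual braid moving the last strand to the `k`-th last place, `k` counted from `0`, and
keeping the order of the other strands. -/
noncomputable def lastTo {m : ℕ} : ∀ k : ℕ, k < m → VB m
  | 0, _ => 1
  | k + 1, h => lastTo k (Nat.lt_of_succ_lt h) * τ (m - (k + 2)) (by omega)

theorem lastTo_perm {m : ℕ} : ∀ (k : ℕ) (h : k < m),
    ((perm (lastTo k h))⁻¹ ⟨m - 1, by omega⟩ : Fin m) = ⟨m - 1 - k, by omega⟩
  | 0, h => by simp [lastTo]
  | k + 1, h => by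
    have ih := lastTo_perm k (Nat.lt_of_succ_lt h)
    rw [lastTo, map_mul, mul_inv_rev, Equiv.Perm.mul_apply, ih, perm_τ]
    have : (adjSwap (m - (k + 2)) (by omega) : Equiv.Perm (Fin m))⁻¹ = adjSwap (m - (k + 2)) (by omega) := by
      simp [adjSwap]
    rw [this]
    ext
    rw [adjSwap_val]
    simp only
    split_ifs <;> omega

/-- Right multiplication of a braid `lastTo k` by a generator `τ i` is again such a braid, up to
a generator on the other strands. -/
theorem lastTo_mul_τ {m : ℕ} (k : ℕ) (h : k < m + 1) (i : ℕ) (hi : i + 1 < m + 1) :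
    ∃ t ∈ virtSubgroup m, ∃ (k' : ℕ) (h' : k' < m + 1),
      lastTo k h * τ i hi = addRight m t * lastTo k' h' := by
  have far : ∀ (k : ℕ) (h : k < m + 1) (i : ℕ) (hi : i + 1 < m + 1), i + 1 < m - k →
      lastTo k h * τ i hi = τ i hi * lastTo k h := by
    intro k
    induction k with
    | zero => intro h i hi _; simp [lastTo]
    | succ k ih =>
      intro h i hi hik
      rw [lastTo, mul_assoc, τ_mul_τ_comm _ i _ _ (by omega), ← mul_assoc,
        ih (by omega) i hi (by omega), mul_assoc]
  have near : ∀ (k : ℕ) (h : k < m + 1) (i : ℕ) (hi : i + 1 < m), m - k < i + 1 →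
      lastTo k h * τ (i + 1) (by omega) = τ i (by omega) * lastTo k h := by
    intro k
    induction k with
    | zero => intro h i hi hik; omega
    | succ k ih =>
      intro h i hi hik
      rcases Nat.lt_or_ge (m - k) (i + 1) with hlt | hge
      · rw [lastTo, mul_assoc, τ_mul_τ_comm _ (i + 1) _ _ (by omega), ← mul_assoc,
          ih (by omega) i hi hlt, mul_assoc]
      · obtain ⟨k', rfl⟩ : ∃ k', k = k' + 1 := ⟨k - 1, by omega⟩
        have e1 : m + 1 - (k' + 1 + 2) = i := by omega
        have e2 : m + 1 - (k' + 2) = i + 1 := by omega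
        simp only [lastTo, e1, e2]
        rw [mul_assoc, mul_assoc, ← mul_assoc (τ (i + 1) _), ← τ_braid, ← mul_assoc, ← mul_assoc,
          far k' (by omega) i (by omega) (by omega)]
        simp only [mul_assoc]
  rcases lt_trichotomy (i + 1) (m - k) with hlt | heq | hgt
  · exact ⟨τ i (by omega), τ_mem _ _, k, h, by rw [far k h i hi hlt, addRight_τ]⟩
  · refine ⟨1, one_mem _, k + 1, by omega, ?_⟩
    have e : m + 1 - (k + 2) = i := by omega
    simp [lastTo, e]
  · rcases Nat.lt_or_ge (m - k) i with hlt | hge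
    · obtain ⟨j, rfl⟩ : ∃ j, i = j + 1 := ⟨i - 1, by omega⟩
      exact ⟨τ j (by omega), τ_mem _ _, k, h, by rw [near k h j (by omega) hlt, addRight_τ]⟩
    · obtain ⟨k', rfl⟩ : ∃ k', k = k' + 1 := ⟨k - 1, by omega⟩
      refine ⟨1, one_mem _, k', by omega, ?_⟩
      have e : m + 1 - (k' + 2) = i := by omega
      simp [lastTo, e, mul_assoc, τ_mul_self]

theorem exists_lastTo {m : ℕ} {b : VB (m + 1)} (hb : b ∈ virtSubgroup (m + 1)) :
    ∃ t ∈ virtSubgroup m, ∃ (k : ℕ) (h : k < m + 1), b = addRight m t * lastTo k h := by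
  induction hb using Subgroup.closure_induction_right with
  | one => exact ⟨1, one_mem _, 0, by omega, by simp [lastTo]⟩
  | mul_right x hx y hy ih =>
    obtain ⟨t, ht, k, h, rfl⟩ := ih
    obtain ⟨i, hi, rfl⟩ := hy
    obtain ⟨t', ht', k', h', e⟩ := lastTo_mul_τ k h i hi
    exact ⟨t * t', mul_mem ht ht', k', h', by rw [mul_assoc, e, map_mul, mul_assoc]⟩
  | mul_inv_cancel x hx y hy ih =>
    obtain ⟨t, ht, k, h, rfl⟩ := ih
    obtain ⟨i, hi, rfl⟩ := hy
    obtain ⟨t', ht', k', h', e⟩ := lastTo_mul_τ k h i hi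
    exact ⟨t * t', mul_mem ht ht', k', h', by rw [τ_inv, mul_assoc, e, map_mul, mul_assoc]⟩

theorem perm_addRight {m : ℕ} (b : VB m) :
    perm (addRight m b) (Fin.last m) = Fin.last m ∧
      ∀ k : Fin m, perm (addRight m b) k.castSucc = (perm b k).castSucc := by
  have key (i : ℕ) (h : i + 1 < m) :
      adjSwap i (Nat.lt_succ_of_lt h) (Fin.last m) = Fin.last m ∧
      ∀ k : Fin m, adjSwap i (Nat.lt_succ_of_lt h) k.castSucc = (adjSwap i h k).castSucc := by
    constructor
    · ext; rw [adjSwap_val]; simp only [Fin.val_last]; split_ifs <;> omega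
    · intro k; ext; rw [adjSwap_val]; simp only [Fin.val_castSucc, adjSwap_val]
  have hinv (i : ℕ) (h : i + 1 < m) : (adjSwap i h)⁻¹ = adjSwap i h := by simp [adjSwap]
  have hinv' (i : ℕ) (h : i + 1 < m + 1) : (adjSwap i h)⁻¹ = adjSwap i h := by simp [adjSwap]
  induction b using induction_left with
  | one => simp
  | hσ i h b ih =>
    simp only [map_mul, addRight_σ, perm_σ, Equiv.Perm.mul_apply, ih.1, ih.2]
    exact ⟨(key i h).1, fun k => (key i h).2 _⟩
  | hσ' i h b ih =>
    simp only [map_mul, map_inv, addRight_σ, perm_σ, hinv, hinv', Equiv.Perm.mul_apply, ih.1, ih.2]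
    exact ⟨(key i h).1, fun k => (key i h).2 _⟩
  | hτ i h b ih =>
    simp only [map_mul, addRight_τ, perm_τ, Equiv.Perm.mul_apply, ih.1, ih.2]
    exact ⟨(key i h).1, fun k => (key i h).2 _⟩

/-- A virtual braid without real crossings is determined by its permutation. -/
theorem eq_one_of_perm_eq_one : ∀ {m : ℕ} {b : VB m}, b ∈ virtSubgroup m → perm b = 1 → b = 1
  | 0, b, hb, _ => by
    have : ({b | ∃ i h, b = τ i h} : Set (VB 0)) = ∅ := by
      ext b; simp
    rw [virtSubgroup, this, Subgroup.closure_empty] at hb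
    exact hb
  | m + 1, b, hb, h1 => by
    obtain ⟨t, ht, k, h, rfl⟩ := exists_lastTo hb
    have hk : k = 0 := by
      have h2 := lastTo_perm k h
      rw [map_mul, mul_eq_one_iff_inv_eq] at h1
      have h3 : (perm (lastTo k h))⁻¹ = perm (addRight m t) := by rw [← h1, inv_inv]
      rw [h3] at h2
      have h4 := (perm_addRight t).1
      have e : (⟨m + 1 - 1, by omega⟩ : Fin (m + 1)) = Fin.last m := rfl
      rw [e, h4] at h2
      have := congrArg Fin.val h2
      simp at this
      omega
    subst hk
    simp only [lastTo, mul_one] at h1 ⊢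
    have : perm t = 1 := by
      ext k
      have h5 := (perm_addRight t).2 k
      rw [h1] at h5
      have := congrArg Fin.val h5
      simpa using this.symm
    rw [eq_one_of_perm_eq_one ht this, map_one]

theorem perm_surjOn_virt (g : Equiv.Perm (Fin m)) : ∃ b ∈ virtSubgroup m, perm b = g := by
  cases m with
  | zero => exact ⟨1, one_mem _, Subsingleton.elim _ _⟩
  | succ m =>
    have hg : g ∈ Submonoid.closure
        (Set.range fun i : Fin m ↦ Equiv.swap i.castSucc i.succ) := by
      rw [Equiv.Perm.mclosure_swap_castSucc_succ]; trivial
    induction hg using Submonoid.closure_induction with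
    | mem x hx =>
      obtain ⟨i, rfl⟩ := hx
      exact ⟨τ i (by omega), τ_mem _ _, rfl⟩
    | one => exact ⟨1, one_mem _, map_one _⟩
    | mul x y _ _ hx hy =>
      obtain ⟨a, ha, rfl⟩ := hx
      obtain ⟨b, hb, rfl⟩ := hy
      exact ⟨a * b, mul_mem ha hb, map_mul _ _ _⟩

/-- The virtual braids without real crossings, identified with the permutations. -/
noncomputable def permEquiv (m : ℕ) : virtSubgroup m ≃* Equiv.Perm (Fin m) :=
  MulEquiv.ofBijective (perm.comp (virtSubgroup m).subtype) <| by
    constructor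
    · rw [injective_iff_map_eq_one]
      rintro ⟨b, hb⟩ h
      exact Subtype.ext (eq_one_of_perm_eq_one hb h)
    · intro g
      obtain ⟨b, hb, rfl⟩ := perm_surjOn_virt g
      exact ⟨⟨b, hb⟩, rfl⟩

/-- The virtual braid without real crossings whose strand beginning at the place `g i` ends at the
place `i`. -/
noncomputable def ofPerm : Equiv.Perm (Fin m) →* VB m :=
  (virtSubgroup m).subtype.comp (permEquiv m).symm.toMonoidHom

theorem ofPerm_eq {b : VB m} (hb : b ∈ virtSubgroup m) {g : Equiv.Perm (Fin m)} (h : perm b = g) :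
    ofPerm g = b := by
  have : (permEquiv m).symm g = ⟨b, hb⟩ := by
    rw [MulEquiv.symm_apply_eq]; exact h.symm
  change ((permEquiv m).symm g : VB m) = b
  rw [this]

theorem ofPerm_adjSwap (i : ℕ) (h : i + 1 < m) : ofPerm (adjSwap i h) = τ i h :=
  ofPerm_eq (τ_mem i h) (perm_τ i h)

end VB

end VirtualKnot

namespace VirtualKnot

namespace VB

variable {m : ℕ}

theorem perm_ofPerm (g : Equiv.Perm (Fin m)) : perm (ofPerm g) = g :=
  (permEquiv m).apply_symm_apply g

theorem ofPerm_mem (g : Equiv.Perm (Fin m)) : ofPerm g ∈ virtSubgroup m :=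
  ((permEquiv m).symm g).2

/-! ### The crossings between arbitrary strands -/

theorem exists_perm_extending {α : Type*} {k : ℕ} (f f' : Fin k → α) (hf : Function.Injective f)
    (hf' : Function.Injective f') : ∃ g : Equiv.Perm α, ∀ i, g (f i) = f' i := by
  have := Equiv.Perm.isMultiplyPretransitive α k
  obtain ⟨g, hg⟩ := this.exists_smul_eq ⟨f, hf⟩ ⟨f', hf'⟩
  exact ⟨g, fun i => DFunLike.congr_fun hg i⟩

/-- A subgroup of a permutation group that contains the transpositions of the elements
outside of `T` contains all permutations fixing `T` pointwise. -/
theorem mem_of_swap_mem {α : Type*} [Fintype α] [DecidableEq α] (T : α → Prop) [DecidablePred T]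
    (H : Subgroup (Equiv.Perm α)) (hH : ∀ a b, ¬ T a → ¬ T b → Equiv.swap a b ∈ H)
    (g : Equiv.Perm α) (hg : ∀ a, T a → g a = a) : g ∈ H := by
  have h1 : ∀ a, ¬ T a ↔ ¬ T (g a) := by
    intro a
    constructor
    · intro h h'
      exact h (by rwa [g.injective (hg _ h')] at h')
    · intro h h'
      exact h (by rwa [hg _ h'])
  have h2 : Equiv.Perm.ofSubtype (g.subtypePerm (p := fun a => ¬ T a) (fun a => (h1 a).symm)) = g :=
    Equiv.Perm.ofSubtype_subtypePerm _ (fun a ha h' => ha (hg a h'))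
  rw [← h2]
  induction (g.subtypePerm (p := fun a => ¬ T a) (fun a => (h1 a).symm))
    using Equiv.Perm.swap_induction_on with
  | one => rw [map_one]; exact one_mem _
  | swap_mul f x y _ ih =>
    rw [map_mul, Equiv.Perm.ofSubtype_swap_eq]
    exact mul_mem (hH _ _ x.2 y.2) ih

/-- The permutations fixing the first two places are products of transpositions of the other places,
which far commutativity deals with. -/
theorem ofPerm_commute_σ_zero (h0 : 0 + 1 < m) (g : Equiv.Perm (Fin m))
    (hg0 : g ⟨0, by omega⟩ = ⟨0, by omega⟩) (hg1 : g ⟨1, h0⟩ = ⟨1, h0⟩) :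
    Commute (ofPerm g) (σ 0 h0) := by
  let H : Subgroup (Equiv.Perm (Fin m)) :=
    (Subgroup.centralizer {(σ 0 h0 : VB m)}).comap ofPerm
  have hmem (g) : g ∈ H ↔ Commute (ofPerm g) (σ 0 h0) := by
    simp only [H, Subgroup.mem_comap, Subgroup.mem_centralizer_singleton_iff]
    rfl
  rw [← hmem]
  refine mem_of_swap_mem (fun a : Fin m => (a : ℕ) < 2) H ?_ g ?_
  · have adj (i : ℕ) (hi : i + 1 < m) (h2 : 2 ≤ i) : adjSwap i hi ∈ H := by
      rw [hmem, ofPerm_adjSwap]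
      exact (σ_mul_τ_comm 0 i h0 hi (by omega)).symm
    have key : ∀ (d i : ℕ) (hi : i + d < m), 2 ≤ i →
        Equiv.swap (⟨i, by omega⟩ : Fin m) ⟨i + d, hi⟩ ∈ H := by
      intro d
      induction d with
      | zero =>
        intro i hi _
        have : Equiv.swap (⟨i, by omega⟩ : Fin m) ⟨i + 0, hi⟩ = 1 := Equiv.swap_self _
        rw [this]; exact one_mem _
      | succ d ih =>
        intro i hi h2
        rcases Nat.eq_zero_or_pos d with rfl | hd
        · exact adj i hi h2
        · have h3 := ih i (by omega) h2
          have h4 := adj (i + d) (by omega) (by omega)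
          have h5 := mul_mem (mul_mem h4 h3) (inv_mem h4)
          rw [Equiv.mul_swap_eq_swap_mul, mul_inv_cancel_right] at h5
          convert h5 using 2
          · ext; rw [adjSwap_val]; simp only; split_ifs <;> omega
          · ext; rw [adjSwap_val]; simp only; split_ifs <;> omega
    intro a b ha hb
    rcases le_total (a : ℕ) b with hab | hab
    · have := key (b - a) a (by omega) (by omega)
      convert this using 2
      ext; simp only; omega
    · have := key (a - b) b (by omega) (by omega)
      rw [Equiv.swap_comm]
      convert this using 2
      ext; simp only; omega
  · intro a ha
    obtain ⟨a, ha'⟩ := a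
    simp only at ha
    interval_cases a
    · exact hg0
    · exact hg1

theorem ofPerm_conj_τ (g : Equiv.Perm (Fin m)) (i j : ℕ) (hi : i + 1 < m) (hj : j + 1 < m)
    (h : g ⟨i, by omega⟩ = ⟨j, by omega⟩) (h' : g ⟨i + 1, hi⟩ = ⟨j + 1, hj⟩) :
    ofPerm g * τ i hi * (ofPerm g)⁻¹ = τ j hj := by
  rw [← ofPerm_adjSwap, ← ofPerm_adjSwap, ← map_inv, ← map_mul, ← map_mul, adjSwap,
    Equiv.mul_swap_eq_swap_mul, mul_inv_cancel_right, h, h']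
  rfl

/-- By the mixed relation, the permutation braid `τ i * τ (i + 1)` conjugates `σ i` to `σ (i + 1)`,
so that every `σ i` is a conjugate of `σ 0` by a permutation braid. -/
theorem exists_σ_eq_conj (i : ℕ) (hi : i + 1 < m) : ∃ g : Equiv.Perm (Fin m),
    g ⟨0, by omega⟩ = ⟨i, by omega⟩ ∧ g ⟨1, by omega⟩ = ⟨i + 1, hi⟩ ∧
      σ i hi = ofPerm g * σ 0 (by omega) * (ofPerm g)⁻¹ := by
  induction i with
  | zero => exact ⟨1, rfl, rfl, by simp⟩
  | succ i ih =>
    obtain ⟨g, h0, h1, e⟩ := ih (by omega)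
    refine ⟨adjSwap i (by omega) * adjSwap (i + 1) hi * g, ?_, ?_, ?_⟩
    · ext
      simp only [Equiv.Perm.mul_apply, adjSwap_val, h0]
      split_ifs <;> omega
    · ext
      simp only [Equiv.Perm.mul_apply, adjSwap_val, h1]
      split_ifs <;> omega
    · have hm := mixed i (by omega) hi
      have h2 : σ (i + 1) hi = τ i (by omega) * τ (i + 1) hi * σ i (by omega) * τ (i + 1) hi
          * τ i (by omega) := by
        rw [mul_assoc, mul_assoc, ← mul_assoc (σ i _), hm, ← mul_assoc, ← mul_assoc,
          mul_assoc (τ i _), τ_mul_self, mul_one, τ_mul_self, one_mul]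
      rw [h2, e]
      simp only [map_mul, ofPerm_adjSwap, mul_inv_rev, τ_inv, mul_assoc]

open Classical in
/-- The pure virtual braid in which the strand at the place `p` passes under the strand at the
place `q`, by a positive crossing, and all other crossings are virtual.  If `p = q`, no permutation
is as required, and the value is `1`. -/
noncomputable def x (p q : Fin m) : VB m :=
  if h : ∃ (h0 : 0 + 1 < m) (g : Equiv.Perm (Fin m)), g ⟨0, by omega⟩ = p ∧ g ⟨1, h0⟩ = q then
    ofPerm h.choose_spec.choose * (σ 0 h.choose * τ 0 h.choose) * (ofPerm h.choose_spec.choose)⁻¹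
  else 1

/-- The conjugate on the left depends only on the images of the places `i` and `i + 1`: if `i = 0`,
two permutations with the same images there differ by one that fixes the first two places. -/
theorem conj_σ_mul_τ (i : ℕ) (hi : i + 1 < m) (g : Equiv.Perm (Fin m)) :
    ofPerm g * (σ i hi * τ i hi) * (ofPerm g)⁻¹ = x (g ⟨i, by omega⟩) (g ⟨i + 1, hi⟩) := by
  obtain ⟨k, hk0, hk1, e⟩ := exists_σ_eq_conj i hi
  have e' := ofPerm_conj_τ k 0 i (by omega) hi hk0 hk1
  have h : ∃ (h0 : 0 + 1 < m) (g' : Equiv.Perm (Fin m)),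
      g' ⟨0, by omega⟩ = g ⟨i, by omega⟩ ∧ g' ⟨1, h0⟩ = g ⟨i + 1, hi⟩ :=
    ⟨by omega, g * k, by simp [hk0], by simp [hk1]⟩
  rw [x, dif_pos h]
  have h0 := h.choose_spec.choose_spec.1
  have h1 := h.choose_spec.choose_spec.2
  set g' := h.choose_spec.choose
  have hc := ofPerm_commute_σ_zero (by omega) (g'⁻¹ * (g * k))
    (by simp only [Equiv.Perm.mul_apply, hk0, ← h0, Equiv.Perm.coe_inv, Equiv.symm_apply_apply])
    (by simp only [Equiv.Perm.mul_apply, hk1, ← h1, Equiv.Perm.coe_inv, Equiv.symm_apply_apply])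
  have hc' := ofPerm_conj_τ (g'⁻¹ * (g * k)) 0 0 (by omega) (by omega)
    (by simp only [Equiv.Perm.mul_apply, hk0, ← h0, Equiv.Perm.coe_inv, Equiv.symm_apply_apply])
    (by simp only [Equiv.Perm.mul_apply, hk1, zero_add, ← h1, Equiv.Perm.coe_inv, Equiv.symm_apply_apply])
  have hc2 : ofPerm (g'⁻¹ * (g * k)) * σ 0 (by omega) * (ofPerm (g'⁻¹ * (g * k)))⁻¹
      = σ 0 (by omega) := by rw [hc.eq, mul_inv_cancel_right]
  rw [← e', e]
  conv_rhs => rw [← hc', ← hc2]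
  simp only [map_mul, map_inv]
  group

theorem x_succ (i : ℕ) (hi : i + 1 < m) : x ⟨i, by omega⟩ ⟨i + 1, hi⟩ = σ i hi * τ i hi := by
  have := conj_σ_mul_τ i hi 1
  simpa using this.symm

theorem ofPerm_conj_x (g : Equiv.Perm (Fin m)) (p q : Fin m) :
    ofPerm g * x p q * (ofPerm g)⁻¹ = x (g p) (g q) := by
  by_cases h : ∃ (h0 : 0 + 1 < m) (k : Equiv.Perm (Fin m)), k ⟨0, by omega⟩ = p ∧ k ⟨1, h0⟩ = q
  · obtain ⟨h0, k, rfl, rfl⟩ := h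
    have e1 := conj_σ_mul_τ 0 h0 k
    have e2 := conj_σ_mul_τ 0 h0 (g * k)
    simp only [zero_add] at e1 e2
    rw [← e1]
    simp only [Equiv.Perm.mul_apply] at e2
    rw [← e2, map_mul]
    group
  · have h' : ¬ ∃ (h0 : 0 + 1 < m) (k : Equiv.Perm (Fin m)),
        k ⟨0, by omega⟩ = g p ∧ k ⟨1, h0⟩ = g q := by
      rintro ⟨h0, k, e1, e2⟩
      exact h ⟨h0, g⁻¹ * k, by simp [e1], by simp [e2]⟩
    rw [x, x, dif_neg h, dif_neg h']
    simp

theorem x_commute {p q r t : Fin m} (hpq : p ≠ q) (hrt : r ≠ t) (hpr : p ≠ r) (hpt : p ≠ t)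
    (hqr : q ≠ r) (hqt : q ≠ t) : Commute (x p q) (x r t) := by
  have hm : 3 < m := by
    simp only [ne_eq, Fin.ext_iff] at *
    omega
  obtain ⟨g, hg⟩ := exists_perm_extending (Fin.castLE hm) ![p, q, r, t] (Fin.castLE_injective _)
    (by
      intro i j
      fin_cases i <;> fin_cases j <;> simp [hpq, hrt, hpr, hpt, hqr, hqt, hpq.symm, hrt.symm,
        hpr.symm, hpt.symm, hqr.symm, hqt.symm])
  have e0 : g ⟨0, by omega⟩ = p := hg 0
  have e1 : g ⟨1, by omega⟩ = q := hg 1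
  have e2 : g ⟨2, by omega⟩ = r := hg 2
  have e3 : g ⟨3, by omega⟩ = t := hg 3
  rw [← e0, ← e1, ← e2, ← e3, ← ofPerm_conj_x, ← ofPerm_conj_x]
  refine (Commute.conj_iff _).2 ?_
  rw [x_succ 0, x_succ 2]
  refine Commute.mul_left (Commute.mul_right ?_ ?_) (Commute.mul_right ?_ ?_)
  · exact σ_mul_σ_comm _ _ _ _ (by omega)
  · exact σ_mul_τ_comm _ _ _ _ (by omega)
  · exact (σ_mul_τ_comm _ _ _ _ (by omega)).symm
  · exact τ_mul_τ_comm _ _ _ _ (by omega)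

/-- The third Reidemeister move for the bottom strand `p`, the middle strand `q` and the top
strand `r`. -/
theorem yang_baxter {p q r : Fin m} (hpq : p ≠ q) (hpr : p ≠ r) (hqr : q ≠ r) :
    x p q * x p r * x q r = x q r * x p r * x p q := by
  have hm : 2 < m := by
    simp only [ne_eq, Fin.ext_iff] at *
    omega
  obtain ⟨g, hg⟩ := exists_perm_extending (Fin.castLE hm) ![p, q, r] (Fin.castLE_injective _)
    (by
      intro i j
      fin_cases i <;> fin_cases j <;> simp [hpq, hpr, hqr, hpq.symm, hpr.symm, hqr.symm])
  have e0 : g ⟨0, by omega⟩ = p := hg 0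
  have e1 : g ⟨1, by omega⟩ = q := hg 1
  have e2 : g ⟨2, by omega⟩ = r := hg 2
  rw [← e0, ← e1, ← e2, ← ofPerm_conj_x, ← ofPerm_conj_x, ← ofPerm_conj_x]
  have h02 : x (⟨0, by omega⟩ : Fin m) ⟨2, by omega⟩
      = τ 1 hm * (σ 0 (by omega) * τ 0 (by omega)) * τ 1 hm := by
    have := conj_σ_mul_τ 0 (by omega) (adjSwap 1 hm)
    rw [ofPerm_adjSwap, τ_inv] at this
    rw [this]
    congr 1
  rw [h02, x_succ 0, x_succ 1]
  have hs := σ_braid 0 (by omega) hm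
  have ht := τ_braid 0 (by omega) hm
  have hx := mixed 0 (by omega) hm
  have t0 := τ_mul_self (m := m) 0 (by omega)
  have t1 := τ_mul_self (m := m) 1 hm
  simp only [zero_add] at hs ht hx
  generalize σ (m := m) 0 _ = s0 at *
  generalize σ (m := m) 1 _ = s1 at *
  generalize τ (m := m) 0 _ = a at *
  generalize τ (m := m) 1 _ = b at *
  -- the mixed relation carries `σ`'s through pairs of virtual crossings
  have hy : s1 * a * b = a * b * s0 := by
    calc s1 * a * b = a * b * (b * a * s1) * (a * b) := by
          simp only [mul_assoc]
          rw [← mul_assoc b b, t1, one_mul, ← mul_assoc a a, t0, one_mul]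
      _ = a * b * s0 := by
          rw [← hx]
          simp only [mul_assoc]
          rw [← mul_assoc a a, t0, one_mul, t1, mul_one]
  have key : s0 * a * (b * (s0 * a) * b) * (s1 * b) = s1 * b * (b * (s0 * a) * b) * (s0 * a) := by
    calc s0 * a * (b * (s0 * a) * b) * (s1 * b) = s0 * (a * b * s0) * a * b * s1 * b := by
          simp only [mul_assoc]
      _ = s0 * s1 * (a * b * a) * b * s1 * b := by rw [← hy]; simp only [mul_assoc]
      _ = s0 * s1 * (b * a * s1) * b := by
          rw [ht]; simp only [mul_assoc]; rw [← mul_assoc b b, t1, one_mul]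
      _ = s1 * s0 * s1 * (b * a * b) := by rw [← hx, ← hs]; simp only [mul_assoc]
      _ = s1 * s0 * (s1 * a * b) * a := by rw [← ht]; simp only [mul_assoc]
      _ = s1 * b * (b * (s0 * a) * b) * (s0 * a) := by
          rw [hy]; simp only [mul_assoc]; rw [← mul_assoc b b, t1, one_mul]
  generalize ofPerm g = G
  calc G * (s0 * a) * G⁻¹ * (G * (b * (s0 * a) * b) * G⁻¹) * (G * (s1 * b) * G⁻¹)
      = G * (s0 * a * (b * (s0 * a) * b) * (s1 * b)) * G⁻¹ := by group
    _ = G * (s1 * b * (b * (s0 * a) * b) * (s0 * a)) * G⁻¹ := by rw [key]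
    _ = _ := by group

/-! ### Braids in which a strand is idle -/

/-- The virtual braids in which the strand at the place `l` is straight and has no real
crossing. -/
noncomputable def idle (l : Fin m) : Subgroup (VB m) :=
  Subgroup.closure ({b | ∃ p q, p ≠ l ∧ q ≠ l ∧ b = x p q} ∪ {b | ∃ g, g l = l ∧ b = ofPerm g})

theorem x_mem_idle {l p q : Fin m} (hp : p ≠ l) (hq : q ≠ l) : x p q ∈ idle l :=
  Subgroup.subset_closure (.inl ⟨p, q, hp, hq, rfl⟩)

theorem ofPerm_mem_idle {l : Fin m} {g : Equiv.Perm (Fin m)} (hg : g l = l) : ofPerm g ∈ idle l :=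
  Subgroup.subset_closure (.inr ⟨g, hg, rfl⟩)

theorem conj_mem_idle {l l' : Fin m} (g : Equiv.Perm (Fin m)) (hl : g l = l') {b : VB m}
    (hb : b ∈ idle l) : ofPerm g * b * (ofPerm g)⁻¹ ∈ idle l' := by
  subst hl
  induction hb using Subgroup.closure_induction with
  | mem b hb =>
    rcases hb with ⟨p, q, hp, hq, rfl⟩ | ⟨h, hh, rfl⟩
    · rw [ofPerm_conj_x]
      exact x_mem_idle (by simpa using hp) (by simpa using hq)
    · rw [← map_inv, ← map_mul, ← map_mul]
      exact ofPerm_mem_idle (by simp [hh])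
  | one => simp
  | mul a b _ _ ha hb =>
    have := mul_mem ha hb
    convert this using 1
    group
  | inv a _ ha =>
    have := inv_mem ha
    convert this using 1
    group

theorem perm_addLeft (b : VB m) :
    perm (addLeft m b) 0 = 0 ∧ ∀ k : Fin m, perm (addLeft m b) k.succ = (perm b k).succ := by
  have key (i : ℕ) (h : i + 1 < m) :
      adjSwap (i + 1) (Nat.succ_lt_succ h) 0 = 0 ∧
      ∀ k : Fin m, adjSwap (i + 1) (Nat.succ_lt_succ h) k.succ = (adjSwap i h k).succ := by
    constructor
    · ext; rw [adjSwap_val]; simp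
    · intro k; ext; rw [adjSwap_val]; simp only [Fin.val_succ, adjSwap_val]; split_ifs <;> omega
  have hinv (i : ℕ) (h : i + 1 < m) : (adjSwap i h)⁻¹ = adjSwap i h := by simp [adjSwap]
  have hinv' (i : ℕ) (h : i + 1 < m + 1) : (adjSwap i h)⁻¹ = adjSwap i h := by simp [adjSwap]
  induction b using induction_left with
  | one => simp
  | hσ i h b ih =>
    simp only [map_mul, addLeft_σ, perm_σ, Equiv.Perm.mul_apply, ih.1, ih.2]
    exact ⟨(key i h).1, fun k => (key i h).2 _⟩
  | hσ' i h b ih =>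
    simp only [map_mul, map_inv, addLeft_σ, perm_σ, hinv, hinv', Equiv.Perm.mul_apply, ih.1, ih.2]
    exact ⟨(key i h).1, fun k => (key i h).2 _⟩
  | hτ i h b ih =>
    simp only [map_mul, addLeft_τ, perm_τ, Equiv.Perm.mul_apply, ih.1, ih.2]
    exact ⟨(key i h).1, fun k => (key i h).2 _⟩

theorem addRight_mem_virt {b : VB m} (hb : b ∈ virtSubgroup m) :
    addRight m b ∈ virtSubgroup (m + 1) := by
  induction hb using Subgroup.closure_induction with
  | mem b hb => obtain ⟨i, h, rfl⟩ := hb; exact τ_mem _ _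
  | one => rw [map_one]; exact one_mem _
  | mul a b _ _ ha hb => rw [map_mul]; exact mul_mem ha hb
  | inv a _ ha => rw [map_inv]; exact inv_mem ha

theorem addLeft_mem_virt {b : VB m} (hb : b ∈ virtSubgroup m) :
    addLeft m b ∈ virtSubgroup (m + 1) := by
  induction hb using Subgroup.closure_induction with
  | mem b hb => obtain ⟨i, h, rfl⟩ := hb; exact τ_mem _ _
  | one => rw [map_one]; exact one_mem _
  | mul a b _ _ ha hb => rw [map_mul]; exact mul_mem ha hb
  | inv a _ ha => rw [map_inv]; exact inv_mem ha

theorem addRight_ofPerm {g : Equiv.Perm (Fin m)} {g' : Equiv.Perm (Fin (m + 1))}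
    (h : ∀ k, g' (Fin.castSucc k) = (g k).castSucc) : addRight m (ofPerm g) = ofPerm g' := by
  refine (ofPerm_eq (addRight_mem_virt (ofPerm_mem g)) ?_).symm
  have e := perm_addRight (ofPerm g)
  rw [perm_ofPerm] at e
  have hc : ∀ k : Fin m, perm (addRight m (ofPerm g)) k.castSucc = g' k.castSucc := fun k => by
    rw [e.2, h]
  refine Equiv.ext fun k => ?_
  induction k using Fin.lastCases with
  | cast k => exact hc k
  | last =>
    rw [e.1]
    by_contra hne
    obtain ⟨k, hk⟩ := Fin.exists_castSucc_eq.2 (fun h => hne h.symm)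
    have h2 := hc ((g⁻¹) k)
    rw [e.2] at h2
    simp only [Equiv.Perm.coe_inv, Equiv.apply_symm_apply] at h2
    have := g'.injective (hk.symm.trans h2)
    exact (Fin.castSucc_lt_last _).ne this.symm

theorem addLeft_ofPerm {g : Equiv.Perm (Fin m)} {g' : Equiv.Perm (Fin (m + 1))}
    (h : ∀ k, g' (Fin.succ k) = (g k).succ) : addLeft m (ofPerm g) = ofPerm g' := by
  refine (ofPerm_eq (addLeft_mem_virt (ofPerm_mem g)) ?_).symm
  have e := perm_addLeft (ofPerm g)
  rw [perm_ofPerm] at e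
  have hc : ∀ k : Fin m, perm (addLeft m (ofPerm g)) k.succ = g' k.succ := fun k => by
    rw [e.2, h]
  refine Equiv.ext fun k => ?_
  induction k using Fin.cases with
  | succ k => exact hc k
  | zero =>
    rw [e.1]
    by_contra hne
    obtain ⟨k, hk⟩ := Fin.exists_succ_eq.2 (fun h => hne h.symm)
    have h2 := hc ((g⁻¹) k)
    rw [e.2] at h2
    simp only [Equiv.Perm.coe_inv, Equiv.apply_symm_apply] at h2
    have := g'.injective (hk.symm.trans h2)
    exact Fin.succ_ne_zero _ this.symm

theorem exists_perm_castSucc {g : Equiv.Perm (Fin (m + 1))} (h : g (Fin.last m) = Fin.last m) :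
    ∃ g₀ : Equiv.Perm (Fin m), ∀ k, g (Fin.castSucc k) = (g₀ k).castSucc := by
  have hne (f : Equiv.Perm (Fin (m + 1))) (hf : f (Fin.last m) = Fin.last m) (k : Fin m) :
      f k.castSucc ≠ Fin.last m := fun e =>
    (Fin.castSucc_lt_last k).ne (f.injective (e.trans hf.symm))
  have hi : g⁻¹ (Fin.last m) = Fin.last m := by rw [Equiv.Perm.inv_eq_iff_eq, h]
  refine ⟨⟨fun k => (g k.castSucc).castPred (hne g h k),
    fun k => (g⁻¹ k.castSucc).castPred (hne _ hi k), fun k => ?_, fun k => ?_⟩, fun k => ?_⟩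
  · simp
  · simp
  · simp

theorem exists_perm_succ {g : Equiv.Perm (Fin (m + 1))} (h : g 0 = 0) :
    ∃ g₀ : Equiv.Perm (Fin m), ∀ k, g (Fin.succ k) = (g₀ k).succ := by
  have hne (f : Equiv.Perm (Fin (m + 1))) (hf : f 0 = 0) (k : Fin m) :
      f k.succ ≠ 0 := fun e => Fin.succ_ne_zero k (f.injective (e.trans hf.symm))
  have hi : g⁻¹ 0 = 0 := by rw [Equiv.Perm.inv_eq_iff_eq, h]
  refine ⟨⟨fun k => (g k.succ).pred (hne g h k),
    fun k => (g⁻¹ k.succ).pred (hne _ hi k), fun k => ?_, fun k => ?_⟩, fun k => ?_⟩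
  · simp
  · simp
  · simp

theorem exists_x_eq {p q : Fin m} (hpq : p ≠ q) : ∃ (h0 : 0 + 1 < m) (g : Equiv.Perm (Fin m)),
    g ⟨0, by omega⟩ = p ∧ g ⟨1, h0⟩ = q ∧
      x p q = ofPerm g * (σ 0 h0 * τ 0 h0) * (ofPerm g)⁻¹ := by
  have hm : 1 < m := by
    simp only [ne_eq, Fin.ext_iff] at *
    omega
  obtain ⟨g, hg⟩ := exists_perm_extending (Fin.castLE hm) ![p, q] (Fin.castLE_injective _)
    (by intro i j; fin_cases i <;> fin_cases j <;> simp [hpq, hpq.symm])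
  have e0 : g ⟨0, by omega⟩ = p := hg 0
  have e1 : g ⟨1, by omega⟩ = q := hg 1
  refine ⟨hm, g, e0, e1, ?_⟩
  have := conj_σ_mul_τ 0 hm g
  rw [this, ← e0, ← e1]

theorem x_self (p : Fin m) : x p p = 1 := by
  rw [x, dif_neg]
  rintro ⟨h0, g, h1, h2⟩
  have := g.injective (h1.trans h2.symm)
  simp at this

theorem exists_perm_extend_castSucc (g : Equiv.Perm (Fin m)) : ∃ g' : Equiv.Perm (Fin (m + 1)),
    ∀ k, g' (Fin.castSucc k) = (g k).castSucc :=
  ⟨perm (addRight m (ofPerm g)), fun k => by rw [(perm_addRight _).2, perm_ofPerm]⟩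

theorem exists_perm_extend_succ (g : Equiv.Perm (Fin m)) : ∃ g' : Equiv.Perm (Fin (m + 1)),
    ∀ k, g' (Fin.succ k) = (g k).succ :=
  ⟨perm (addLeft m (ofPerm g)), fun k => by rw [(perm_addLeft _).2, perm_ofPerm]⟩

theorem addRight_x (p q : Fin m) : addRight m (x p q) = x p.castSucc q.castSucc := by
  by_cases hpq : p = q
  · subst hpq; simp [x_self]
  obtain ⟨h0, g, rfl, rfl, e⟩ := exists_x_eq hpq
  obtain ⟨g', hg'⟩ := exists_perm_extend_castSucc g
  rw [e, map_mul, map_mul, map_mul, map_inv, addRight_ofPerm hg', addRight_σ, addRight_τ,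
    conj_σ_mul_τ, ← hg', ← hg']
  rfl

theorem addLeft_x (p q : Fin m) : addLeft m (x p q) = x p.succ q.succ := by
  by_cases hpq : p = q
  · subst hpq; simp [x_self]
  obtain ⟨h0, g, rfl, rfl, e⟩ := exists_x_eq hpq
  obtain ⟨g', hg'⟩ := exists_perm_extend_succ g
  rw [e, map_mul, map_mul, map_mul, map_inv, addLeft_ofPerm hg', addLeft_σ, addLeft_τ,
    conj_σ_mul_τ, ← hg', ← hg']
  rfl

/-- A braid in which the last strand is idle comes from a braid with one strand less. -/
theorem exists_addRight_eq {b : VB (m + 1)} (hb : b ∈ idle (Fin.last m)) :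
    ∃ a, b = addRight m a := by
  induction hb using Subgroup.closure_induction with
  | mem b hb =>
    rcases hb with ⟨p, q, hp, hq, rfl⟩ | ⟨g, hg, rfl⟩
    · obtain ⟨p, rfl⟩ := Fin.exists_castSucc_eq.2 hp
      obtain ⟨q, rfl⟩ := Fin.exists_castSucc_eq.2 hq
      exact ⟨_, (addRight_x p q).symm⟩
    · obtain ⟨g₀, h⟩ := exists_perm_castSucc hg
      exact ⟨_, (addRight_ofPerm h).symm⟩
  | one => exact ⟨1, (map_one _).symm⟩
  | mul a b _ _ ha hb =>
    obtain ⟨a, rfl⟩ := ha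
    obtain ⟨b, rfl⟩ := hb
    exact ⟨a * b, (map_mul _ _ _).symm⟩
  | inv a _ ha =>
    obtain ⟨a, rfl⟩ := ha
    exact ⟨a⁻¹, (map_inv _ _).symm⟩

/-- A braid in which the first strand is idle comes from a braid with one strand less. -/
theorem exists_addLeft_eq {b : VB (m + 1)} (hb : b ∈ idle 0) : ∃ a, b = addLeft m a := by
  induction hb using Subgroup.closure_induction with
  | mem b hb =>
    rcases hb with ⟨p, q, hp, hq, rfl⟩ | ⟨g, hg, rfl⟩
    · obtain ⟨p, rfl⟩ := Fin.exists_succ_eq.2 hp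
      obtain ⟨q, rfl⟩ := Fin.exists_succ_eq.2 hq
      exact ⟨_, (addLeft_x p q).symm⟩
    · obtain ⟨g₀, h⟩ := exists_perm_succ hg
      exact ⟨_, (addLeft_ofPerm h).symm⟩
  | one => exact ⟨1, (map_one _).symm⟩
  | mul a b _ _ ha hb =>
    obtain ⟨a, rfl⟩ := ha
    obtain ⟨b, rfl⟩ := hb
    exact ⟨a * b, (map_mul _ _ _).symm⟩
  | inv a _ ha =>
    obtain ⟨a, rfl⟩ := ha
    exact ⟨a⁻¹, (map_inv _ _).symm⟩

end VB

end VirtualKnot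

namespace VirtualKnot

/-! ### Markov classes -/

/-- Virtual braids of all degrees up to the Markov moves. -/
def MarkovClass : Type := Quot BraidMove

namespace VB

variable {m : ℕ}

/-- The class of a virtual braid up to the Markov moves. -/
def cl (b : VB m) : MarkovClass := Quot.mk _ ⟨m, b⟩

theorem cl_mul_comm (a b : VB m) : cl (a * b) = cl (b * a) := by
  have : cl (a * b) = cl (a⁻¹ * (a * b) * a) := Quot.sound (.conj _ _)
  rw [this, inv_mul_cancel_left]

theorem cl_conj (g b : VB m) : cl (g * b * g⁻¹) = cl b := by
  rw [cl_mul_comm, inv_mul_cancel_left]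

theorem ofPerm_swap_inv (p q : Fin m) : (ofPerm (Equiv.swap p q))⁻¹ = ofPerm (Equiv.swap p q) := by
  rw [← map_inv, Equiv.swap_inv]

theorem ofPerm_swap_mul_self (p q : Fin m) :
    ofPerm (Equiv.swap p q) * ofPerm (Equiv.swap p q) = 1 := by
  rw [← map_mul, Equiv.swap_mul_self, map_one]

theorem ofPerm_conj_swap (g : Equiv.Perm (Fin m)) (p q : Fin m) :
    ofPerm g * ofPerm (Equiv.swap p q) * (ofPerm g)⁻¹ = ofPerm (Equiv.swap (g p) (g q)) := by
  rw [← map_inv, ← map_mul, ← map_mul, Equiv.mul_swap_eq_swap_mul, mul_inv_cancel_right]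

theorem σ_eq_x (i : ℕ) (h : i + 1 < m) : σ i h
    = x ⟨i, by omega⟩ ⟨i + 1, h⟩ * ofPerm (Equiv.swap ⟨i, by omega⟩ ⟨i + 1, h⟩) := by
  have : ofPerm (Equiv.swap ⟨i, by omega⟩ ⟨i + 1, h⟩) = τ i h := ofPerm_adjSwap i h
  rw [x_succ, this, mul_assoc, τ_mul_self, mul_one]

theorem σ_inv_eq_x (i : ℕ) (h : i + 1 < m) : (σ i h)⁻¹
    = (x ⟨i + 1, h⟩ ⟨i, by omega⟩)⁻¹ * ofPerm (Equiv.swap ⟨i, by omega⟩ ⟨i + 1, h⟩) := by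
  rw [σ_eq_x, mul_inv_rev, ofPerm_swap_inv]
  have := ofPerm_conj_x (Equiv.swap (⟨i, by omega⟩ : Fin m) ⟨i + 1, h⟩) ⟨i, by omega⟩ ⟨i + 1, h⟩
  rw [Equiv.swap_apply_left, Equiv.swap_apply_right, ofPerm_swap_inv] at this
  rw [← this]
  simp only [mul_inv_rev, ofPerm_swap_inv, mul_assoc, ofPerm_swap_mul_self, mul_one]

/-- A braid `S` which becomes the last generator `T` after conjugation may be used in a
stabilization. -/
theorem cl_addRight_mul (b : VB m) (i : ℕ) (hi : i + 1 = m) (T : VB (m + 1))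
    (hT : ∀ b : VB m, cl (addRight m b * T) = cl b) (j : Fin m) (S : VB (m + 1))
    (hS : ∀ g : Equiv.Perm (Fin (m + 1)), g (Fin.last m) = Fin.last m →
      g ⟨i, by omega⟩ = j.castSucc → ofPerm g * T * (ofPerm g)⁻¹ = S) :
    cl (addRight m b * S) = cl b := by
  obtain ⟨g', hg'⟩ := exists_perm_extend_castSucc (Equiv.swap (⟨i, by omega⟩ : Fin m) j)
  have hl : g' (Fin.last m) = Fin.last m := by
    by_contra hne
    obtain ⟨k, hk⟩ := Fin.exists_castSucc_eq.2 hne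
    have h2 := hg' ((Equiv.swap (⟨i, by omega⟩ : Fin m) j) k)
    rw [Equiv.swap_apply_self, hk] at h2
    exact (Fin.castSucc_lt_last _).ne (g'.injective h2)
  have := hS g' hl (by
    have := hg' ⟨i, by omega⟩
    rwa [Equiv.swap_apply_left] at this)
  rw [← this, ← addRight_ofPerm hg']
  set G := ofPerm (Equiv.swap (⟨i, by omega⟩ : Fin m) j)
  calc cl (addRight m b * (addRight m G * T * (addRight m G)⁻¹))
      = cl (addRight m G * (addRight m (G⁻¹ * b * G) * T) * (addRight m G)⁻¹) := by
        simp only [map_mul, map_inv]; congr 1; group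
    _ = cl (G * (G⁻¹ * b * G) * G⁻¹) := by rw [cl_conj, hT, cl_conj]
    _ = cl b := by congr 1; group

theorem cl_stab_last (b : VB m) (j : Fin m) :
    cl (addRight m b * ofPerm (Equiv.swap j.castSucc (Fin.last m))) = cl b := by
  obtain ⟨i, rfl⟩ : ∃ i, m = i + 1 := ⟨m - 1, by have := j.2; omega⟩
  refine cl_addRight_mul b i rfl (τ i (by omega))
    (fun b => (Quot.sound (BraidMove.stab_virt i rfl b)).symm) j _ fun g h1 h2 => ?_
  have : ofPerm (Equiv.swap (⟨i, by omega⟩ : Fin (i + 2)) ⟨i + 1, by omega⟩) = τ i (by omega) :=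
    ofPerm_adjSwap i _
  rw [← this, ofPerm_conj_swap, h2]
  congr 3

theorem cl_stab_pos_last (b : VB m) (j : Fin m) :
    cl (addRight m b * (x j.castSucc (Fin.last m) *
      ofPerm (Equiv.swap j.castSucc (Fin.last m)))) = cl b := by
  obtain ⟨i, rfl⟩ : ∃ i, m = i + 1 := ⟨m - 1, by have := j.2; omega⟩
  refine cl_addRight_mul b i rfl (σ i (by omega))
    (fun b => (Quot.sound (BraidMove.stab_pos i rfl b)).symm) j _ fun g h1 h2 => ?_
  have h1' : g ⟨i + 1, by omega⟩ = Fin.last _ := h1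
  rw [σ_eq_x, ← conj_mul, ofPerm_conj_swap, ofPerm_conj_x, h2, h1']

theorem cl_stab_neg_last (b : VB m) (j : Fin m) :
    cl (addRight m b * ((x (Fin.last m) j.castSucc)⁻¹ *
      ofPerm (Equiv.swap j.castSucc (Fin.last m)))) = cl b := by
  obtain ⟨i, rfl⟩ : ∃ i, m = i + 1 := ⟨m - 1, by have := j.2; omega⟩
  refine cl_addRight_mul b i rfl (σ i (by omega))⁻¹
    (fun b => (Quot.sound (BraidMove.stab_neg i rfl b)).symm) j _ fun g h1 h2 => ?_
  have h1' : g ⟨i + 1, by omega⟩ = Fin.last _ := h1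
  rw [σ_inv_eq_x, ← conj_mul, ofPerm_conj_swap, ← conj_inv, ofPerm_conj_x, h2, h1']

theorem exists_idle_eq {n : ℕ} (k : Fin (n + 1)) {u : VB (n + 1)} (hu : u ∈ idle k) :
    ∃ a, u = ofPerm (Equiv.swap k (Fin.last n)) * addRight n a
      * (ofPerm (Equiv.swap k (Fin.last n)))⁻¹ := by
  have h := conj_mem_idle (Equiv.swap k (Fin.last n)) (Equiv.swap_apply_left _ _) hu
  obtain ⟨a, ha⟩ := exists_addRight_eq h
  refine ⟨a, ?_⟩
  rw [← ha]
  simp only [ofPerm_swap_inv, mul_assoc, ofPerm_swap_mul_self, mul_one]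
  rw [← mul_assoc, ofPerm_swap_mul_self, one_mul]

/-- Stabilization: an otherwise idle strand `k` is inserted after the strand `j`. -/
theorem cl_stab_comm {j j' k : Fin m} (hj : j ≠ k) (hj' : j' ≠ k) {u v : VB m} (hu : u ∈ idle k)
    (hv : v ∈ idle k) : cl (u * v * ofPerm (Equiv.swap j k))
      = cl (v * u * ofPerm (Equiv.swap j' k)) := by
  obtain ⟨n, rfl⟩ : ∃ n, m = n + 1 := ⟨m - 1, by have := j.2; omega⟩
  have key (j : Fin (n + 1)) (hj : j ≠ k) {u v : VB (n + 1)} (a b : VB n)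
      (ha : u = ofPerm (Equiv.swap k (Fin.last n)) * addRight n a
        * (ofPerm (Equiv.swap k (Fin.last n)))⁻¹)
      (hb : v = ofPerm (Equiv.swap k (Fin.last n)) * addRight n b
        * (ofPerm (Equiv.swap k (Fin.last n)))⁻¹) :
      cl (u * v * ofPerm (Equiv.swap j k)) = cl (a * b) := by
    subst ha hb
    set g := Equiv.swap k (Fin.last n)
    have hk : g (Fin.last n) = k := Equiv.swap_apply_right _ _
    have hne : g j ≠ Fin.last n := by
      intro h
      apply hj
      rw [← hk, ← h]; simp [g]
    obtain ⟨j', hj'⟩ := Fin.exists_castSucc_eq.2 hne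
    have e : ofPerm (Equiv.swap j k)
        = ofPerm g * ofPerm (Equiv.swap j'.castSucc (Fin.last n)) * (ofPerm g)⁻¹ := by
      rw [ofPerm_conj_swap, hj', hk]; simp [g]
    rw [e, conj_mul, conj_mul, cl_conj, ← map_mul, cl_stab_last]
  obtain ⟨a, ha⟩ := exists_idle_eq k hu
  obtain ⟨b, hb⟩ := exists_idle_eq k hv
  rw [key j hj a b ha hb, key j' hj' b a hb ha, cl_mul_comm]

/-- A positive stabilization on an arbitrary strand `k` may be replaced by a virtual one. -/
theorem cl_stab_pos {j k : Fin m} (hj : j ≠ k) {u : VB m} (hu : u ∈ idle k) :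
    cl (u * (x j k * ofPerm (Equiv.swap j k))) = cl (u * ofPerm (Equiv.swap j k)) := by
  obtain ⟨n, rfl⟩ : ∃ n, m = n + 1 := ⟨m - 1, by have := j.2; omega⟩
  obtain ⟨a, rfl⟩ := exists_idle_eq k hu
  set g := Equiv.swap k (Fin.last n)
  have hk : g (Fin.last n) = k := Equiv.swap_apply_right _ _
  have hne : g j ≠ Fin.last n := by
    intro h
    apply hj
    rw [← hk, ← h]; simp [g]
  obtain ⟨j', hj'⟩ := Fin.exists_castSucc_eq.2 hne
  have hj2 : g j'.castSucc = j := by rw [hj']; simp [g]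
  have e : ofPerm (Equiv.swap j k)
      = ofPerm g * ofPerm (Equiv.swap j'.castSucc (Fin.last n)) * (ofPerm g)⁻¹ := by
    rw [ofPerm_conj_swap, hj2, hk]
  have e' : x j k = ofPerm g * x j'.castSucc (Fin.last n) * (ofPerm g)⁻¹ := by
    rw [ofPerm_conj_x, hj2, hk]
  rw [e, e', conj_mul, conj_mul, conj_mul, cl_conj, cl_conj, cl_stab_last, cl_stab_pos_last]

/-- A negative stabilization on an arbitrary strand `k` may be replaced by a virtual one. -/
theorem cl_stab_neg {j k : Fin m} (hj : j ≠ k) {u : VB m} (hu : u ∈ idle k) :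
    cl (u * ((x k j)⁻¹ * ofPerm (Equiv.swap j k))) = cl (u * ofPerm (Equiv.swap j k)) := by
  obtain ⟨n, rfl⟩ : ∃ n, m = n + 1 := ⟨m - 1, by have := j.2; omega⟩
  obtain ⟨a, rfl⟩ := exists_idle_eq k hu
  set g := Equiv.swap k (Fin.last n)
  have hk : g (Fin.last n) = k := Equiv.swap_apply_right _ _
  have hne : g j ≠ Fin.last n := by
    intro h
    apply hj
    rw [← hk, ← h]; simp [g]
  obtain ⟨j', hj'⟩ := Fin.exists_castSucc_eq.2 hne
  have hj2 : g j'.castSucc = j := by rw [hj']; simp [g]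
  have e : ofPerm (Equiv.swap j k)
      = ofPerm g * ofPerm (Equiv.swap j'.castSucc (Fin.last n)) * (ofPerm g)⁻¹ := by
    rw [ofPerm_conj_swap, hj2, hk]
  have e' : (x k j)⁻¹ = ofPerm g * (x (Fin.last n) j'.castSucc)⁻¹ * (ofPerm g)⁻¹ := by
    rw [← conj_inv, ofPerm_conj_x, hj2, hk]
  rw [e, e', conj_mul, conj_mul, conj_mul, cl_conj, cl_conj, cl_stab_last, cl_stab_neg_last]

/-! ### The exchange move between arbitrary strands -/

/-- The algebra common to the two exchange moves. -/
theorem cl_exchange_aux {s t a b : VB m} (ht : t * t = 1)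
    (h : cl (b * s⁻¹ * a * s) = cl (b * t * a * t)) :
    cl ((s * t)⁻¹ * a * (s * t) * (t * b * t)) = cl (a * (t * b * t)) := by
  have ht' : t⁻¹ = t := inv_eq_of_mul_eq_one_left ht
  calc cl ((s * t)⁻¹ * a * (s * t) * (t * b * t)) = cl (t * (s⁻¹ * a * s * b) * t⁻¹) := by
        rw [mul_inv_rev, ht']
        congr 1
        simp only [mul_assoc]
        rw [← mul_assoc t t, ht, one_mul]
    _ = cl (b * s⁻¹ * a * s) := by
        rw [cl_conj, cl_mul_comm]; simp only [mul_assoc]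
    _ = cl (a * (t * b * t)) := by
        rw [h, mul_assoc (b * t), cl_mul_comm]
        simp only [mul_assoc]

theorem mul_self_conj {t b : VB m} (ht : t * t = 1) : t * (t * b * t) * t = b := by
  rw [mul_assoc t b, ← mul_assoc t t, ht, one_mul, mul_assoc, ht, mul_one]

/-- The right exchange move between arbitrary strands.  As `x j k` is a crossing followed by a
virtual one, the virtual crossings of the move disappear. -/
theorem cl_exchange_right {j k : Fin m} (hjk : j ≠ k) {u v : VB m} (hv : v ∈ idle k)
    (hu : u ∈ idle j) : cl ((x j k)⁻¹ * v * x j k * u) = cl (v * u) := by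
  obtain ⟨i, rfl⟩ : ∃ i, m = i + 2 := ⟨m - 2, by
    simp only [ne_eq, Fin.ext_iff] at *
    omega⟩
  obtain ⟨g, hg⟩ := exists_perm_extending ![(⟨i, by omega⟩ : Fin (i + 2)), Fin.last (i + 1)] ![j, k]
    (by intro a b; fin_cases a <;> fin_cases b <;> simp [Fin.ext_iff])
    (by intro a b; fin_cases a <;> fin_cases b <;> simp [hjk, hjk.symm])
  have hj : g ⟨i, by omega⟩ = j := hg 0
  have hk : g (Fin.last (i + 1)) = k := hg 1
  have hv' := conj_mem_idle g⁻¹ (by rw [Equiv.Perm.inv_eq_iff_eq, hk]) hv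
  have hu' := conj_mem_idle g⁻¹ (by rw [Equiv.Perm.inv_eq_iff_eq, hj]) hu
  have hu'' := conj_mem_idle (adjSwap i (by omega)) (l' := Fin.last (i + 1))
    (by ext; rw [adjSwap_val]; simp) hu'
  obtain ⟨a, ha⟩ := exists_addRight_eq hv'
  obtain ⟨b, hb⟩ := exists_addRight_eq hu''
  rw [ofPerm_adjSwap, τ_inv] at hb
  rw [map_inv, inv_inv] at ha hb
  have key := cl_exchange_aux (s := σ i (by omega)) (t := τ i (by omega)) (τ_mul_self _ _)
    (Quot.sound (BraidMove.exchange_right i rfl b a))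
  change cl (_ * addRight _ a * _ * (_ * addRight _ b * _)) =
    cl (addRight _ a * (_ * addRight _ b * _)) at key
  rw [← ha, ← hb, mul_self_conj (τ_mul_self _ _), ← x_succ] at key
  have e : x j k = ofPerm g * x ⟨i, by omega⟩ ⟨i + 1, by omega⟩ * (ofPerm g)⁻¹ := by
    rw [ofPerm_conj_x, hj]; congr 1; exact hk.symm
  rw [← cl_conj (ofPerm g)⁻¹, ← cl_conj (ofPerm g)⁻¹ (v * u), inv_inv]
  rw [e]
  convert key using 2 <;> group

/-- The left exchange move between arbitrary strands, with `k` in the role of the first strand. -/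
theorem cl_exchange_left {j k : Fin m} (hjk : j ≠ k) {u v : VB m} (hv : v ∈ idle k)
    (hu : u ∈ idle j) : cl ((x k j)⁻¹ * v * x k j * u) = cl (v * u) := by
  obtain ⟨i, rfl⟩ : ∃ i, m = i + 2 := ⟨m - 2, by
    simp only [ne_eq, Fin.ext_iff] at *
    omega⟩
  obtain ⟨g, hg⟩ := exists_perm_extending ![(⟨1, by omega⟩ : Fin (i + 2)), 0] ![j, k]
    (by intro a b; fin_cases a <;> fin_cases b <;> simp)
    (by intro a b; fin_cases a <;> fin_cases b <;> simp [hjk, hjk.symm])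
  have hj : g ⟨1, by omega⟩ = j := hg 0
  have hk : g 0 = k := hg 1
  have hv' := conj_mem_idle g⁻¹ (by rw [Equiv.Perm.inv_eq_iff_eq, hk]) hv
  have hu' := conj_mem_idle g⁻¹ (by rw [Equiv.Perm.inv_eq_iff_eq, hj]) hu
  have hu'' := conj_mem_idle (adjSwap 0 (by omega)) (l' := 0)
    (by ext; rw [adjSwap_val]; simp) hu'
  obtain ⟨a, ha⟩ := exists_addLeft_eq hv'
  obtain ⟨b, hb⟩ := exists_addLeft_eq hu''
  rw [ofPerm_adjSwap, τ_inv] at hb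
  rw [map_inv, inv_inv] at ha hb
  have key := cl_exchange_aux (s := σ 0 (by omega)) (t := τ 0 (by omega)) (τ_mul_self _ _)
    (Quot.sound (BraidMove.exchange_left (by omega) b a))
  change cl (_ * addLeft _ a * _ * (_ * addLeft _ b * _)) =
    cl (addLeft _ a * (_ * addLeft _ b * _)) at key
  rw [← ha, ← hb, mul_self_conj (τ_mul_self _ _), ← x_succ] at key
  have e : x k j = ofPerm g * x ⟨0, by omega⟩ ⟨0 + 1, by omega⟩ * (ofPerm g)⁻¹ := by
    rw [ofPerm_conj_x]
    congr 1
    · exact hk.symm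
    · exact hj.symm
  rw [← cl_conj (ofPerm g)⁻¹, ← cl_conj (ofPerm g)⁻¹ (v * u), inv_inv]
  rw [e]
  convert key using 2 <;> group

end VB

end VirtualKnot

namespace VirtualKnot

namespace VB

variable {m : ℕ}

/-! ### Reidemeister moves between arbitrary strands -/

/-- The real crossing of the strands `p` and `q` of sign `e` (`true` is positive), at which `q` is
the over-strand if `o` is true, and `p` if `o` is false. -/
noncomputable def real (o e : Bool) (p q : Fin m) : VB m :=
  match o, e with
  | true, true => x p q
  | true, false => (x p q)⁻¹
  | false, true => x q p
  | false, false => (x q p)⁻¹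

theorem real_not_left (o e : Bool) (p q : Fin m) : real (!o) e p q = real o e q p := by
  cases o <;> cases e <;> rfl

theorem real_not_right (o e : Bool) (p q : Fin m) : real o (!e) p q = (real o e p q)⁻¹ := by
  cases o <;> cases e <;> simp [real]

theorem ofPerm_conj_real (g : Equiv.Perm (Fin m)) (o e : Bool) (p q : Fin m) :
    ofPerm g * real o e p q * (ofPerm g)⁻¹ = real o e (g p) (g q) := by
  cases o <;> cases e <;> simp only [real, ← ofPerm_conj_x] <;> group

theorem real_mem_idle {l p q : Fin m} (o e : Bool) (hp : p ≠ l) (hq : q ≠ l) :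
    real o e p q ∈ idle l := by
  cases o <;> cases e <;> simp only [real, inv_mem_iff] <;> apply x_mem_idle <;> assumption

theorem real_commute (o e o' e' : Bool) {p q r t : Fin m} (hpq : p ≠ q) (hrt : r ≠ t)
    (hpr : p ≠ r) (hpt : p ≠ t) (hqr : q ≠ r) (hqt : q ≠ t) :
    Commute (real o e p q) (real o' e' r t) := by
  have h1 := x_commute hpq hrt hpr hpt hqr hqt
  have h2 := x_commute hpq.symm hrt hqr hqt hpr hpt
  have h3 := x_commute hpq hrt.symm hpt hpr hqt hqr
  have h4 := x_commute hpq.symm hrt.symm hqt hqr hpt hpr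
  cases o <;> cases e <;> cases o' <;> cases e' <;>
    simp only [real, Commute.inv_left_iff, Commute.inv_right_iff] <;> assumption

/-- The third Reidemeister move for three strands all of whose crossings run in the same direction,
when one of the strands is over the other two. The products `e xor o` tell in which way the strands
of a crossing cross each other in the plane, so they agree. -/
theorem real_braid {o₁ o₂ o₃ e₁ e₂ e₃ : Bool} (ho : ¬ (o₁ = o₃ ∧ o₁ ≠ o₂))
    (h₁ : (e₁ ^^ o₁) = (e₂ ^^ o₂)) (h₂ : (e₂ ^^ o₂) = (e₃ ^^ o₃)) {p q r : Fin m} (hpq : p ≠ q)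
    (hpr : p ≠ r) (hqr : q ≠ r) :
    real o₁ e₁ p q * real o₂ e₂ p r * real o₃ e₃ q r
      = real o₃ e₃ q r * real o₂ e₂ p r * real o₁ e₁ p q := by
  have key {a b c : VB m} (h : a * b * c = c * b * a) : a * b * c = c * b * a ∧
      a⁻¹ * b⁻¹ * c⁻¹ = c⁻¹ * b⁻¹ * a⁻¹ ∧ b * c * a⁻¹ = a⁻¹ * c * b ∧ c⁻¹ * a * b = b * a * c⁻¹ ∧
      b⁻¹ * c⁻¹ * a = a * c⁻¹ * b⁻¹ ∧ c * a⁻¹ * b⁻¹ = b⁻¹ * a⁻¹ * c := by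
    have v1 : a⁻¹ * b⁻¹ * c⁻¹ = c⁻¹ * b⁻¹ * a⁻¹ := by
      have := congrArg (·⁻¹) h
      simpa [mul_assoc] using this.symm
    have v2 {a b c : VB m} (h : a * b * c = c * b * a) : b * c * a⁻¹ = a⁻¹ * c * b := by
      rw [mul_inv_eq_iff_eq_mul, mul_assoc a⁻¹, mul_assoc a⁻¹, eq_inv_mul_iff_mul_eq, ← mul_assoc,
        h]
    have v3 {a b c : VB m} (h : a * b * c = c * b * a) : c⁻¹ * a * b = b * a * c⁻¹ := by
      rw [eq_mul_inv_iff_mul_eq, mul_assoc c⁻¹, mul_assoc c⁻¹, inv_mul_eq_iff_eq_mul, h, mul_assoc]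
    have v2' := v2 v1
    have v3' := v3 v1
    rw [inv_inv] at v2' v3'
    exact ⟨h, v1, v2 h, v3 h, v2', v3'⟩
  obtain ⟨_, _, _, _, _, _⟩ := key (yang_baxter hpq hpr hqr)
  obtain ⟨_, _, _, _, _, _⟩ := key (yang_baxter hpr hpq hqr.symm)
  obtain ⟨_, _, _, _, _, _⟩ := key (yang_baxter hpq.symm hqr hpr)
  obtain ⟨_, _, _, _, _, _⟩ := key (yang_baxter hqr hpq.symm hpr.symm)
  obtain ⟨_, _, _, _, _, _⟩ := key (yang_baxter hpr.symm hqr.symm hpq)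
  obtain ⟨_, _, _, _, _, _⟩ := key (yang_baxter hqr.symm hpr.symm hpq.symm)
  cases o₁ <;> cases o₂ <;> cases o₃ <;> (try exact absurd (by decide) ho) <;>
    cases e₁ <;> cases e₂ <;> cases e₃ <;> (try exact absurd h₁ (by decide)) <;>
    (try exact absurd h₂ (by decide)) <;> simp only [real] <;>
    first | assumption | (symm; assumption)

/-- The second Reidemeister move for strands of opposite directions: the strand `k` is idle in `v`
and the strand `j` is idle in `u`. -/
theorem cl_exchange (o e : Bool) {j k : Fin m} (hjk : j ≠ k) {u v : VB m} (hv : v ∈ idle k)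
    (hu : u ∈ idle j) : cl (real o (!e) j k * v * real o e j k * u) = cl (v * u) := by
  cases e
  · have h (a : VB m) (h : cl (a⁻¹ * u * a * v) = cl (u * v)) :
        cl (a * v * a⁻¹ * u) = cl (v * u) := by
      rw [cl_mul_comm v, ← h, mul_assoc (a⁻¹ * u), cl_mul_comm (a⁻¹ * u), mul_assoc (a * v)]
    cases o
    · exact h _ (cl_exchange_right hjk.symm hu hv)
    · exact h _ (cl_exchange_left hjk.symm hu hv)
  · cases o
    · exact cl_exchange_left hjk hv hu
    · exact cl_exchange_right hjk hv hu

/-- The next strand of each strand in the closure of a braid is given by a permutation `ν`; if `ν`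
sends `p` to `q`, then its inverse is the transposition of `p` and `q` followed by a braid in which
`q` is idle. -/
theorem exists_ofPerm_inv_eq {ν : Equiv.Perm (Fin m)} {p q : Fin m} (h : ν p = q) :
    ∃ H ∈ idle q, (ofPerm ν)⁻¹ = ofPerm (Equiv.swap p q) * H := by
  refine ⟨ofPerm (Equiv.swap p q * ν⁻¹), ofPerm_mem_idle ?_, ?_⟩
  · rw [Equiv.Perm.mul_apply, Equiv.Perm.inv_eq_iff_eq.2 h.symm, Equiv.swap_apply_left]
  · rw [map_mul, map_inv, ← mul_assoc, ofPerm_swap_mul_self, one_mul]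

/-- The part of a braid involving the strand `q` but not its predecessor `p` may be moved to the
predecessor. -/
theorem cl_slide {ν : Equiv.Perm (Fin m)} {p q : Fin m} (h : ν p = q) (hpq : p ≠ q) {a b b' : VB m}
    (ha : a ∈ idle q) (hb : b ∈ idle p)
    (hb' : ofPerm (Equiv.swap p q) * b * (ofPerm (Equiv.swap p q))⁻¹ = b') :
    cl (a * b * (ofPerm ν)⁻¹) = cl (a * b' * (ofPerm ν)⁻¹) := by
  obtain ⟨H, hH, e⟩ := exists_ofPerm_inv_eq h
  have hmem : b' ∈ idle q := by
    rw [← hb']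
    exact conj_mem_idle _ (Equiv.swap_apply_left _ _) hb
  have h1 : cl (a * b * (ofPerm ν)⁻¹) = cl (b' * (H * a) * ofPerm (Equiv.swap p q)) := by
    have : a * b * (ofPerm ν)⁻¹ = (a * ofPerm (Equiv.swap p q)) * (b' * H) := by
      rw [e, ← hb', ofPerm_swap_inv]
      simp only [mul_assoc]
      rw [← mul_assoc (ofPerm (Equiv.swap p q)) (ofPerm (Equiv.swap p q)), ofPerm_swap_mul_self,
        one_mul]
    rw [this, cl_mul_comm]
    simp only [mul_assoc]
  have h2 : cl (a * b' * (ofPerm ν)⁻¹) = cl (H * a * b' * ofPerm (Equiv.swap p q)) := by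
    rw [e, ← mul_assoc, cl_mul_comm]
    simp only [mul_assoc]
  rw [h1, h2, cl_stab_comm hpq hpq hmem (mul_mem hH ha)]

/-- The first Reidemeister move, in the two cases given directly by stabilization. -/
theorem cl_kink_stab {ν : Equiv.Perm (Fin m)} {p q : Fin m} (h : ν p = q) (hpq : p ≠ q) {a : VB m}
    (ha : a ∈ idle q) (o : Bool) :
    cl (a * real o o p q * (ofPerm ν)⁻¹) = cl (a * (ofPerm ν)⁻¹) := by
  obtain ⟨H, hH, e⟩ := exists_ofPerm_inv_eq h
  have h1 (y : VB m) : cl (a * y * (ofPerm ν)⁻¹)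
      = cl (H * a * (y * ofPerm (Equiv.swap p q))) := by
    rw [e, ← mul_assoc, cl_mul_comm]
    simp only [mul_assoc]
  have h2 := h1 1
  rw [mul_one, one_mul] at h2
  rw [h1, h2]
  cases o
  · exact cl_stab_neg hpq (mul_mem hH ha)
  · exact cl_stab_pos hpq (mul_mem hH ha)

/-- The second Reidemeister move: the strand `r` crosses `q` and its predecessor `p`, at crossings
of opposite signs which are adjacent on `r`. -/
theorem cl_bigon {ν : Equiv.Perm (Fin m)} {p q r : Fin m} (h : ν p = q) (hpr : p ≠ r)
    (hqr : q ≠ r) (o e : Bool) {a v b : VB m} (ha : a ∈ idle q) (hv : v ∈ idle r)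
    (hb : b ∈ idle p) :
    cl (a * real o (!e) q r * v * real o e p r * b * (ofPerm ν)⁻¹)
      = cl (a * v * b * (ofPerm ν)⁻¹) := by
  obtain ⟨H, hH, eH⟩ := exists_ofPerm_inv_eq h
  have hx := ofPerm_conj_real (Equiv.swap p q) o e q r
  rw [Equiv.swap_apply_right, Equiv.swap_apply_of_ne_of_ne hpr.symm hqr.symm] at hx
  have hb' := conj_mem_idle _ (Equiv.swap_apply_left p q) hb
  have hS := ofPerm_mem_idle (Equiv.swap_apply_of_ne_of_ne hpr.symm hqr.symm)
  rw [ofPerm_swap_inv] at hx hb'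
  have hSS := ofPerm_swap_mul_self p q
  set S := ofPerm (Equiv.swap p q)
  have key := cl_exchange o e hqr (mul_mem hv hS) (mul_mem (mul_mem hb' hH) ha)
  calc cl (a * real o (!e) q r * v * real o e p r * b * (ofPerm ν)⁻¹)
      = cl (a * (real o (!e) q r * (v * S) * real o e q r * (S * b * S * H))) := by
        rw [eH, ← hx]; simp only [mul_assoc]
    _ = cl (real o (!e) q r * (v * S) * real o e q r * (S * b * S * H * a)) := by
        rw [cl_mul_comm]; simp only [mul_assoc]
    _ = cl (v * S * (S * b * S * H) * a) := by rw [key, ← mul_assoc (v * S)]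
    _ = cl (a * v * b * (ofPerm ν)⁻¹) := by
        rw [cl_mul_comm, eH]
        congr 1
        simp only [mul_assoc]
        rw [← mul_assoc S S, hSS, one_mul]

/-- The first Reidemeister move: a strand `q` is inserted between the strands `p` and `r` which
cross each other. -/
theorem cl_kink {ν : Equiv.Perm (Fin m)} {p q r : Fin m} (h : ν p = q) (h' : ν q = r) (hpq : p ≠ q)
    (hpr : p ≠ r) (hqr : q ≠ r) (o e : Bool) {a : VB m} (haq : a ∈ idle q)
    (har : a ∈ idle r) :
    cl (a * real o e p r * (ofPerm ν)⁻¹) = cl (a * (ofPerm ν)⁻¹) := by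
  rcases Bool.eq_or_eq_not e o with rfl | rfl
  · rw [cl_slide h' hqr har (real_mem_idle e e hpq hqr.symm) rfl, ofPerm_conj_real,
      Equiv.swap_apply_of_ne_of_ne hpq hpr, Equiv.swap_apply_right]
    exact cl_kink_stab h hpq haq _
  · -- a kink of one of the remaining types cancels against one of the opposite sign
    have h1 := cl_kink_stab h hpq (mul_mem haq (real_mem_idle o (!o) hpq hqr.symm)) o
    have h2 := cl_bigon h' hpq.symm hpr.symm (!o) o har (one_mem _) (one_mem _)
    rw [real_not_left, real_not_left, mul_one, mul_one, mul_one] at h2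
    rw [← h1, h2, mul_one]

/-- The pure virtual braids in which none of the strands `T` has a real crossing. -/
noncomputable def avoid (T : List (Fin m)) : Subgroup (VB m) :=
  Subgroup.closure {b | ∃ p q, p ∉ T ∧ q ∉ T ∧ b = x p q}

theorem avoid_le_idle {T : List (Fin m)} {l : Fin m} (hl : l ∈ T) : avoid T ≤ idle l :=
  (Subgroup.closure_le _).2 fun _ ⟨_, _, hp, hq, e⟩ =>
    e ▸ x_mem_idle (fun h => hp (h ▸ hl)) (fun h => hq (h ▸ hl))

theorem real_mem_avoid {T : List (Fin m)} {p q : Fin m} (o e : Bool) (hp : p ∉ T) (hq : q ∉ T) :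
    real o e p q ∈ avoid T := by
  have h1 : x p q ∈ avoid T := Subgroup.subset_closure ⟨p, q, hp, hq, rfl⟩
  have h2 : x q p ∈ avoid T := Subgroup.subset_closure ⟨q, p, hq, hp, rfl⟩
  cases o <;> cases e <;> simp only [real, inv_mem_iff] <;> assumption

theorem swap_conj_avoid {T : List (Fin m)} {k l : Fin m} (hk : k ∈ T) (hl : l ∈ T) {b : VB m}
    (hb : b ∈ avoid T) : ofPerm (Equiv.swap k l) * b * (ofPerm (Equiv.swap k l))⁻¹ = b := by
  induction hb using Subgroup.closure_induction with
  | mem b hb =>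
    obtain ⟨p, q, hp, hq, rfl⟩ := hb
    rw [ofPerm_conj_x, Equiv.swap_apply_of_ne_of_ne, Equiv.swap_apply_of_ne_of_ne]
    all_goals rintro rfl; contradiction
  | one => simp
  | mul a b _ _ ha hb => rw [← conj_mul, ha, hb]
  | inv a _ ha => rw [← conj_inv, ha]

/-- The three crossings of three strands, each of which is cut in two between its crossings, may be
moved to the first halves of the strands. -/
theorem cl_triangle_stack {ν : Equiv.Perm (Fin m)} {p p' q q' r r' : Fin m} (hp : ν p = p')
    (hq : ν q = q') (hr : ν r = r') (hn : [p, p', q, q', r, r'].Nodup) {a b : VB m}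
    (ha : a ∈ avoid [p, p', q, q', r, r']) (hb : b ∈ avoid [p, p', q, q', r, r'])
    (o₁ e₁ o₂ e₂ o₃ e₃ : Bool) :
    cl (a * (real o₁ e₁ p q * real o₂ e₂ p' r * real o₃ e₃ q' r') * b * (ofPerm ν)⁻¹)
      = cl (a * (real o₁ e₁ p q * real o₂ e₂ p r * real o₃ e₃ q r) * b * (ofPerm ν)⁻¹) := by
  have ia {l} (hl : l ∈ [p, p', q, q', r, r']) : a ∈ idle l := avoid_le_idle hl ha
  have ib {l} (hl : l ∈ [p, p', q, q', r, r']) : b ∈ idle l := avoid_le_idle hl hb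
  have cp := swap_conj_avoid (k := p) (l := p') (by simp) (by simp) hb
  have cq := swap_conj_avoid (k := q) (l := q') (by simp) (by simp) hb
  have cr := swap_conj_avoid (k := r) (l := r') (by simp) (by simp) hb
  simp only [List.nodup_cons, List.mem_cons, List.not_mem_nil, or_false, not_or, List.nodup_nil,
    not_false_eq_true, and_true] at hn
  obtain ⟨⟨pp', pq, pq', pr, pr'⟩, ⟨p'q, p'q', p'r, p'r'⟩, ⟨qq', qr, qr'⟩, ⟨q'r, q'r'⟩, rr'⟩ := hn
  have s1 := cl_slide hp pp' (a := a * real o₁ e₁ p q)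
    (b := real o₂ e₂ p' r * real o₃ e₃ q' r' * b)
    (mul_mem (ia (by simp)) (real_mem_idle _ _ pp' (Ne.symm p'q)))
    (mul_mem (mul_mem (real_mem_idle _ _ (Ne.symm pp') (Ne.symm pr))
      (real_mem_idle _ _ (Ne.symm pq') (Ne.symm pr'))) (ib (by simp)))
    (by rw [← conj_mul, ← conj_mul, cp, ofPerm_conj_real, ofPerm_conj_real, Equiv.swap_apply_right,
      Equiv.swap_apply_of_ne_of_ne (Ne.symm pr) (Ne.symm p'r),
      Equiv.swap_apply_of_ne_of_ne (Ne.symm pq') (Ne.symm p'q'),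
      Equiv.swap_apply_of_ne_of_ne (Ne.symm pr') (Ne.symm p'r')])
  have s2 := cl_slide hq qq' (a := a * real o₁ e₁ p q * real o₂ e₂ p r)
    (b := real o₃ e₃ q' r' * b)
    (mul_mem (mul_mem (ia (by simp)) (real_mem_idle _ _ pq' qq'))
      (real_mem_idle _ _ pq' (Ne.symm q'r)))
    (mul_mem (real_mem_idle _ _ (Ne.symm qq') (Ne.symm qr')) (ib (by simp)))
    (by rw [← conj_mul, cq, ofPerm_conj_real, Equiv.swap_apply_right,
      Equiv.swap_apply_of_ne_of_ne (Ne.symm qr') (Ne.symm q'r')])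
  have s3 := cl_slide hr rr' (a := a * real o₁ e₁ p q * real o₂ e₂ p r)
    (b := real o₃ e₃ q r' * b)
    (mul_mem (mul_mem (ia (by simp)) (real_mem_idle _ _ pr' qr'))
      (real_mem_idle _ _ pr' rr'))
    (mul_mem (real_mem_idle _ _ qr (Ne.symm rr')) (ib (by simp)))
    (by rw [← conj_mul, cr, ofPerm_conj_real, Equiv.swap_apply_right,
      Equiv.swap_apply_of_ne_of_ne qr qr'])
  simp only [mul_assoc] at s1 s2 s3 ⊢
  rw [s1, s2, s3]

/-- The third Reidemeister move for three strands, when their directions are such that the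
crossings can be ordered along the strands. -/
theorem cl_triangle {ν : Equiv.Perm (Fin m)} {p p' q q' r r' : Fin m} (hp : ν p = p')
    (hq : ν q = q') (hr : ν r = r') (hn : [p, p', q, q', r, r'].Nodup) {a b : VB m}
    (ha : a ∈ avoid [p, p', q, q', r, r']) (hb : b ∈ avoid [p, p', q, q', r, r'])
    {o₁ e₁ o₂ e₂ o₃ e₃ : Bool} (ho : ¬ (o₁ = o₃ ∧ o₁ ≠ o₂))
    (h₁ : (e₁ ^^ o₁) = (e₂ ^^ o₂)) (h₂ : (e₂ ^^ o₂) = (e₃ ^^ o₃)) :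
    cl (a * (real o₁ e₁ p q * real o₂ e₂ p' r * real o₃ e₃ q' r') * b * (ofPerm ν)⁻¹)
      = cl (a * (real o₃ e₃ q r * real o₂ e₂ p r' * real o₁ e₁ p' q') * b * (ofPerm ν)⁻¹) := by
  have e : [p, p', q, q', r, r'].Perm [r, r', q, q', p, p'] := by
    have := (List.perm_append_comm (l₁ := [p, p']) (l₂ := [q, q', r, r'])).trans
      ((List.perm_append_comm (l₁ := [q, q']) (l₂ := [r, r'])).append_right [p, p'])
    simpa using this
  have av : avoid [p, p', q, q', r, r'] = avoid [r, r', q, q', p, p'] := by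
    unfold avoid
    simp only [e.mem_iff]
  have s := cl_triangle_stack hr hq hp (e.nodup_iff.1 hn) (av ▸ ha) (av ▸ hb) (!o₃) e₃ (!o₂) e₂
    (!o₁) e₁
  simp only [real_not_left] at s
  have hpq : p ≠ q := by rintro rfl; simp at hn
  have hpr : p ≠ r := by rintro rfl; simp at hn
  have hqr : q ≠ r := by rintro rfl; simp at hn
  rw [s, cl_triangle_stack hp hq hr hn ha hb, real_braid ho h₁ h₂ hpq hpr hqr]

/-- The third Reidemeister move for three strands, when their directions are such that the
crossings have a cyclic order. A pair of crossings of `p` and `q` of opposite signs is inserted, to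
obtain a triangle of the other kind. -/
theorem cl_triangle_cyclic {ν : Equiv.Perm (Fin m)} {p p' q q' r r' : Fin m} (hp : ν p = p')
    (hq : ν q = q') (hr : ν r = r') (hn : [p, p', q, q', r, r'].Nodup) {a b : VB m}
    (ha : a ∈ avoid [p, p', q, q', r, r']) (hb : b ∈ avoid [p, p', q, q', r, r'])
    {o₁ e₁ o₂ e₂ o₃ e₃ : Bool} (ho : ¬ (o₂ = !o₃ ∧ o₂ ≠ o₁))
    (h₁ : (e₂ ^^ o₂) = !(e₁ ^^ o₁)) (h₂ : (e₂ ^^ o₂) = !(e₃ ^^ o₃)) :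
    cl (a * (real o₂ e₂ p' r * real o₃ e₃ q r' * real o₁ e₁ p q') * b * (ofPerm ν)⁻¹)
      = cl (a * (real o₃ e₃ q' r * real o₂ e₂ p r' * real o₁ e₁ p' q) * b * (ofPerm ν)⁻¹) := by
  have ia {l} (hl : l ∈ [p, p', q, q', r, r']) : a ∈ idle l := avoid_le_idle hl ha
  have ib {l} (hl : l ∈ [p, p', q, q', r, r']) : b ∈ idle l := avoid_le_idle hl hb
  have cp := swap_conj_avoid (k := p) (l := p') (by simp) (by simp) hb
  have cq := swap_conj_avoid (k := q) (l := q') (by simp) (by simp) hb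
  have cr := swap_conj_avoid (k := r) (l := r') (by simp) (by simp) hb
  simp only [List.nodup_cons, List.mem_cons, List.not_mem_nil, or_false, not_or, List.nodup_nil,
    not_false_eq_true, and_true] at hn
  obtain ⟨⟨pp', pq, pq', pr, pr'⟩, ⟨p'q, p'q', p'r, p'r'⟩, ⟨qq', qr, qr'⟩, ⟨q'r, q'r'⟩, rr'⟩ := hn
  -- all crossings of `r` are moved to its first half, and those of `q` to its second half
  have s1 := cl_slide hr rr' (a := a * real o₂ e₂ p' r)
    (b := real o₃ e₃ q r' * real o₁ e₁ p q' * b)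
    (mul_mem (ia (by simp)) (real_mem_idle _ _ p'r' rr'))
    (mul_mem (mul_mem (real_mem_idle _ _ qr (Ne.symm rr')) (real_mem_idle _ _ pr q'r))
      (ib (by simp)))
    (by rw [← conj_mul, ← conj_mul, cr, ofPerm_conj_real, ofPerm_conj_real, Equiv.swap_apply_right,
      Equiv.swap_apply_of_ne_of_ne qr qr', Equiv.swap_apply_of_ne_of_ne pr pr',
      Equiv.swap_apply_of_ne_of_ne q'r q'r'])
  have s2 := cl_slide hq qq' (a := a * real o₂ e₂ p' r * real o₃ e₃ q r)
    (b := real o₁ e₁ p q' * b)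
    (mul_mem (mul_mem (ia (by simp)) (real_mem_idle _ _ p'q' (Ne.symm q'r)))
      (real_mem_idle _ _ qq' (Ne.symm q'r)))
    (mul_mem (real_mem_idle _ _ pq (Ne.symm qq')) (ib (by simp)))
    (by rw [← conj_mul, cq, ofPerm_conj_real, Equiv.swap_apply_right,
      Equiv.swap_apply_of_ne_of_ne pq pq'])
  have s3 := cl_slide hq qq' (a := a * real o₂ e₂ p' r)
    (b := real o₃ e₃ q' r * real o₁ e₁ p q' * b)
    (mul_mem (ia (by simp)) (real_mem_idle _ _ p'q' (Ne.symm q'r)))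
    (mul_mem (mul_mem (real_mem_idle _ _ (Ne.symm qq') (Ne.symm qr))
      (real_mem_idle _ _ pq (Ne.symm qq'))) (ib (by simp)))
    (by rw [← conj_mul, ← conj_mul, cq, ofPerm_conj_real, ofPerm_conj_real,
      Equiv.swap_apply_right, Equiv.swap_apply_of_ne_of_ne pq pq',
      Equiv.swap_apply_of_ne_of_ne (Ne.symm qr) (Ne.symm q'r)])
  -- the additional pair of crossings of `p` and `q`
  have s4 := cl_bigon hq (Ne.symm p'q) (Ne.symm p'q') (!o₁) e₁ (a := a * real o₂ e₂ p' r)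
    (v := real o₃ e₃ q' r * real o₁ e₁ p q') (b := b)
    (mul_mem (ia (by simp)) (real_mem_idle _ _ p'q' (Ne.symm q'r)))
    (mul_mem (real_mem_idle _ _ (Ne.symm p'q') (Ne.symm p'r))
      (real_mem_idle _ _ pp' (Ne.symm p'q')))
    (ib (by simp))
  have s5 := real_braid (o₁ := o₂) (e₁ := e₂) (o₂ := o₁) (e₂ := !e₁) (o₃ := !o₃) (e₃ := e₃)
    (p := p') (q := r) (r := q') ho (by rw [h₁]; cases e₁ <;> cases o₁ <;> rfl)
    (by have := h₁.symm.trans h₂; revert this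
        cases e₁ <;> cases o₁ <;> cases e₃ <;> cases o₃ <;> decide) p'r p'q' (Ne.symm q'r)
  have s6 := cl_bigon hp pq' p'q' o₁ e₁ (a := a * real o₃ e₃ q' r)
    (v := real o₂ e₂ p' r) (b := real o₁ e₁ p' q * b)
    (mul_mem (ia (by simp)) (real_mem_idle _ _ (Ne.symm p'q') (Ne.symm p'r)))
    (real_mem_idle _ _ p'q' (Ne.symm q'r))
    (mul_mem (real_mem_idle _ _ (Ne.symm pp') (Ne.symm pq)) (ib (by simp)))
  have s7 := cl_slide hr rr' (a := a * real o₃ e₃ q' r)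
    (b := real o₂ e₂ p' r' * real o₁ e₁ p' q * b)
    (mul_mem (ia (by simp)) (real_mem_idle _ _ q'r' rr'))
    (mul_mem (mul_mem (real_mem_idle _ _ p'r (Ne.symm rr')) (real_mem_idle _ _ p'r qr))
      (ib (by simp)))
    (by rw [← conj_mul, ← conj_mul, cr, ofPerm_conj_real, ofPerm_conj_real, Equiv.swap_apply_right,
      Equiv.swap_apply_of_ne_of_ne qr qr', Equiv.swap_apply_of_ne_of_ne p'r p'r'])
  have s8 := cl_slide hp pp' (a := a * real o₃ e₃ q' r)
    (b := real o₂ e₂ p' r' * real o₁ e₁ p' q * b)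
    (mul_mem (ia (by simp)) (real_mem_idle _ _ (Ne.symm p'q') (Ne.symm p'r)))
    (mul_mem (mul_mem (real_mem_idle _ _ (Ne.symm pp') (Ne.symm pr'))
      (real_mem_idle _ _ (Ne.symm pp') (Ne.symm pq))) (ib (by simp)))
    (by rw [← conj_mul, ← conj_mul, cp, ofPerm_conj_real, ofPerm_conj_real, Equiv.swap_apply_right,
      Equiv.swap_apply_of_ne_of_ne (Ne.symm pr') (Ne.symm p'r'),
      Equiv.swap_apply_of_ne_of_ne (Ne.symm pq) (Ne.symm p'q)])
  have s9 := cl_slide hp pp' (a := a * real o₃ e₃ q' r * real o₂ e₂ p r')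
    (b := real o₁ e₁ p' q * b)
    (mul_mem (mul_mem (ia (by simp)) (real_mem_idle _ _ (Ne.symm p'q') (Ne.symm p'r)))
      (real_mem_idle _ _ pp' (Ne.symm p'r')))
    (mul_mem (real_mem_idle _ _ (Ne.symm pp') (Ne.symm pq)) (ib (by simp)))
    (by rw [← conj_mul, cp, ofPerm_conj_real, Equiv.swap_apply_right,
      Equiv.swap_apply_of_ne_of_ne (Ne.symm pq) (Ne.symm p'q)])
  rw [real_not_left, real_not_left] at s4
  rw [real_not_left] at s5
  have s5' := congrArg (fun y => cl (a * y * real o₁ e₁ p q' * real o₁ e₁ p' q * b * (ofPerm ν)⁻¹))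
    s5
  simp only [mul_assoc] at s1 s2 s3 s4 s5' s6 s7 s8 s9 ⊢
  rw [s1, s2, ← s3, ← s4, s5', s6, ← s7, s8, ← s9]

end VB

end VirtualKnot

namespace VirtualKnot

open VB

/-! ### Gauss data -/

/-- A real crossing of two labelled strands: `q` is the over-strand if `o` is true, otherwise `p`;
the sign is positive if `e` is true. -/
structure RealCrossing (α : Type*) where
  o : Bool
  e : Bool
  p : α
  q : α

namespace RealCrossing

variable {α β γ : Type*}

/-- Change of the labels. -/
def map (f : α → β) (c : RealCrossing α) : RealCrossing β := ⟨c.o, c.e, f c.p, f c.q⟩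

theorem map_injective {f : α → β} (hf : Function.Injective f) :
    Function.Injective (RealCrossing.map f) := by
  rintro ⟨o, e, p, q⟩ ⟨o', e', p', q'⟩ h
  simp only [map, mk.injEq] at h
  obtain ⟨h1, h2, h3, h4⟩ := h
  rw [h1, h2, hf h3, hf h4]

/-- The labels of a list of crossings. -/
def labels (C : List (RealCrossing α)) : List α := C.flatMap fun c => [c.p, c.q]

theorem labels_append (C C' : List (RealCrossing α)) : labels (C ++ C') = labels C ++ labels C' :=
  List.flatMap_append

theorem labels_cons (c : RealCrossing α) (C : List (RealCrossing α)) :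
    labels (c :: C) = c.p :: c.q :: labels C := rfl

theorem labels_map (f : α → β) (C : List (RealCrossing α)) :
    labels (C.map (map f)) = (labels C).map f := by
  induction C with
  | nil => rfl
  | cons c C ih => simp only [List.map_cons, labels_cons, ih, map]

theorem map_eq_of_labels {f g : α → β} {C : List (RealCrossing α)}
    (h : ∀ x ∈ labels C, f x = g x) : C.map (map f) = C.map (map g) := by
  induction C with
  | nil => rfl
  | cons c C ih =>
    rw [List.map_cons, List.map_cons, ih fun x hx => h x (by simp [labels_cons, hx])]
    simp only [map, h c.p (by simp [labels_cons]), h c.q (by simp [labels_cons])]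

theorem map_eq_self {f : α → α} {C : List (RealCrossing α)}
    (h : ∀ x ∈ labels C, f x = x) : C.map (map f) = C := by
  rw [map_eq_of_labels (g := id) h]
  exact (List.map_congr_left fun _ _ => rfl).trans (List.map_id _)

theorem exists_map_eq {f : α → β} {C : List (RealCrossing β)} (h : ∀ x ∈ labels C, ∃ y, f y = x) :
    ∃ D : List (RealCrossing α), C = D.map (map f) := by
  induction C with
  | nil => exact ⟨[], rfl⟩
  | cons c C ih =>
    obtain ⟨D, rfl⟩ := ih fun x hx => h x (by simp [labels_cons, hx])
    obtain ⟨y, hy⟩ := h c.p (by simp [labels_cons])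
    obtain ⟨z, hz⟩ := h c.q (by simp [labels_cons])
    exact ⟨⟨c.o, c.e, y, z⟩ :: D, by simp [map, hy, hz]⟩

/-- The product of the real crossings of strands labelled by their places. -/
noncomputable def word {m : ℕ} (C : List (RealCrossing (Fin m))) : VB m :=
  (C.map fun c => real c.o c.e c.p c.q).prod

variable {m : ℕ}

theorem word_append (C C' : List (RealCrossing (Fin m))) : word (C ++ C') = word C * word C' := by
  simp [word]

theorem word_cons (c : RealCrossing (Fin m)) (C : List (RealCrossing (Fin m))) :
    word (c :: C) = real c.o c.e c.p c.q * word C := by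
  simp [word]

theorem word_nil : word ([] : List (RealCrossing (Fin m))) = 1 := rfl

theorem ofPerm_conj_word (g : Equiv.Perm (Fin m)) (C : List (RealCrossing (Fin m))) :
    ofPerm g * word C * (ofPerm g)⁻¹ = word (C.map (map g)) := by
  induction C with
  | nil => simp [word]
  | cons c C ih =>
    rw [List.map_cons, word_cons, word_cons, ← ih, ← conj_mul, ofPerm_conj_real]
    rfl

theorem word_mem_avoid {T : List (Fin m)} {C : List (RealCrossing (Fin m))}
    (h : ∀ x ∈ labels C, x ∉ T) : word C ∈ avoid T := by
  induction C with
  | nil => exact one_mem _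
  | cons c C ih =>
    rw [word_cons]
    exact mul_mem (real_mem_avoid _ _ (h _ (by simp [labels_cons])) (h _ (by simp [labels_cons])))
      (ih fun x hx => h x (by simp [labels_cons, hx]))

end RealCrossing

open RealCrossing

/-- The pair `(L, C)` are Gauss data of the Markov class `c`: some braid in the class is a product
of real crossings between labelled strands, listed in `C`, and a virtual braid without real
crossings, in whose closure each label is followed by the label given by the pairs in `L`. -/
def Reps (L : Multiset (ℕ × ℕ)) (C : List (RealCrossing ℕ)) (c : MarkovClass) : Prop :=
  ∃ (m : ℕ) (ℓ : Fin m → ℕ) (ν : Equiv.Perm (Fin m)) (D : List (RealCrossing (Fin m))),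
    Function.Injective ℓ ∧ L = Finset.univ.val.map (fun i => (ℓ i, ℓ (ν i))) ∧
    C = D.map (RealCrossing.map ℓ) ∧ c = cl (word D * (ofPerm ν)⁻¹)

theorem Reps.map {L : Multiset (ℕ × ℕ)} {C : List (RealCrossing ℕ)} {c : MarkovClass}
    (h : Reps L C c) {ρ : ℕ → ℕ} (hρ : Function.Injective ρ) :
    Reps (L.map (Prod.map ρ ρ)) (C.map (RealCrossing.map ρ)) c := by
  obtain ⟨m, ℓ, ν, D, hℓ, rfl, rfl, rfl⟩ := h
  refine ⟨m, ρ ∘ ℓ, ν, D, hρ.comp hℓ, ?_, ?_, rfl⟩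
  · rw [Multiset.map_map]; rfl
  · rw [List.map_map]; rfl

/-- The places may be permuted. -/
theorem cl_relabel {m : ℕ} (g ν : Equiv.Perm (Fin m)) (D : List (RealCrossing (Fin m))) :
    cl (word (D.map (RealCrossing.map g)) * (ofPerm (g * ν * g⁻¹))⁻¹)
      = cl (word D * (ofPerm ν)⁻¹) := by
  rw [← ofPerm_conj_word, map_mul, map_mul, map_inv, conj_inv, conj_mul, cl_conj]

/-- Two braids with the same Gauss data differ by a renumbering of the strands, that is, by
conjugation with a permutation braid. -/
theorem Reps.unique {L : Multiset (ℕ × ℕ)} {C : List (RealCrossing ℕ)} {c c' : MarkovClass}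
    (h : Reps L C c) (h' : Reps L C c') : c = c' := by
  obtain ⟨m, ℓ, ν, D, hℓ, rfl, rfl, rfl⟩ := h
  obtain ⟨m', ℓ', ν', D', hℓ', hL, hC, rfl⟩ := h'
  have hm : m = m' := by simpa using congrArg Multiset.card hL
  subst hm
  have hmem (i : Fin m) : ∃ j, ℓ' j = ℓ i ∧ ℓ' (ν' j) = ℓ (ν i) := by
    have : (ℓ i, ℓ (ν i)) ∈ Finset.univ.val.map (fun i => (ℓ' i, ℓ' (ν' i))) := by
      rw [← hL]; exact Multiset.mem_map.2 ⟨i, Finset.mem_univ_val i, rfl⟩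
    obtain ⟨j, _, hj⟩ := Multiset.mem_map.1 this
    exact ⟨j, congrArg Prod.fst hj, congrArg Prod.snd hj⟩
  choose g hg hg' using hmem
  have hginj : Function.Injective g := fun i j hij => hℓ (by rw [← hg, ← hg, hij])
  let G : Equiv.Perm (Fin m) := Equiv.ofBijective g (Finite.injective_iff_bijective.1 hginj)
  have hG (i) : ℓ' (G i) = ℓ i := hg i
  have hν : ν' = G * ν * G⁻¹ := by
    ext i
    obtain ⟨j, rfl⟩ := G.surjective i
    have : ν' (G j) = G (ν j) := hℓ' ((hg' j).trans (hG _).symm)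
    rw [this]; simp
  have hD : D' = D.map (RealCrossing.map G) := by
    apply List.map_injective_iff.2 (RealCrossing.map_injective hℓ')
    rw [← hC, List.map_map]
    refine List.map_congr_left fun c _ => ?_
    simp only [Function.comp, RealCrossing.map, hG]
  rw [hν, hD, cl_relabel]

/-- The map of labels that replaces `p` by `a` and closes the gap. -/
def merge (a p k : ℕ) : ℕ := if k = p then a else if p < k then k - 1 else k

theorem merge_eq {a p x y : ℕ} (hap : a < p) (h : merge a p x = merge a p y) :
    x = y ∨ (x = a ∧ y = p) ∨ (x = p ∧ y = a) := by
  unfold merge at h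
  split_ifs at h <;> omega

/-- Two consecutive labels can be identified, when the crossings with the first one precede those
with the second one. -/
theorem Reps.contract {s t : ℕ} {L : Multiset (ℕ × ℕ)} {C₁ C₂ : List (RealCrossing ℕ)}
    {c : MarkovClass} (h : Reps ((s, t) ::ₘ L) (C₁ ++ C₂) c) (hst : s ≠ t) (ht : t ∉ labels C₁)
    (hs : s ∉ labels C₂) {ρ : ℕ → ℕ} (hρ : ρ s = ρ t)
    (hρ' : ∀ x y, ρ x = ρ y → x = y ∨ (x = s ∧ y = t) ∨ (x = t ∧ y = s)) :
    Reps (L.map (Prod.map ρ ρ)) ((C₁ ++ C₂).map (RealCrossing.map ρ)) c := by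
  obtain ⟨m, ℓ, ν, D, hℓ, hL, hC, rfl⟩ := h
  -- the place of the label `t` is the last one, after a permutation of the places
  obtain ⟨k₀, hk₀, hk₀'⟩ : ∃ k, ℓ k = s ∧ ℓ (ν k) = t := by
    have : (s, t) ∈ Finset.univ.val.map (fun i => (ℓ i, ℓ (ν i))) := by
      rw [← hL]; exact Multiset.mem_cons_self _ _
    obtain ⟨j, _, hj⟩ := Multiset.mem_map.1 this
    exact ⟨j, congrArg Prod.fst hj, congrArg Prod.snd hj⟩
  obtain ⟨n, rfl⟩ : ∃ n, m = n + 1 := ⟨m - 1, by have := k₀.2; omega⟩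
  obtain ⟨ℓ, ν, D, k₀, hℓ, hL, hC, hk₀, hk₀', hcl⟩ : ∃ (ℓ' : Fin (n + 1) → ℕ)
      (ν' : Equiv.Perm (Fin (n + 1))) (D' : List (RealCrossing (Fin (n + 1)))) (k₀ : Fin (n + 1)),
      Function.Injective ℓ' ∧ (s, t) ::ₘ L = Finset.univ.val.map (fun i => (ℓ' i, ℓ' (ν' i))) ∧
      C₁ ++ C₂ = D'.map (RealCrossing.map ℓ') ∧ ℓ' k₀ = s ∧ ℓ' (Fin.last n) = t ∧
      ν' k₀ = Fin.last n ∧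
      cl (word D * (ofPerm ν)⁻¹) = cl (word D' * (ofPerm ν')⁻¹) := by
    set g := Equiv.swap (ν k₀) (Fin.last n)
    have hgg (i) : g (g i) = i := Equiv.swap_apply_self _ _ _
    refine ⟨ℓ ∘ g, g * ν * g⁻¹, D.map (RealCrossing.map g), g k₀, hℓ.comp g.injective, ?_, ?_, ?_,
      ?_, ?_, (cl_relabel g ν D).symm⟩
    · rw [hL]
      have : (Finset.univ : Finset (Fin (n + 1))).val.map g = Finset.univ.val := by
        have := Finset.map_univ_equiv g
        exact congrArg Finset.val this
      conv_lhs => rw [← this, Multiset.map_map]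
      refine Multiset.map_congr rfl fun i _ => ?_
      simp [g, Equiv.swap_inv]
    · rw [hC, List.map_map]
      refine List.map_congr_left fun c _ => ?_
      simp only [Function.comp, RealCrossing.map, hgg]
    · simp [hgg, hk₀]
    · rw [← hk₀']; simp [g]
    · simp [g]
  obtain ⟨hν, hcl⟩ := hcl
  rw [hcl]
  clear hcl
  have hne : k₀ ≠ Fin.last n := by rintro rfl; exact hst (hk₀.symm.trans hk₀')
  obtain ⟨k, rfl⟩ := Fin.exists_castSucc_eq.2 hne
  obtain ⟨D₁, D₂, rfl, hC₁, hC₂⟩ := List.map_eq_append_iff.1 hC.symm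
  -- the next label, with the last place left out
  set sw := Equiv.swap k.castSucc (Fin.last n)
  have hH : (sw * ν⁻¹) (Fin.last n) = Fin.last n := by
    rw [Equiv.Perm.mul_apply, Equiv.Perm.inv_eq_iff_eq.2 hν.symm, Equiv.swap_apply_left]
  obtain ⟨h₀, hh₀⟩ := exists_perm_castSucc hH
  have hfirst : ∀ x ∈ labels D₁, ∃ y : Fin n, y.castSucc = x := fun x hx => by
    refine Fin.exists_castSucc_eq.2 ?_
    rintro rfl
    apply ht
    rw [← hC₁, labels_map, ← hk₀']
    exact List.mem_map_of_mem hx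
  have hsecond : ∀ x ∈ labels (D₂.map (RealCrossing.map sw)), ∃ y : Fin n, y.castSucc = x := by
    intro x hx
    refine Fin.exists_castSucc_eq.2 ?_
    rintro rfl
    apply hs
    rw [labels_map] at hx
    obtain ⟨y, hy, hy'⟩ := List.mem_map.1 hx
    have : y = k.castSucc := by
      have := congrArg sw hy'
      simpa [sw] using this
    subst this
    rw [← hC₂, labels_map, ← hk₀]
    exact List.mem_map_of_mem hy
  obtain ⟨E₁, hE₁⟩ := exists_map_eq hfirst
  obtain ⟨E₂, hE₂⟩ := exists_map_eq hsecond
  have hinj : ∀ i j : Fin n, ρ (ℓ i.castSucc) = ρ (ℓ j.castSucc) → i = j := by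
    intro i j hij
    have hl (i : Fin n) : ℓ i.castSucc ≠ t := fun h =>
      (Fin.castSucc_lt_last i).ne (hℓ (h.trans hk₀'.symm))
    rcases hρ' _ _ hij with h | h | h
    · exact Fin.castSucc_injective _ (hℓ h)
    · exact absurd h.2 (hl j)
    · exact absurd h.1 (hl i)
  have hsw (i : Fin (n + 1)) : ρ (ℓ (sw i)) = ρ (ℓ i) := by
    rcases eq_or_ne i k.castSucc with rfl | h1
    · rw [Equiv.swap_apply_left, hk₀, hk₀', hρ]
    · rcases eq_or_ne i (Fin.last n) with rfl | h2
      · rw [Equiv.swap_apply_right, hk₀, hk₀', hρ]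
      · rw [Equiv.swap_apply_of_ne_of_ne h1 h2]
  have haddR (E : List (RealCrossing (Fin n))) :
      addRight n (word E) = word (E.map (RealCrossing.map Fin.castSucc)) := by
    induction E with
    | nil => simp [word]
    | cons e E ih =>
      rw [List.map_cons, word_cons, word_cons, map_mul, ih]
      congr 1
      obtain ⟨o, e, p, q⟩ := e
      cases o <;> cases e <;> simp [real, RealCrossing.map, addRight_x]
  refine ⟨n, fun i => ρ (ℓ i.castSucc), h₀⁻¹, E₁ ++ E₂, hinj, ?_, ?_, ?_⟩
  · have e1 : (Finset.univ : Finset (Fin (n + 1))).val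
        = Fin.last n ::ₘ Finset.univ.val.map Fin.castSucc := by
      rw [Fin.univ_castSuccEmb]; simp
    have e2 : Finset.univ.val.map (fun i => (ℓ i, ℓ (ν i)))
        = (ℓ k.castSucc, ℓ (ν k.castSucc)) ::ₘ
          (Finset.univ.val.erase k.castSucc).map (fun i => (ℓ i, ℓ (ν i))) := by
      conv_lhs => rw [← Multiset.cons_erase (Finset.mem_univ_val k.castSucc), Multiset.map_cons]
    rw [e2, hν, hk₀, hk₀', Multiset.cons_inj_right] at hL
    have e3 : (Finset.univ : Finset (Fin (n + 1))).val.erase k.castSucc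
        = (Finset.univ.val.map Fin.castSucc).map sw := by
      have : (Finset.univ : Finset (Fin (n + 1))).val = (Finset.univ.val.map sw) :=
        (congrArg Finset.val (Finset.map_univ_equiv sw)).symm
      rw [this, e1, Multiset.map_cons, Equiv.swap_apply_right, Multiset.erase_cons_head]
    rw [hL, e3, Multiset.map_map, Multiset.map_map, Multiset.map_map]
    refine Multiset.map_congr rfl fun i _ => ?_
    simp only [Function.comp, Prod.map, hsw, Prod.mk.injEq, true_and]
    have := hh₀ (h₀⁻¹ i)
    simp only [Equiv.Perm.mul_apply, Equiv.Perm.coe_inv, Equiv.apply_symm_apply] at this ⊢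
    rw [← this]
    simp [sw]
  · rw [List.map_append, List.map_append, ← hC₁, ← hC₂, hE₁, List.map_map, List.map_map,
      List.map_map]
    congr 1
    have h2 : E₂.map (RealCrossing.map fun i => ρ (ℓ i.castSucc))
        = (D₂.map (RealCrossing.map sw)).map (RealCrossing.map fun i => ρ (ℓ i)) := by
      rw [hE₂, List.map_map]; rfl
    rw [h2, List.map_map]
    refine List.map_congr_left fun c _ => ?_
    simp only [Function.comp, RealCrossing.map, hsw]
  · have e1 : (ofPerm ν)⁻¹ = ofPerm sw * addRight n (ofPerm h₀) := by
      rw [addRight_ofPerm hh₀, ← map_mul, ← mul_assoc, Equiv.swap_mul_self, one_mul, map_inv]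
    have e2 : word D₁ = addRight n (word E₁) := by rw [haddR, ← hE₁]
    have e3 : ofPerm sw * word D₂ * (ofPerm sw)⁻¹ = addRight n (word E₂) := by
      rw [haddR, ← hE₂, ofPerm_conj_word]
    have e4 : word D₂ * ofPerm sw = ofPerm sw * addRight n (word E₂) := by
      rw [← e3, ofPerm_swap_inv, ← mul_assoc, ← mul_assoc, ofPerm_swap_mul_self, one_mul]
    calc cl (word (D₁ ++ D₂) * (ofPerm ν)⁻¹)
        = cl (addRight n (word E₁) * ofPerm sw * addRight n (word E₂ * ofPerm h₀)) := by
          rw [word_append, e1, e2, mul_assoc, ← mul_assoc (word D₂), e4, map_mul]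
          simp only [mul_assoc]
      _ = cl (addRight n (word E₂ * ofPerm h₀ * word E₁) * ofPerm sw) := by
          rw [cl_mul_comm, map_mul _ _ (word E₁), mul_assoc]
      _ = cl (word (E₁ ++ E₂) * (ofPerm h₀⁻¹)⁻¹) := by
          rw [cl_stab_last, cl_mul_comm, word_append, map_inv, inv_inv, mul_assoc]

/-! ### Local changes of Gauss data -/

/-- A local change of the crossings, between which and the other crossings there are no common
labels, may be made if it is possible for the corresponding words. -/
theorem Reps.replace {L : Multiset (ℕ × ℕ)} {C₁ C₂ P P' : List (RealCrossing ℕ)} {c : MarkovClass}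
    (h : Reps L (C₁ ++ P ++ C₂) c) (T : List ℕ) (hT : T ≠ [])
    (hTL : ∀ x ∈ T, ∃ y, (x, y) ∈ L ∨ (y, x) ∈ L)
    (h₁ : ∀ x ∈ labels C₁, x ∉ T) (h₂ : ∀ x ∈ labels C₂, x ∉ T) (hP' : ∀ x ∈ labels P', x ∈ T)
    (H : ∀ (m : ℕ) (ν : Equiv.Perm (Fin m)) (k : ℕ → Fin m),
      (∀ x ∈ T, ∀ y ∈ T, k x = k y → x = y) →
      (∀ x ∈ T, ∀ y ∈ T, (x, y) ∈ L → ν (k x) = k y) →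
      ∀ a ∈ avoid (T.map k), ∀ b ∈ avoid (T.map k),
        cl (a * word (P.map (RealCrossing.map k)) * b * (ofPerm ν)⁻¹)
          = cl (a * word (P'.map (RealCrossing.map k)) * b * (ofPerm ν)⁻¹)) :
    Reps L (C₁ ++ P' ++ C₂) c := by
  obtain ⟨m, ℓ, ν, D, hℓ, hL, hC, rfl⟩ := h
  have hrange : ∀ x ∈ T, ∃ i, ℓ i = x := fun x hx => by
    obtain ⟨y, h | h⟩ := hTL x hx
    all_goals
      rw [hL] at h
      obtain ⟨i, _, hi⟩ := Multiset.mem_map.1 h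
    · exact ⟨i, congrArg Prod.fst hi⟩
    · exact ⟨ν i, congrArg Prod.snd hi⟩
  obtain ⟨x₀, hx₀⟩ := List.exists_mem_of_ne_nil T hT
  have : Nonempty (Fin m) := ⟨(hrange x₀ hx₀).choose⟩
  set k := Function.invFun ℓ
  have hk (i) : k (ℓ i) = i := Function.leftInverse_invFun hℓ i
  have hk' : ∀ x ∈ T, ℓ (k x) = x := fun x hx => Function.invFun_eq (hrange x hx)
  obtain ⟨D', D₂, rfl, hC', hC₂⟩ := List.map_eq_append_iff.1 hC.symm
  obtain ⟨D₁, D₃, rfl, hC₁, hP⟩ := List.map_eq_append_iff.1 hC'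
  have hD₃ : D₃ = P.map (RealCrossing.map k) := by
    rw [← hP, List.map_map]
    refine ((List.map_congr_left fun c _ => ?_).trans (List.map_id _)).symm
    simp [RealCrossing.map, hk]
  have hav {E : List (RealCrossing (Fin m))} {C : List (RealCrossing ℕ)}
      (hE : E.map (RealCrossing.map ℓ) = C) (hC : ∀ x ∈ labels C, x ∉ T) :
      word E ∈ avoid (T.map k) := by
    refine word_mem_avoid fun i hi hi' => ?_
    obtain ⟨x, hx, rfl⟩ := List.mem_map.1 hi'
    refine hC x ?_ hx
    rw [← hE, labels_map, ← hk' x hx]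
    exact List.mem_map_of_mem hi
  refine ⟨m, ℓ, ν, D₁ ++ P'.map (RealCrossing.map k) ++ D₂, hℓ, hL, ?_, ?_⟩
  · rw [List.map_append, List.map_append, hC₁, hC₂, List.map_map]
    congr 2
    exact (map_eq_self (f := ℓ ∘ k) fun x hx => hk' x (hP' x hx)).symm
  · have := H m ν k (fun x hx y hy hxy => by rw [← hk' x hx, hxy, hk' y hy])
      (fun x hx y hy hxy => by
        rw [hL] at hxy
        obtain ⟨i, _, hi⟩ := Multiset.mem_map.1 hxy
        have hi1 : ℓ i = x := congrArg Prod.fst hi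
        have hi2 : ℓ (ν i) = y := congrArg Prod.snd hi
        rw [← hi1, hk, ← hi2, hk]) _ (hav hC₁ h₁) _ (hav hC₂ h₂)
    rw [word_append, word_append, word_append, word_append, hD₃, this]

/-- The data of a labelling by `0, …, N - 1` in which each label has one successor and one
predecessor belong to some braid. -/
theorem exists_reps {N : ℕ} {L : Multiset (ℕ × ℕ)} {C : List (RealCrossing ℕ)}
    (h₁ : L.map Prod.fst = Multiset.range N) (h₂ : L.map Prod.snd = Multiset.range N)
    (hC : ∀ x ∈ labels C, x < N) : ∃ c, Reps L C c := by
  have hex (i : Fin N) : ∃ j : Fin N, ((i : ℕ), (j : ℕ)) ∈ L := by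
    have : (i : ℕ) ∈ L.map Prod.fst := by rw [h₁]; exact Multiset.mem_range.2 i.2
    obtain ⟨⟨a, b⟩, hab, rfl : a = i⟩ := Multiset.mem_map.1 this
    have : b ∈ L.map Prod.snd := Multiset.mem_map.2 ⟨_, hab, rfl⟩
    rw [h₂] at this
    exact ⟨⟨b, Multiset.mem_range.1 this⟩, hab⟩
  choose g hg using hex
  have hnd : (L.map Prod.fst).Nodup := h₁ ▸ Multiset.nodup_range N
  have hnd' : (L.map Prod.snd).Nodup := h₂ ▸ Multiset.nodup_range N
  have hginj : Function.Injective g := fun i j hij => by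
    have := Multiset.inj_on_of_nodup_map hnd' _ (hg i) _ (hg j) (by rw [hij])
    exact Fin.ext (congrArg Prod.fst this)
  let ν : Equiv.Perm (Fin N) := Equiv.ofBijective g (Finite.injective_iff_bijective.1 hginj)
  obtain ⟨D, hD⟩ := exists_map_eq (f := ((↑) : Fin N → ℕ)) (C := C)
    fun x hx => ⟨⟨x, hC x hx⟩, rfl⟩
  refine ⟨_, N, (↑), ν, D, Fin.val_injective, ?_, hD, rfl⟩
  refine (Multiset.eq_of_le_of_card_le ?_ ?_).symm
  · rw [Multiset.le_iff_subset]
    · intro x hx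
      obtain ⟨i, _, rfl⟩ := Multiset.mem_map.1 hx
      exact hg i
    · exact (Finset.univ.nodup).map fun i j hij => Fin.ext (congrArg Prod.fst hij)
  · have := congrArg Multiset.card h₁
    simp only [Multiset.card_map, Multiset.card_range] at this
    simp [this]

/-- The link of consecutive labels `a`, `b` along a strand that goes from top to bottom or, if the
direction is `up`, from bottom to top. -/
def link : Dir → ℕ → ℕ → ℕ × ℕ
  | .down, a, b => (a, b)
  | .up, a, b => (b, a)

theorem map_link (ρ : ℕ → ℕ) (d : Dir) (a b : ℕ) : Prod.map ρ ρ (link d a b) = link d (ρ a) (ρ b) := by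
  cases d <;> rfl

theorem link_opp (d : Dir) (a b : ℕ) : link d.opp a b = link d b a := by
  cases d <;> rfl

/-- A strand without crossings is united with one of its neighbours. -/
theorem Reps.join {L : Multiset (ℕ × ℕ)} {C : List (RealCrossing ℕ)} {c : MarkovClass} {d : Dir}
    {a p : ℕ} (h : Reps (link d a p ::ₘ L) C c) (hap : a < p) (hp : p ∉ labels C) :
    Reps (L.map (Prod.map (merge a p) (merge a p)))
      (C.map (RealCrossing.map (merge a p))) c := by
  have e : merge a p a = merge a p p := by
    simp [merge, hap.ne, hap.not_gt]
  cases d with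
  | down =>
    have := Reps.contract (C₁ := C) (C₂ := []) (by simpa [link] using h) hap.ne hp (by simp [labels])
      e fun x y => merge_eq hap
    simpa using this
  | up =>
    exact Reps.contract (C₁ := []) (C₂ := C) (by simpa [link] using h) hap.ne' (by simp [labels]) hp
      e.symm fun x y hxy => (merge_eq hap hxy).imp_right Or.symm

namespace VB

variable {m : ℕ}

theorem avoid_commute {T : List (Fin m)} {p q : Fin m} (hp : p ∈ T) (hq : q ∈ T) (hpq : p ≠ q)
    (o e : Bool) {b : VB m} (hb : b ∈ avoid T) : Commute b (real o e p q) := by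
  induction hb using Subgroup.closure_induction with
  | mem b hb =>
    obtain ⟨r, t, hr, ht, rfl⟩ := hb
    rcases eq_or_ne r t with rfl | hrt
    · rw [x_self]; exact Commute.one_left _
    · refine real_commute true true o e hrt hpq ?_ ?_ ?_ ?_
      all_goals rintro rfl; contradiction
  | one => exact Commute.one_left _
  | mul a b _ _ ha hb => exact ha.mul_left hb
  | inv a _ ha => exact ha.inv_left

/-- A bigon of a strand cut into `p` and `p'` and a strand cut into `q` and `q'`, in either
direction, vanishes. -/
theorem cl_bigon_cut {ν : Equiv.Perm (Fin m)} {p p' q q' : Fin m} (hp : ν p = p' ∨ ν p' = p)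
    (hq : ν q = q' ∨ ν q' = q) (hn : [p, p', q, q'].Nodup) {a b : VB m}
    (ha : a ∈ avoid [p, p', q, q']) (hb : b ∈ avoid [p, p', q, q']) (o e : Bool) :
    cl (a * (real o e p q * real o (!e) p' q') * b * (ofPerm ν)⁻¹)
      = cl (a * b * (ofPerm ν)⁻¹) := by
  have ia {l} (hl : l ∈ [p, p', q, q']) : a ∈ idle l := avoid_le_idle hl ha
  have ib {l} (hl : l ∈ [p, p', q, q']) : b ∈ idle l := avoid_le_idle hl hb
  have sc {k l} (hk : k ∈ [p, p', q, q']) (hl : l ∈ [p, p', q, q']) := swap_conj_avoid hk hl hb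
  simp only [List.mem_cons, List.not_mem_nil, or_false] at ia ib sc
  clear ha hb
  -- the case of two strands directed downwards, and that of opposite directions
  have par {p p' q q' : Fin m} (hp : ν p = p') (hq : ν q = q') (hn : [p, p', q, q'].Nodup)
      (ia : a ∈ idle p' ∧ a ∈ idle q') (ib : b ∈ idle p ∧ b ∈ idle q)
      (sp : ofPerm (Equiv.swap p p') * b * (ofPerm (Equiv.swap p p'))⁻¹ = b)
      (sq : ofPerm (Equiv.swap q q') * b * (ofPerm (Equiv.swap q q'))⁻¹ = b) (e : Bool) :
      cl (a * (real o e p q * real o (!e) p' q') * b * (ofPerm ν)⁻¹)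
        = cl (a * b * (ofPerm ν)⁻¹) := by
    simp only [List.nodup_cons, List.mem_cons, List.not_mem_nil, or_false, not_or, List.nodup_nil,
      not_false_eq_true, and_true] at hn
    obtain ⟨⟨pp', pq, pq'⟩, ⟨p'q, p'q'⟩, qq'⟩ := hn
    have s1 := cl_slide hp pp' (a := a * real o e p q) (b := real o (!e) p' q' * b)
      (mul_mem ia.1 (real_mem_idle _ _ pp' (Ne.symm p'q)))
      (mul_mem (real_mem_idle _ _ (Ne.symm pp') (Ne.symm pq')) ib.1)
      (by rw [← conj_mul, sp, ofPerm_conj_real, Equiv.swap_apply_right,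
        Equiv.swap_apply_of_ne_of_ne (Ne.symm pq') (Ne.symm p'q')])
    have s2 := cl_slide hq qq' (a := a * real o e p q) (b := real o (!e) p q' * b)
      (mul_mem ia.2 (real_mem_idle _ _ pq' qq'))
      (mul_mem (real_mem_idle _ _ pq (Ne.symm qq')) ib.2)
      (by rw [← conj_mul, sq, ofPerm_conj_real, Equiv.swap_apply_right,
        Equiv.swap_apply_of_ne_of_ne pq pq'])
    simp only [mul_assoc] at s1 s2 ⊢
    rw [s1, s2, real_not_right, mul_inv_cancel_left]
  have anti {p p' q q' : Fin m} (hp : ν p = p') (hq : ν q' = q) (hn : [p, p', q, q'].Nodup)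
      (ia : a ∈ idle p' ∧ a ∈ idle q) (ib : b ∈ idle p ∧ b ∈ idle q')
      (sp : ofPerm (Equiv.swap p p') * b * (ofPerm (Equiv.swap p p'))⁻¹ = b) (o : Bool) :
      cl (a * (real o e p q * real o (!e) p' q') * b * (ofPerm ν)⁻¹)
        = cl (a * b * (ofPerm ν)⁻¹) := by
    simp only [List.nodup_cons, List.mem_cons, List.not_mem_nil, or_false, not_or, List.nodup_nil,
      not_false_eq_true, and_true] at hn
    obtain ⟨⟨pp', pq, pq'⟩, ⟨p'q, p'q'⟩, qq'⟩ := hn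
    have s1 := cl_slide hp pp' (a := a * real o e p q) (b := real o (!e) p' q' * b)
      (mul_mem ia.1 (real_mem_idle _ _ pp' (Ne.symm p'q)))
      (mul_mem (real_mem_idle _ _ (Ne.symm pp') (Ne.symm pq')) ib.1)
      (by rw [← conj_mul, sp, ofPerm_conj_real, Equiv.swap_apply_right,
        Equiv.swap_apply_of_ne_of_ne (Ne.symm pq') (Ne.symm p'q')])
    have s2 := cl_bigon hq (Ne.symm pq') (Ne.symm pq) (!o) (!e) ia.2 (one_mem _) ib.2
    simp only [real_not_left, Bool.not_not, mul_one] at s2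
    simp only [mul_assoc] at s1 s2 ⊢
    rw [s1, s2]
  have hn' : [p', p, q', q].Nodup := by
    simp only [List.nodup_cons, List.mem_cons, List.not_mem_nil, or_false, not_or, List.nodup_nil,
      not_false_eq_true, and_true] at hn ⊢
    tauto
  have hn'' : [q, q', p, p'].Nodup := by
    simp only [List.nodup_cons, List.mem_cons, List.not_mem_nil, or_false, not_or, List.nodup_nil,
      not_false_eq_true, and_true] at hn ⊢
    tauto
  rcases hp with hp | hp <;> rcases hq with hq | hq
  · exact par hp hq hn ⟨ia (by simp), ia (by simp)⟩ ⟨ib (by simp), ib (by simp)⟩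
      (sc (by simp) (by simp)) (sc (by simp) (by simp)) e
  · exact anti hp hq hn ⟨ia (by simp), ia (by simp)⟩ ⟨ib (by simp), ib (by simp)⟩
      (sc (by simp) (by simp)) o
  · have := anti hq hp hn'' ⟨ia (by simp), ia (by simp)⟩ ⟨ib (by simp), ib (by simp)⟩
      (sc (by simp) (by simp)) (!o)
    simpa only [real_not_left] using this
  · have := par hp hq hn' ⟨ia (by simp), ia (by simp)⟩ ⟨ib (by simp), ib (by simp)⟩
      (sc (by simp) (by simp)) (sc (by simp) (by simp)) (!e)
    rw [Bool.not_not] at this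
    rw [← this]
    simp only [List.nodup_cons, List.mem_cons, List.not_mem_nil, or_false, not_or, List.nodup_nil,
      not_false_eq_true, and_true] at hn
    obtain ⟨⟨pp', pq, pq'⟩, ⟨p'q, p'q'⟩, qq'⟩ := hn
    rw [(real_commute o e o (!e) pq p'q' pp' pq' (Ne.symm p'q) qq').eq]

end VB

/-! ### Tracing a sliced diagram -/

/-- Sign contribution of a direction. -/
def Dir.isUp : Dir → Bool
  | .down => false
  | .up => true

/-- The real crossing at which the rising strand is over if `o` is true, otherwise the falling
strand. -/
def Crossing.ofBool : Bool → Crossing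
  | true => .risingOver
  | false => .fallingOver

theorem Crossing.flip_ofBool (o : Bool) : (ofBool o).flip = ofBool !o := by cases o <;> rfl

theorem Crossing.eq_ofBool : ∀ t : Crossing, t = .virt ∨ ∃ o, t = ofBool o
  | .fallingOver => .inr ⟨false, rfl⟩
  | .risingOver => .inr ⟨true, rfl⟩
  | .virt => .inl rfl

/-- The result of tracing a part of a diagram from top to bottom, while the strands are labelled:
`n` is the first label that has not been used, `ends` are the directions and labels on the bottom
line, `links` are the pairs of consecutive labels along the strands, and `crossings` are the real
crossings. -/
structure Trace where
  n : ℕ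
  ends : List (Dir × ℕ)
  links : Multiset (ℕ × ℕ)
  crossings : List (RealCrossing ℕ)

/-- Additional strands to the left. -/
def Trace.left (l : List (Dir × ℕ)) (t : Trace) : Trace := { t with ends := l ++ t.ends }

/-- Tracing one piece that starts at the leftmost strand. A maximum has one new label, a real
crossing has new labels for the parts of the falling and of the rising strand below it. (The sign
of a crossing changes with the direction of one of the strands.) -/
def Piece.trace : Piece → ℕ → List (Dir × ℕ) → Trace
  | .max d, n, f => ⟨n + 1, (d, n) :: (d.opp, n) :: f, 0, []⟩
  | .min, n, (d, a) :: (_, b) :: f => ⟨n, f, {link d a b}, []⟩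
  | .crossing .virt, n, α :: β :: f => ⟨n, β :: α :: f, 0, []⟩
  | .crossing .fallingOver, n, (d, a) :: (d', b) :: f =>
    ⟨n + 2, (d', n + 1) :: (d, n) :: f, {link d a n, link d' b (n + 1)},
      [⟨false, d.isUp ^^ d'.isUp, n, n + 1⟩]⟩
  | .crossing .risingOver, n, (d, a) :: (d', b) :: f =>
    ⟨n + 2, (d', n + 1) :: (d, n) :: f, {link d a n, link d' b (n + 1)},
      [⟨true, !(d.isUp ^^ d'.isUp), n, n + 1⟩]⟩
  | _, n, f => ⟨n, f, 0, []⟩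

/-- Tracing one slice. -/
def Piece.traceAt (p : Piece) : ℕ → ℕ → List (Dir × ℕ) → Trace
  | 0, n, f => p.trace n f
  | _ + 1, n, [] => ⟨n, [], 0, []⟩
  | i + 1, n, α :: f => (p.traceAt i n f).left [α]

/-- Tracing a part of a diagram, when the unused labels are `n, n + 1, …` and the strands on the top
line have the directions and labels `f`. -/
def trace : List Slice → ℕ → List (Dir × ℕ) → Trace
  | [], n, f => ⟨n, f, 0, []⟩
  | c :: w, n, f =>
    let t := c.piece.traceAt c.pos n f
    let t' := trace w t.n t.ends
    ⟨t'.n, t'.ends, t.links + t'.links, t.crossings ++ t'.crossings⟩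

theorem trace_real (o : Bool) (n : ℕ) (d d' : Dir) (a b : ℕ) (f : List (Dir × ℕ)) :
    (Piece.crossing (.ofBool o)).trace n ((d, a) :: (d', b) :: f)
      = ⟨n + 2, (d', n + 1) :: (d, n) :: f, {link d a n, link d' b (n + 1)},
        [⟨o, o ^^ (d.isUp ^^ d'.isUp), n, n + 1⟩]⟩ := by
  cases o
  · simp [Crossing.ofBool, Piece.trace]
  · simp [Crossing.ofBool, Piece.trace]

theorem trace_append (u w : List Slice) (n : ℕ) (f : List (Dir × ℕ)) :
    trace (u ++ w) n f = ⟨(trace w (trace u n f).n (trace u n f).ends).n,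
      (trace w (trace u n f).n (trace u n f).ends).ends,
      (trace u n f).links + (trace w (trace u n f).n (trace u n f).ends).links,
      (trace u n f).crossings ++ (trace w (trace u n f).n (trace u n f).ends).crossings⟩ := by
  induction u generalizing n f with
  | nil => simp [trace]
  | cons c u ih => simp [trace, ih, add_assoc]

theorem Trace.left_left (l l' : List (Dir × ℕ)) (t : Trace) :
    (t.left l').left l = t.left (l ++ l') := by
  simp [Trace.left]

theorem traceAt_append (p : Piece) (l : List (Dir × ℕ)) (i n : ℕ) (f : List (Dir × ℕ)) :
    p.traceAt (l.length + i) n (l ++ f) = (p.traceAt i n f).left l := by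
  induction l with
  | nil => simp [Trace.left]
  | cons α l ih =>
    rw [List.length_cons, Nat.add_right_comm, List.cons_append, Piece.traceAt, ih, Trace.left_left]
    rfl

/-- A slice with `i` more strands to the left. -/
def Slice.right (i : ℕ) (c : Slice) : Slice := ⟨c.piece, i + c.pos⟩

theorem trace_left (w : List Slice) (l : List (Dir × ℕ)) (n : ℕ) (f : List (Dir × ℕ)) :
    trace (w.map (Slice.right l.length)) n (l ++ f) = (trace w n f).left l := by
  induction w generalizing n f with
  | nil => rfl
  | cons c w ih =>
    simp only [List.map_cons, trace, Slice.right, traceAt_append]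
    simp only [Trace.left, ih]

/-! ### Substitution of the labels -/

/-- Change of the labels of strands. -/
def relabel (ρ : ℕ → ℕ) (f : List (Dir × ℕ)) : List (Dir × ℕ) := f.map (Prod.map id ρ)

/-- The trace `t'` is obtained from `t` by the substitution `ρ` of the labels. -/
structure Trace.Subst (ρ : ℕ → ℕ) (t t' : Trace) : Prop where
  new : ∀ j, ρ (t.n + j) = t'.n + j
  ends : t'.ends = relabel ρ t.ends
  links : t'.links = t.links.map (Prod.map ρ ρ)
  crossings : t'.crossings = t.crossings.map (RealCrossing.map ρ)

theorem subst_piece (p : Piece) {ρ : ℕ → ℕ} {n n' : ℕ} (h : ∀ j, ρ (n + j) = n' + j)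
    (f : List (Dir × ℕ)) : (p.trace n f).Subst ρ (p.trace n' (relabel ρ f)) := by
  have h0 : ρ n = n' := h 0
  have h1 : ρ (n + 1) = n' + 1 := h 1
  have h2 : ∀ j, ρ (n + 2 + j) = n' + 2 + j := fun j => by rw [add_assoc, h, add_assoc]
  have h3 : ∀ j, ρ (n + 1 + j) = n' + 1 + j := fun j => by rw [add_assoc, h, add_assoc]
  cases p with
  | max d => constructor <;> simp [Piece.trace, h3, relabel, h0]
  | min => match f with
    | [] => constructor <;> simp [Piece.trace, h, relabel]
    | [(_, _)] => constructor <;> simp [Piece.trace, h, relabel]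
    | (d, a) :: (d', b) :: f => constructor <;> simp [Piece.trace, h, relabel, map_link]
  | crossing t => cases t <;> match f with
    | [] => constructor <;> simp [Piece.trace, h, relabel]
    | [(_, _)] => constructor <;> simp [Piece.trace, h, relabel]
    | (d, a) :: (d', b) :: f =>
      constructor <;>
        simp [Piece.trace, h, h2, h0, relabel, map_link, RealCrossing.map]

theorem subst_traceAt (p : Piece) (i : ℕ) {ρ : ℕ → ℕ} {n n' : ℕ} (h : ∀ j, ρ (n + j) = n' + j)
    (f : List (Dir × ℕ)) : (p.traceAt i n f).Subst ρ (p.traceAt i n' (relabel ρ f)) := by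
  induction i generalizing f with
  | zero => exact subst_piece p h f
  | succ i ih => match f with
    | [] => constructor <;> simp [Piece.traceAt, h, relabel]
    | α :: f =>
      obtain ⟨h1, h2, h3, h4⟩ := ih f
      exact ⟨h1, by simp [Piece.traceAt, Trace.left, relabel] at h2 ⊢; exact h2, h3, h4⟩

theorem subst_trace (w : List Slice) {ρ : ℕ → ℕ} {n n' : ℕ} (h : ∀ j, ρ (n + j) = n' + j)
    (f : List (Dir × ℕ)) : (trace w n f).Subst ρ (trace w n' (relabel ρ f)) := by
  induction w generalizing n n' f with
  | nil => constructor <;> simp [trace, h]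
  | cons c w ih =>
    obtain ⟨h1, h2, h3, h4⟩ := subst_traceAt c.piece c.pos h f
    obtain ⟨k1, k2, k3, k4⟩ := ih h1 (c.piece.traceAt c.pos n f).ends
    rw [← h2] at k1 k2 k3 k4
    exact ⟨k1, k2, by simp only [trace, h3, k3, Multiset.map_add],
      by simp only [trace, h4, k4, List.map_append]⟩

/-! ### The labels of a trace -/

/-- The labels of the strands with direction `d`. -/
def labelsOf : Dir → List (Dir × ℕ) → Multiset ℕ
  | _, [] => 0
  | .down, (.down, a) :: f => a ::ₘ labelsOf .down f
  | .up, (.up, a) :: f => a ::ₘ labelsOf .up f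
  | d, _ :: f => labelsOf d f

theorem labelsOf_append (d : Dir) (f f' : List (Dir × ℕ)) :
    labelsOf d (f ++ f') = labelsOf d f + labelsOf d f' := by
  induction f with
  | nil => cases d <;> simp [labelsOf]
  | cons α f ih =>
    obtain ⟨d', a⟩ := α
    cases d <;> cases d' <;> simp [labelsOf, ih]

theorem mem_labelsOf {d : Dir} {a : ℕ} {f : List (Dir × ℕ)} (h : (d, a) ∈ f) : a ∈ labelsOf d f := by
  obtain ⟨f, f', rfl⟩ := List.append_of_mem h
  rw [labelsOf_append]
  cases d <;> simp [labelsOf]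

/-- Each label is the source of one link, unless it belongs to a strand going downwards on the
bottom line, and likewise for the targets. -/
structure Trace.Counts (n : ℕ) (f : List (Dir × ℕ)) (t : Trace) : Prop where
  fst : t.links.map Prod.fst + labelsOf .down t.ends + Multiset.range n
    = labelsOf .down f + Multiset.range t.n
  snd : t.links.map Prod.snd + labelsOf .up t.ends + Multiset.range n
    = labelsOf .up f + Multiset.range t.n

theorem Trace.Counts.left {n : ℕ} {f : List (Dir × ℕ)} {t : Trace} (h : t.Counts n f)
    (l : List (Dir × ℕ)) : (t.left l).Counts n (l ++ f) := by
  constructor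
  · simp only [Trace.left, labelsOf_append]
    rw [add_assoc (labelsOf _ l), ← h.fst]; abel
  · simp only [Trace.left, labelsOf_append]
    rw [add_assoc (labelsOf _ l), ← h.snd]; abel

theorem Slice.Step.counts {s s' : List Dir} {c : Slice} (h : c.Step s s') {f : List (Dir × ℕ)}
    (hf : f.map Prod.fst = s) (n : ℕ) :
    (c.piece.traceAt c.pos n f).ends.map Prod.fst = s' ∧
      (c.piece.traceAt c.pos n f).Counts n f := by
  have key (p : Piece) (i : ℕ) {f₁ f₂ : List (Dir × ℕ)} (hi : i = f₁.length)
      (H : (p.trace n f₂).Counts n f₂) : p.traceAt i n (f₁ ++ f₂) = (p.trace n f₂).left f₁ ∧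
      (p.traceAt i n (f₁ ++ f₂)).Counts n (f₁ ++ f₂) := by
    have := traceAt_append p f₁ 0 n f₂
    rw [Nat.add_zero, ← hi] at this
    rw [this]
    exact ⟨rfl, H.left f₁⟩
  cases h with
  | crossing l r d d' t =>
    obtain ⟨f₁, f', rfl, rfl, hf'⟩ := List.map_eq_append_iff.1 hf
    obtain ⟨⟨d, a⟩, f'', rfl, rfl, hf''⟩ := List.map_eq_cons_iff.1 hf'
    obtain ⟨⟨d', b⟩, f₂, rfl, rfl, rfl⟩ := List.map_eq_cons_iff.1 hf''
    obtain ⟨h1, h2⟩ := key (.crossing t) _ (f₂ := (d, a) :: (d', b) :: f₂)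
      (List.length_map (as := f₁) Prod.fst) (by
      rcases t.eq_ofBool with rfl | ⟨o, rfl⟩
      · constructor
        all_goals
          cases d <;> cases d' <;>
          simp [Piece.trace, labelsOf, Multiset.cons_swap]
      · rw [trace_real]
        constructor
        all_goals
          cases d <;> cases d' <;>
          simp [labelsOf, link, Multiset.range_succ, ← Multiset.singleton_add] <;> abel)
    refine ⟨?_, h2⟩
    rw [h1]
    cases t <;> simp [Trace.left, Piece.trace]
  | max l r d =>
    obtain ⟨f₁, f₂, rfl, rfl, rfl⟩ := List.map_eq_append_iff.1 hf
    obtain ⟨h1, h2⟩ := key (.max d) _ (f₂ := f₂)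
      (List.length_map (as := f₁) Prod.fst) (by
      constructor
      all_goals
        cases d <;>
        simp [Piece.trace, labelsOf, Dir.opp, Multiset.range_succ, ← Multiset.singleton_add] <;> abel)
    refine ⟨?_, h2⟩
    rw [h1]
    simp [Trace.left, Piece.trace]
  | min l r d =>
    obtain ⟨f₁, f', rfl, rfl, hf'⟩ := List.map_eq_append_iff.1 hf
    obtain ⟨⟨d, a⟩, f'', rfl, rfl, hf''⟩ := List.map_eq_cons_iff.1 hf'
    obtain ⟨⟨d', b⟩, f₂, rfl, hd, rfl⟩ := List.map_eq_cons_iff.1 hf''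
    obtain rfl : d' = d.opp := hd
    obtain ⟨h1, h2⟩ := key .min _ (f₂ := (d, a) :: (d.opp, b) :: f₂)
      (List.length_map (as := f₁) Prod.fst) (by
      constructor
      all_goals
        cases d <;> simp [Piece.trace, labelsOf, Dir.opp, link])
    refine ⟨?_, h2⟩
    rw [h1]
    simp [Trace.left, Piece.trace]

theorem Run.counts {s s' : List Dir} {w : List Slice} (h : Run s w s') {f : List (Dir × ℕ)}
    (hf : f.map Prod.fst = s) (n : ℕ) :
    (trace w n f).ends.map Prod.fst = s' ∧ (trace w n f).Counts n f := by
  have hadd {x₁ x₂ d₀ d₁ d₂ r₀ r₁ r₂ : Multiset ℕ} (h : x₁ + d₁ + r₀ = d₀ + r₁)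
      (h' : x₂ + d₂ + r₁ = d₁ + r₂) : x₁ + x₂ + d₂ + r₀ = d₀ + r₂ := by
    apply add_right_cancel (b := d₁ + r₁)
    calc x₁ + x₂ + d₂ + r₀ + (d₁ + r₁) = (x₁ + d₁ + r₀) + (x₂ + d₂ + r₁) := by abel
      _ = d₀ + r₂ + (d₁ + r₁) := by rw [h, h']; abel
  induction h generalizing n f with
  | nil s => exact ⟨hf, ⟨by simp [trace], by simp [trace]⟩⟩
  | cons h _ ih =>
    obtain ⟨h1, h2⟩ := h.counts hf n
    obtain ⟨h3, h4⟩ := ih h1 _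
    refine ⟨h3, ?_, ?_⟩
    · simpa only [trace, Multiset.map_add] using hadd h2.fst h4.fst
    · simpa only [trace, Multiset.map_add] using hadd h2.snd h4.snd

theorem traceAt_crossings (p : Piece) (i n : ℕ) (f : List (Dir × ℕ)) :
    n ≤ (p.traceAt i n f).n ∧
      ∀ x ∈ labels (p.traceAt i n f).crossings, n ≤ x ∧ x < (p.traceAt i n f).n := by
  induction i generalizing f with
  | succ i ih => match f with
    | [] => simp [Piece.traceAt, labels]
    | α :: f => exact ih f
  | zero => cases p with
    | max d => simp [Piece.traceAt, Piece.trace, labels]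
    | min => match f with
      | [] => simp [Piece.traceAt, Piece.trace, labels]
      | [_] => simp [Piece.traceAt, Piece.trace, labels]
      | (d, a) :: (d', b) :: f => simp [Piece.traceAt, Piece.trace, labels]
    | crossing t => cases t <;> match f with
      | [] => simp [Piece.traceAt, Piece.trace, labels]
      | [_] => simp [Piece.traceAt, Piece.trace, labels]
      | (d, a) :: (d', b) :: f => simp [Piece.traceAt, Piece.trace, labels]

theorem trace_crossings (w : List Slice) (n : ℕ) (f : List (Dir × ℕ)) :
    n ≤ (trace w n f).n ∧
      ∀ x ∈ labels (trace w n f).crossings, n ≤ x ∧ x < (trace w n f).n := by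
  induction w generalizing n f with
  | nil => simp [trace, labels]
  | cons c w ih =>
    obtain ⟨h1, h2⟩ := traceAt_crossings c.piece c.pos n f
    obtain ⟨h3, h4⟩ := ih (c.piece.traceAt c.pos n f).n (c.piece.traceAt c.pos n f).ends
    refine ⟨h1.trans h3, fun x hx => ?_⟩
    rw [trace, labels_append, List.mem_append] at hx
    rcases hx with hx | hx
    · exact ⟨(h2 x hx).1, (h2 x hx).2.trans_le h3⟩
    · exact ⟨h1.trans (h4 x hx).1, (h4 x hx).2⟩

/-- The labels on the bottom line and of the links have been used. -/
theorem Trace.Counts.lt {n : ℕ} {f : List (Dir × ℕ)} {t : Trace} (h : t.Counts n f)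
    (hf : ∀ α ∈ f, α.2 < n) (hn : n ≤ t.n) :
    (∀ α ∈ t.ends, α.2 < t.n) ∧ ∀ y ∈ t.links, y.1 < t.n ∧ y.2 < t.n := by
  have hd (d : Dir) : ∀ a ∈ labelsOf d f, a < n := by
    intro a ha
    clear h
    induction f with
    | nil => cases d <;> simp [labelsOf] at ha
    | cons α f ih =>
      obtain ⟨d', b⟩ := α
      have hb : b < n := hf (d', b) (by simp)
      have ih := ih fun α hα => hf α (by simp [hα])
      cases d <;> cases d' <;> simp only [labelsOf, Multiset.mem_cons] at ha <;> grind
  have k1 : ∀ a ∈ labelsOf .down f + Multiset.range t.n, a < t.n := fun a ha =>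
    (Multiset.mem_add.1 ha).elim (fun h => (hd _ a h).trans_le hn) Multiset.mem_range.1
  have k2 : ∀ a ∈ labelsOf .up f + Multiset.range t.n, a < t.n := fun a ha =>
    (Multiset.mem_add.1 ha).elim (fun h => (hd _ a h).trans_le hn) Multiset.mem_range.1
  rw [← h.fst] at k1
  rw [← h.snd] at k2
  simp only [Multiset.mem_add] at k1 k2
  refine ⟨?_, fun y hy => ⟨k1 _ (.inl (.inl (Multiset.mem_map_of_mem _ hy))),
    k2 _ (.inl (.inl (Multiset.mem_map_of_mem _ hy)))⟩⟩
  rintro ⟨d | d, a⟩ hα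
  · exact k1 _ (.inl (.inr (mem_labelsOf hα)))
  · exact k2 _ (.inl (.inr (mem_labelsOf hα)))

/-! ### The Markov class of a link diagram -/

/-- The Markov class of the braids whose closures have the Gauss data of a diagram. -/
def LinkDiagram.HasClass (K : LinkDiagram) (c : MarkovClass) : Prop :=
  Reps (trace K.1 0 []).links (trace K.1 0 []).crossings c

theorem LinkDiagram.exists_hasClass (K : LinkDiagram) : ∃ c, K.HasClass c := by
  obtain ⟨h1, h2⟩ := K.2.counts (f := []) rfl 0
  rw [List.map_eq_nil_iff] at h1
  have h3 := h2.fst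
  have h4 := h2.snd
  rw [h1] at h3 h4
  exact exists_reps (by simpa [labelsOf] using h3) (by simpa [labelsOf] using h4)
    fun x hx => ((trace_crossings _ _ _).2 x hx).2

/-! ### Invariance of the Markov class under local changes -/

/-- Replacing the part `u` of a diagram by `v`, when `n` labels have been used above it and the
strands `f` enter from above, does not change the Markov class. -/
def LocalInvariance (n : ℕ) (f : List (Dir × ℕ)) (u v : List Slice) : Prop :=
  ∃ ρ : ℕ → ℕ, (∀ k < n, ρ k = k) ∧ (∀ j, ρ ((trace u n f).n + j) = (trace v n f).n + j) ∧
    (trace v n f).ends = relabel ρ (trace u n f).ends ∧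
    ∀ (L : Multiset (ℕ × ℕ)) (C₁ C₂ : List (RealCrossing ℕ)) (c : MarkovClass),
      (∀ x ∈ labels C₁, x < n) → (∀ x ∈ labels C₂, (trace u n f).n ≤ x) →
      Reps ((trace u n f).links + L) (C₁ ++ (trace u n f).crossings ++ C₂) c →
      Reps ((trace v n f).links + L.map (Prod.map ρ ρ))
        (C₁ ++ (trace v n f).crossings ++ C₂.map (RealCrossing.map ρ)) c

theorem relabel_eq_self {ρ : ℕ → ℕ} {f : List (Dir × ℕ)} (h : ∀ α ∈ f, ρ α.2 = α.2) :
    relabel ρ f = f := by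
  unfold relabel
  refine (List.map_congr_left fun α hα => ?_).trans (List.map_id _)
  exact Prod.ext rfl (h α hα)

theorem relabel_append (ρ : ℕ → ℕ) (f f' : List (Dir × ℕ)) :
    relabel ρ (f ++ f') = relabel ρ f ++ relabel ρ f' := List.map_append

theorem LocalInvariance.left {n : ℕ} {f : List (Dir × ℕ)} {u v : List Slice}
    (h : LocalInvariance n f u v) {l : List (Dir × ℕ)} (hl : ∀ α ∈ l, α.2 < n) :
    LocalInvariance n (l ++ f) (u.map (Slice.right l.length)) (v.map (Slice.right l.length)) := by
  obtain ⟨ρ, h1, h2, h3, h4⟩ := h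
  unfold LocalInvariance
  rw [trace_left, trace_left]
  refine ⟨ρ, h1, h2, ?_, h4⟩
  simp only [Trace.left, relabel_append, h3]
  rw [relabel_eq_self fun α hα => h1 _ (hl α hα)]

theorem LocalInvariance.of_eq {n : ℕ} {f : List (Dir × ℕ)} {u v : List Slice}
    (h : trace u n f = trace v n f) : LocalInvariance n f u v := by
  refine ⟨id, fun _ _ => rfl, fun _ => by rw [h]; rfl, ?_, fun L C₁ C₂ c _ _ H => ?_⟩
  · rw [h, relabel_eq_self fun _ _ => rfl]
  · rw [h] at H
    rw [map_eq_self (f := id) fun _ _ => rfl]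
    simpa using H

/-- A local change of the diagram that preserves the Markov class of all labelled data preserves
the Markov class of the diagram. -/
theorem LinkDiagram.HasClass.replace {K K' : LinkDiagram} {c : MarkovClass} (hK : K.HasClass c)
    {x u v y : List Slice} {s : List Dir} (hx : Run [] x s) (e : K.1 = x ++ u ++ y)
    (e' : K'.1 = x ++ v ++ y)
    (h : ∀ n f, f.map Prod.fst = s → (∀ α ∈ f, α.2 < n) → LocalInvariance n f u v) :
    K'.HasClass c := by
  unfold HasClass at *
  obtain ⟨h1, h2⟩ := hx.counts (f := []) rfl 0
  obtain ⟨h3, h4⟩ := h2.lt (by simp) (Nat.zero_le _)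
  obtain ⟨ρ, r1, r2, r3, r4⟩ := h (trace x 0 []).n _ h1 h3
  rw [e, trace_append, trace_append] at hK
  rw [e', trace_append, trace_append]
  set tx := trace x 0 []
  set tu := trace u tx.n tx.ends
  set tv := trace v tx.n tx.ends
  obtain ⟨-, -, s3, s4⟩ := subst_trace y r2 tu.ends
  rw [← r3] at s3 s4
  simp only at hK ⊢
  have := r4 (tx.links + (trace y tu.n tu.ends).links) tx.crossings (trace y tu.n tu.ends).crossings
    c (fun z hz => ((trace_crossings _ _ _).2 z hz).2)
    (fun z hz => ((trace_crossings _ _ _).2 z hz).1)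
    (by convert hK using 1; abel)
  rw [s3, s4]
  convert this using 1
  have : tx.links.map (Prod.map ρ ρ) = tx.links := by
    refine (Multiset.map_congr rfl fun y hy => ?_).trans (Multiset.map_id _)
    exact Prod.ext (r1 _ (h4 y hy).1) (r1 _ (h4 y hy).2)
  rw [Multiset.map_add, this]
  abel

/-! ### The form of the strands at a piece -/

theorem step_right_iff {l s t : List Dir} {p : Piece} {i : ℕ} :
    Slice.Step (l ++ s) ⟨p, l.length + i⟩ t ↔ ∃ s', Slice.Step s ⟨p, i⟩ s' ∧ t = l ++ s' := by
  constructor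
  · have key {l₁ r₁ : List Dir} (h : l ++ s = l₁ ++ r₁) (hi : l₁.length = l.length + i) :
        ∃ l₂, l₁ = l ++ l₂ ∧ l₂.length = i ∧ s = l₂ ++ r₁ := by
      rcases List.append_eq_append_iff.1 h with ⟨m, rfl, rfl⟩ | ⟨m, rfl, rfl⟩
      · exact ⟨m, rfl, by simpa using hi, rfl⟩
      · have : m = [] := by
          rw [← List.length_eq_zero_iff]; simp at hi; omega
        subst this
        exact ⟨[], by simp, by simp at hi; simp [hi], by simp⟩
    intro h
    generalize hs : l ++ s = s₀ at h
    generalize hc : (⟨p, l.length + i⟩ : Slice) = c at h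
    cases h with
    | crossing l₁ r a b t =>
      obtain ⟨rfl, hi⟩ := Slice.mk.injEq _ _ _ _ ▸ hc
      obtain ⟨l₂, rfl, rfl, rfl⟩ := key hs hi.symm
      exact ⟨_, .crossing l₂ r a b t, by simp⟩
    | max l₁ r d =>
      obtain ⟨rfl, hi⟩ := Slice.mk.injEq _ _ _ _ ▸ hc
      obtain ⟨l₂, rfl, rfl, rfl⟩ := key hs hi.symm
      exact ⟨_, .max l₂ r d, by simp⟩
    | min l₁ r d =>
      obtain ⟨rfl, hi⟩ := Slice.mk.injEq _ _ _ _ ▸ hc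
      obtain ⟨l₂, rfl, rfl, rfl⟩ := key hs hi.symm
      exact ⟨_, .min l₂ r d, by simp⟩
  · rintro ⟨s', h, rfl⟩
    generalize hc : (⟨p, i⟩ : Slice) = c at h
    cases h with
    | crossing l₁ r a b t =>
      obtain ⟨rfl, rfl⟩ := Slice.mk.injEq _ _ _ _ ▸ hc
      simpa using Slice.Step.crossing (l ++ l₁) r a b t
    | max l₁ r d =>
      obtain ⟨rfl, rfl⟩ := Slice.mk.injEq _ _ _ _ ▸ hc
      simpa using Slice.Step.max (l ++ l₁) r d
    | min l₁ r d =>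
      obtain ⟨rfl, rfl⟩ := Slice.mk.injEq _ _ _ _ ▸ hc
      simpa using Slice.Step.min (l ++ l₁) r d

theorem step_le {s t : List Dir} {p : Piece} {i : ℕ} (h : Slice.Step s ⟨p, i⟩ t) :
    i + p.top ≤ s.length := by
  generalize hc : (⟨p, i⟩ : Slice) = c at h
  cases h <;> obtain ⟨rfl, rfl⟩ := Slice.mk.injEq _ _ _ _ ▸ hc <;> simp [Piece.top]

theorem step_succ_iff {s t : List Dir} {p : Piece} {i : ℕ} :
    Slice.Step s ⟨p, i + 1⟩ t ↔ ∃ d r r', s = d :: r ∧ t = d :: r' ∧ Slice.Step r ⟨p, i⟩ r' := by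
  constructor
  · intro h
    have := step_le h
    cases s with
    | nil => simp at this
    | cons d s =>
      obtain ⟨s', h1, h2⟩ := (step_right_iff (l := [d]) (i := i)).1 (by rwa [add_comm i 1] at h)
      exact ⟨d, s, s', rfl, h2, h1⟩
  · rintro ⟨d, r, r', rfl, rfl, h⟩
    rw [add_comm i 1]
    exact (step_right_iff (l := [d])).2 ⟨r', h, rfl⟩

theorem step_crossing_iff {s s' : List Dir} {t : Crossing} :
    Slice.Step s ⟨.crossing t, 0⟩ s' ↔ ∃ a b r, s = a :: b :: r ∧ s' = b :: a :: r := by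
  constructor
  · intro h
    generalize hc : (⟨.crossing t, 0⟩ : Slice) = c at h
    cases h with
    | crossing l₁ r a b t =>
      obtain ⟨-, hi⟩ := Slice.mk.injEq _ _ _ _ ▸ hc
      obtain rfl := List.length_eq_zero_iff.1 hi.symm
      exact ⟨a, b, r, rfl, rfl⟩
    | max => simp at hc
    | min => simp at hc
  · rintro ⟨a, b, r, rfl, rfl⟩
    exact .crossing [] r a b t

theorem step_max_iff {s s' : List Dir} {d : Dir} :
    Slice.Step s ⟨.max d, 0⟩ s' ↔ s' = d :: d.opp :: s := by
  constructor
  · intro h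
    generalize hc : (⟨.max d, 0⟩ : Slice) = c at h
    cases h with
    | crossing => simp at hc
    | max l₁ r d =>
      obtain ⟨hp, hi⟩ := Slice.mk.injEq _ _ _ _ ▸ hc
      obtain rfl := List.length_eq_zero_iff.1 hi.symm
      cases hp
      rfl
    | min => simp at hc
  · rintro rfl
    exact .max [] s d

theorem step_min_iff {s s' : List Dir} :
    Slice.Step s ⟨.min, 0⟩ s' ↔ ∃ d, s = d :: d.opp :: s' := by
  constructor
  · intro h
    generalize hc : (⟨.min, 0⟩ : Slice) = c at h
    cases h with
    | crossing => simp at hc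
    | max => simp at hc
    | min l₁ r d =>
      obtain ⟨-, hi⟩ := Slice.mk.injEq _ _ _ _ ▸ hc
      obtain rfl := List.length_eq_zero_iff.1 hi.symm
      exact ⟨d, rfl⟩
  · rintro ⟨d, rfl⟩
    exact .min [] s' d

theorem run_nil_iff {s s' : List Dir} : Run s [] s' ↔ s' = s :=
  ⟨fun h => by cases h; rfl, fun h => h ▸ .nil _⟩

theorem run_cons_iff {s s' : List Dir} {c : Slice} {w : List Slice} :
    Run s (c :: w) s' ↔ ∃ t, c.Step s t ∧ Run t w s' :=
  ⟨fun h => by cases h with | cons h hw => exact ⟨_, h, hw⟩, fun ⟨_, h, hw⟩ => .cons h hw⟩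

theorem run_right_iff {l s t : List Dir} {w : List Slice} :
    Run (l ++ s) (w.map (Slice.right l.length)) t ↔ ∃ s', Run s w s' ∧ t = l ++ s' := by
  induction w generalizing s t with
  | nil => simp [run_nil_iff]
  | cons c w ih =>
    simp only [List.map_cons, run_cons_iff]
    constructor
    · rintro ⟨t', h, hw⟩
      obtain ⟨s', h', rfl⟩ := step_right_iff.1 h
      obtain ⟨s'', hw', rfl⟩ := ih.1 hw
      exact ⟨s'', ⟨s', h', hw'⟩, rfl⟩
    · rintro ⟨s'', ⟨s', h', hw'⟩, rfl⟩
      exact ⟨_, step_right_iff.2 ⟨s', h', rfl⟩, ih.2 ⟨_, hw', rfl⟩⟩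

/-- Strands to the left of a part of a diagram may be left out. -/
theorem LocalInvariance.of_right {n : ℕ} {f : List (Dir × ℕ)} {u v : List Slice} {s' : List Dir}
    {i : ℕ} (hi : i ≤ f.length) (hf : ∀ α ∈ f, α.2 < n)
    (hu : Run (f.map Prod.fst) (u.map (Slice.right i)) s')
    (h : ∀ f' s', (∀ α ∈ f', α.2 < n) → Run (f'.map Prod.fst) u s' → LocalInvariance n f' u v) :
    LocalInvariance n f (u.map (Slice.right i)) (v.map (Slice.right i)) := by
  obtain ⟨l, g, rfl, rfl⟩ : ∃ l g, f = l ++ g ∧ l.length = i :=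
    ⟨f.take i, f.drop i, (List.take_append_drop i f).symm, by simp [hi]⟩
  rw [List.map_append, show l.length = (l.map Prod.fst).length by simp] at hu
  obtain ⟨t, hu', -⟩ := run_right_iff.1 hu
  exact (h g t (fun α hα => hf α (by simp [hα])) hu').left fun α hα => hf α (by simp [hα])

/-! ### Reidemeister moves on Gauss data -/

theorem map_of_link {m : ℕ} {L : Multiset (ℕ × ℕ)} {ν : Equiv.Perm (Fin m)} {k : ℕ → Fin m}
    {T : List ℕ} (hν : ∀ x ∈ T, ∀ y ∈ T, (x, y) ∈ L → ν (k x) = k y) {d : Dir} {p q : ℕ}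
    (h : link d p q ∈ L) (hp : p ∈ T) (hq : q ∈ T) :
    (d = .down ∧ ν (k p) = k q) ∨ (d = .up ∧ ν (k q) = k p) := by
  cases d
  · exact .inl ⟨rfl, hν p hp q hq h⟩
  · exact .inr ⟨rfl, hν q hq p hp h⟩

theorem nodup_map_of_injOn {α β : Type*} {T : List α} {k : α → β} (hT : T.Nodup)
    (hk : ∀ x ∈ T, ∀ y ∈ T, k x = k y → x = y) : (T.map k).Nodup :=
  (List.nodup_map_iff_inj_on hT).2 hk

/-- A crossing moves along a strand, which is cut into `p` and `q`. -/
theorem Reps.slide {L : Multiset (ℕ × ℕ)} {C₁ C₂ : List (RealCrossing ℕ)} {c : MarkovClass}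
    {d : Dir} {p q r : ℕ} {o e : Bool} (h : Reps L (C₁ ++ [⟨o, e, p, r⟩] ++ C₂) c)
    (hpq : link d p q ∈ L) (hr : ∃ y, (r, y) ∈ L ∨ (y, r) ∈ L) (hn : [p, q, r].Nodup)
    (h₁ : ∀ x ∈ labels C₁, x ∉ [p, q, r]) (h₂ : ∀ x ∈ labels C₂, x ∉ [p, q, r]) :
    Reps L (C₁ ++ [⟨o, e, q, r⟩] ++ C₂) c := by
  refine h.replace [p, q, r] (by simp) ?_ h₁ h₂ (by simp [labels]) ?_
  · simp only [List.mem_cons, List.not_mem_nil, or_false, forall_eq_or_imp, forall_eq]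
    cases d
    · exact ⟨⟨q, .inl hpq⟩, ⟨p, .inr hpq⟩, hr⟩
    · exact ⟨⟨q, .inr hpq⟩, ⟨p, .inl hpq⟩, hr⟩
  · intro m ν k hk hν a ha b hb
    have hn' := nodup_map_of_injOn hn hk
    have hν' := map_of_link hν hpq (by simp) (by simp)
    simp only [List.map_cons, List.map_nil] at hn' ha hb
    simp only [List.map_cons, List.map_nil, RealCrossing.map, word_cons, word_nil, mul_one]
    generalize k p = p at *
    generalize k q = q at *
    generalize k r = r at *
    have key {p q : Fin m} (h : ν p = q) (hpq : p ≠ q) (hpr : p ≠ r) (hqr : q ≠ r)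
        (ha : a ∈ idle q) (hb : b ∈ idle p)
        (hs : ofPerm (Equiv.swap p q) * b * (ofPerm (Equiv.swap p q))⁻¹ = b) :
        cl (a * real o e p r * b * (ofPerm ν)⁻¹) = cl (a * real o e q r * b * (ofPerm ν)⁻¹) := by
      have := cl_slide h hpq (b := real o e q r * b) ha
        (mul_mem (real_mem_idle _ _ hpq.symm hpr.symm) hb)
        (by rw [← conj_mul, hs, ofPerm_conj_real, Equiv.swap_apply_right,
          Equiv.swap_apply_of_ne_of_ne hpr.symm hqr.symm])
      simpa only [mul_assoc] using this.symm
    simp only [List.nodup_cons, List.mem_cons, List.not_mem_nil, or_false, not_or, List.nodup_nil,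
      not_false_eq_true, and_true] at hn'
    obtain ⟨⟨pq, pr⟩, qr⟩ := hn'
    rcases hν' with ⟨-, hν'⟩ | ⟨-, hν'⟩
    · exact key hν' pq pr qr (avoid_le_idle (by simp) ha) (avoid_le_idle (by simp) hb)
        (swap_conj_avoid (by simp) (by simp) hb)
    · exact (key hν' (Ne.symm pq) qr pr (avoid_le_idle (by simp) ha) (avoid_le_idle (by simp) hb)
        (swap_conj_avoid (by simp) (by simp) hb)).symm

/-- The first Reidemeister move: the crossing of two parts `p` and `r` of a strand vanishes when
between them there is only a part without crossings. -/
theorem Reps.kink {L : Multiset (ℕ × ℕ)} {C₁ C₂ : List (RealCrossing ℕ)} {c : MarkovClass}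
    {d : Dir} {p q r : ℕ} {o e : Bool} (h : Reps L (C₁ ++ [⟨o, e, p, r⟩] ++ C₂) c)
    (hpq : link d p q ∈ L) (hqr : link d q r ∈ L) (hn : [p, q, r].Nodup)
    (h₁ : ∀ x ∈ labels C₁, x ∉ [p, q, r]) (h₂ : ∀ x ∈ labels C₂, x ∉ [p, q, r]) :
    Reps L (C₁ ++ C₂) c := by
  suffices Reps L (C₁ ++ [] ++ C₂) c by simpa using this
  refine h.replace [p, q, r] (by simp) ?_ h₁ h₂ (by simp [labels]) ?_
  · simp only [List.mem_cons, List.not_mem_nil, or_false, forall_eq_or_imp, forall_eq]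
    cases d
    · exact ⟨⟨q, .inl hpq⟩, ⟨p, .inr hpq⟩, ⟨q, .inr hqr⟩⟩
    · exact ⟨⟨q, .inr hpq⟩, ⟨p, .inl hpq⟩, ⟨q, .inl hqr⟩⟩
  · intro m ν k hk hν a ha b hb
    have hn' := nodup_map_of_injOn hn hk
    have hν' := map_of_link hν hpq (by simp) (by simp)
    have hν'' := map_of_link hν hqr (by simp) (by simp)
    simp only [List.map_cons, List.map_nil] at hn' ha hb
    simp only [List.map_cons, List.map_nil, RealCrossing.map, word_cons, word_nil, mul_one]
    generalize k p = p at *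
    generalize k q = q at *
    generalize k r = r at *
    simp only [List.nodup_cons, List.mem_cons, List.not_mem_nil, or_false, not_or, List.nodup_nil,
      not_false_eq_true, and_true] at hn'
    obtain ⟨⟨pq, pr⟩, qr⟩ := hn'
    rw [mul_assoc a, ← (avoid_commute (by simp) (by simp) pr o e hb).eq, ← mul_assoc a]
    have hab := mul_mem ha hb
    rcases hν' with ⟨rfl, hν'⟩ | ⟨rfl, hν'⟩
    · exact cl_kink hν' (by simpa using hν'') pq pr qr o e (avoid_le_idle (by simp) hab)
        (avoid_le_idle (by simp) hab)
    · have := cl_kink (by simpa using hν'') hν' (Ne.symm qr) (Ne.symm pr) (Ne.symm pq) (!o) e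
        (avoid_le_idle (by simp) hab) (avoid_le_idle (by simp) hab)
      rwa [real_not_left] at this

/-- The second Reidemeister move for two strands, cut into `p`, `p'` and `q`, `q'`. -/
theorem Reps.bigon {L : Multiset (ℕ × ℕ)} {C₁ C₂ : List (RealCrossing ℕ)} {c : MarkovClass}
    {d d' : Dir} {p p' q q' : ℕ} {o e : Bool}
    (h : Reps L (C₁ ++ [⟨o, e, p, q⟩, ⟨!o, !e, q', p'⟩] ++ C₂) c)
    (hp : link d p p' ∈ L) (hq : link d' q q' ∈ L) (hn : [p, p', q, q'].Nodup)
    (h₁ : ∀ x ∈ labels C₁, x ∉ [p, p', q, q']) (h₂ : ∀ x ∈ labels C₂, x ∉ [p, p', q, q']) :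
    Reps L (C₁ ++ C₂) c := by
  suffices Reps L (C₁ ++ [] ++ C₂) c by simpa using this
  refine h.replace [p, p', q, q'] (by simp) ?_ h₁ h₂ (by simp [labels]) ?_
  · simp only [List.mem_cons, List.not_mem_nil, or_false, forall_eq_or_imp, forall_eq]
    have hex {d p p'} (h : link d p p' ∈ L) :
        (∃ y, (p, y) ∈ L ∨ (y, p) ∈ L) ∧ ∃ y, (p', y) ∈ L ∨ (y, p') ∈ L := by
      cases d
      · exact ⟨⟨p', .inl h⟩, ⟨p, .inr h⟩⟩
      · exact ⟨⟨p', .inr h⟩, ⟨p, .inl h⟩⟩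
    exact ⟨(hex hp).1, (hex hp).2, (hex hq).1, (hex hq).2⟩
  · intro m ν k hk hν a ha b hb
    have hn' := nodup_map_of_injOn hn hk
    have hν' := map_of_link hν hp (by simp) (by simp)
    have hν'' := map_of_link hν hq (by simp) (by simp)
    simp only [List.map_cons, List.map_nil] at hn' ha hb
    simp only [List.map_cons, List.map_nil, RealCrossing.map, word_cons, word_nil, mul_one,
      real_not_left]
    exact cl_bigon_cut (hν'.imp And.right And.right) (hν''.imp And.right And.right) hn' ha hb o e

/-- Consecutive crossings of different strands may be interchanged. -/
theorem Reps.swap {L : Multiset (ℕ × ℕ)} {C₁ C₂ : List (RealCrossing ℕ)} {c : MarkovClass}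
    {p q r t : ℕ} {o e o' e' : Bool}
    (h : Reps L (C₁ ++ [⟨o, e, p, q⟩, ⟨o', e', r, t⟩] ++ C₂) c)
    (hL : ∀ x ∈ [p, q, r, t], ∃ y, (x, y) ∈ L ∨ (y, x) ∈ L) (hn : [p, q, r, t].Nodup)
    (h₁ : ∀ x ∈ labels C₁, x ∉ [p, q, r, t]) (h₂ : ∀ x ∈ labels C₂, x ∉ [p, q, r, t]) :
    Reps L (C₁ ++ [⟨o', e', r, t⟩, ⟨o, e, p, q⟩] ++ C₂) c := by
  refine h.replace [p, q, r, t] (by simp) hL h₁ h₂ (by simp [labels]) ?_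
  intro m ν k hk hν a ha b hb
  have hn' := nodup_map_of_injOn hn hk
  simp only [List.map_cons, List.map_nil] at hn'
  simp only [List.map_cons, List.map_nil, RealCrossing.map, word_cons, word_nil, mul_one]
  simp only [List.nodup_cons, List.mem_cons, List.not_mem_nil, or_false, not_or, List.nodup_nil,
    not_false_eq_true, and_true] at hn'
  obtain ⟨⟨pq, pr, pt⟩, ⟨qr, qt⟩, rt⟩ := hn'
  rw [(real_commute o e o' e' pq rt pr pt qr qt).eq]

/-! ### Invariance under the moves -/

section

variable {n : ℕ}

theorem merge_of_lt {a p k : ℕ} (h : k < p) : merge a p k = k := by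
  unfold merge; split_ifs <;> omega

theorem merge_of_gt {a p k : ℕ} (h : p < k) : merge a p k = k - 1 := by
  unfold merge; split_ifs <;> omega

theorem merge_add {a p j : ℕ} : merge a p (p + 1 + j) = p + j := by
  unfold merge; split_ifs <;> omega

theorem merge_self {a p : ℕ} : merge a p p = a := by
  simp [merge]

theorem notMem_labels_of_le {C : List (RealCrossing ℕ)} {N k : ℕ} (h : ∀ x ∈ labels C, N ≤ x)
    (hk : k < N) : k ∉ labels C := fun hx => (h _ hx).not_gt hk

theorem notMem_labels_of_lt {C : List (RealCrossing ℕ)} {N k : ℕ} (h : ∀ x ∈ labels C, x < N)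
    (hk : N ≤ k) : k ∉ labels C := fun hx => (h _ hx).not_ge hk

/-- A new strand without crossings is joined to a strand from above. -/
theorem LocalInvariance.of_merge {f : List (Dir × ℕ)} {u v : List Slice} {d : Dir} {a : ℕ}
    (ha : a < n) (hu1 : (trace u n f).n = n + 1) (hu2 : (trace u n f).links = {link d a n})
    (hu3 : (trace u n f).crossings = []) (hv1 : (trace v n f).n = n)
    (hv2 : (trace v n f).links = 0) (hv3 : (trace v n f).crossings = [])
    (he : (trace v n f).ends = relabel (merge a n) (trace u n f).ends) :
    LocalInvariance n f u v := by
  refine ⟨merge a n, fun k hk => merge_of_lt hk, fun j => by rw [hu1, hv1, merge_add], he, ?_⟩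
  intro L C₁ C₂ c h₁ h₂ h
  rw [hu1] at h₂
  rw [hu2, hu3, List.append_nil, Multiset.singleton_add] at h
  have := h.join ha (by
    rw [labels_append, List.mem_append, not_or]
    exact ⟨notMem_labels_of_lt h₁ le_rfl, notMem_labels_of_le h₂ (by omega)⟩)
  rw [List.map_append, map_eq_self fun x hx => merge_of_lt (h₁ x hx)] at this
  rwa [hv2, hv3, zero_add, List.append_nil]

theorem relabel_merge {f : List (Dir × ℕ)} {a p : ℕ} (h : ∀ α ∈ f, α.2 < p) :
    relabel (merge a p) f = f := relabel_eq_self fun α hα => merge_of_lt (h α hα)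

theorem relabel_cons (ρ : ℕ → ℕ) (d : Dir) (a : ℕ) (f : List (Dir × ℕ)) :
    relabel ρ ((d, a) :: f) = (d, ρ a) :: relabel ρ f := rfl

theorem opp_opp (d : Dir) : d.opp.opp = d := by cases d <;> rfl

/-- A change that amounts to a renaming of the new labels and to a change of crossings between
them. -/
theorem LocalInvariance.of_rename {f : List (Dir × ℕ)} {u v : List Slice} {N : ℕ} (ρ : ℕ → ℕ)
    (hρ : Function.Injective ρ) (h₁ : ∀ k < n, ρ k = k)
    (h₂ : ∀ k, N ≤ k → ρ k = k) (hu : (trace u n f).n = N)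
    (hv : (trace v n f).n = N) (he : (trace v n f).ends = relabel ρ (trace u n f).ends)
    (hl : (trace v n f).links = (trace u n f).links.map (Prod.map ρ ρ))
    (hc : ∀ (L : Multiset (ℕ × ℕ)) (C₁ C₂ : List (RealCrossing ℕ)) (c : MarkovClass),
      (∀ x ∈ labels C₁, x < n) → (∀ x ∈ labels C₂, N ≤ x) →
      Reps ((trace v n f).links + L)
        (C₁ ++ (trace u n f).crossings.map (RealCrossing.map ρ) ++ C₂) c →
      Reps ((trace v n f).links + L) (C₁ ++ (trace v n f).crossings ++ C₂) c) :
    LocalInvariance n f u v := by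
  refine ⟨ρ, h₁, fun j => by rw [hu, hv, h₂ _ (Nat.le_add_right _ _)], he, ?_⟩
  intro L C₁ C₂ c k₁ k₂ h
  rw [hu] at k₂
  have e₂ : C₂.map (RealCrossing.map ρ) = C₂ := map_eq_self fun x hx => h₂ _ (k₂ x hx)
  rw [e₂]
  refine hc _ _ _ _ k₁ k₂ ?_
  have := h.map hρ
  rw [Multiset.map_add, List.map_append, List.map_append, e₂,
    map_eq_self fun x hx => h₁ _ (k₁ x hx)] at this
  rwa [hl]

theorem Reps.flip {L : Multiset (ℕ × ℕ)} {C₁ C₂ : List (RealCrossing ℕ)} {c : MarkovClass}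
    {p q : ℕ} {o e : Bool} (h : Reps L (C₁ ++ [⟨o, e, p, q⟩] ++ C₂) c) :
    Reps L (C₁ ++ [⟨!o, e, q, p⟩] ++ C₂) c := by
  obtain ⟨m, ℓ, ν, D, hℓ, hL, hC, rfl⟩ := h
  obtain ⟨D', D₂, rfl, hC', hC₂⟩ := List.map_eq_append_iff.1 hC.symm
  obtain ⟨D₁, D₃, rfl, hC₁, hP⟩ := List.map_eq_append_iff.1 hC'
  obtain ⟨⟨o', e', i, j⟩, D₄, rfl, hP, hD₄⟩ := List.map_eq_cons_iff.1 hP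
  obtain rfl := List.map_eq_nil_iff.1 hD₄
  cases hP
  refine ⟨m, ℓ, ν, D₁ ++ [⟨!o', e', j, i⟩] ++ D₂, hℓ, hL, ?_, ?_⟩
  · simp [RealCrossing.map, hC₁, hC₂]
  · simp only [word_append, word_cons, real_not_left]

theorem step_one_iff {s s' : List Dir} {p : Piece} : Slice.Step s ⟨p, 1⟩ s' ↔
    ∃ d r r', s = d :: r ∧ s' = d :: r' ∧ Slice.Step r ⟨p, 0⟩ r' := step_succ_iff

theorem trace_max (d : Dir) (n : ℕ) (f : List (Dir × ℕ)) :
    (Piece.max d).trace n f = ⟨n + 1, (d, n) :: (d.opp, n) :: f, 0, []⟩ := rfl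

theorem trace_min (d d' : Dir) (n a b : ℕ) (f : List (Dir × ℕ)) :
    Piece.min.trace n ((d, a) :: (d', b) :: f) = ⟨n, f, {link d a b}, []⟩ := rfl

theorem trace_virt (α β : Dir × ℕ) (n : ℕ) (f : List (Dir × ℕ)) :
    (Piece.crossing .virt).trace n (α :: β :: f) = ⟨n, β :: α :: f, 0, []⟩ := rfl

theorem traceAt_zero (p : Piece) (n : ℕ) (f : List (Dir × ℕ)) : p.traceAt 0 n f = p.trace n f := rfl

theorem traceAt_one (p : Piece) (n : ℕ) (α : Dir × ℕ) (f : List (Dir × ℕ)) :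
    p.traceAt 1 n (α :: f) = (p.trace n f).left [α] := rfl

attribute [local simp] run_cons_iff run_nil_iff step_max_iff step_min_iff step_crossing_iff
  step_one_iff trace trace_max trace_min trace_virt trace_real traceAt_zero traceAt_one Trace.left
  relabel_cons merge_self opp_opp map_link link_opp

theorem localInvariance_zigzag_left (d : Dir) {f : List (Dir × ℕ)} {s' : List Dir}
    (hf : ∀ α ∈ f, α.2 < n) (h : Run (f.map Prod.fst) [⟨.max d, 1⟩, ⟨.min, 0⟩] s') :
    LocalInvariance n f [⟨.max d, 1⟩, ⟨.min, 0⟩] [] := by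
  rcases f with _ | ⟨⟨x, a⟩, r⟩
  · simp at h
  · obtain ⟨rfl, -⟩ : d = x.opp ∧ d.opp :: r.map Prod.fst = s' := by simpa using h
    simp only [List.forall_mem_cons] at hf
    refine .of_merge (d := x) (a := a) hf.1 rfl rfl rfl rfl rfl rfl ?_
    simp [relabel_cons, relabel_merge hf.2, opp_opp,
      merge_self]

theorem localInvariance_zigzag_right (d : Dir) {f : List (Dir × ℕ)} {s' : List Dir}
    (hf : ∀ α ∈ f, α.2 < n) (h : Run (f.map Prod.fst) [⟨.max d, 0⟩, ⟨.min, 1⟩] s') :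
    LocalInvariance n f [⟨.max d, 0⟩, ⟨.min, 1⟩] [] := by
  rcases f with _ | ⟨⟨x, a⟩, r⟩
  · simp at h
  · obtain ⟨rfl, -⟩ : x = d ∧ s' = d :: r.map Prod.fst := by simpa [opp_opp] using h
    simp only [List.forall_mem_cons] at hf
    refine .of_merge (d := x) (a := a) hf.1 rfl ?_ rfl rfl rfl rfl ?_
    · simp [link_opp]
    · simp [relabel_cons, relabel_merge hf.2,
        merge_self]

theorem localInvariance_crossing_min (t : Crossing) {f : List (Dir × ℕ)} {s' : List Dir}
    (hf : ∀ α ∈ f, α.2 < n) (h : Run (f.map Prod.fst) [⟨.crossing t, 0⟩, ⟨.min, 1⟩] s') :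
    LocalInvariance n f [⟨.crossing t, 0⟩, ⟨.min, 1⟩] [⟨.crossing t.flip, 1⟩, ⟨.min, 0⟩] := by
  rcases f with _ | ⟨⟨x, a⟩, _ | ⟨⟨y, b⟩, _ | ⟨⟨z, e⟩, r⟩⟩⟩
  · simp at h
  · simp at h
  · simp at h
  obtain ⟨rfl, -⟩ : z = x.opp ∧ s' = y :: r.map Prod.fst := by simpa using h
  rcases t.eq_ofBool with rfl | ⟨o, rfl⟩
  · exact .of_eq (by simp [Crossing.flip])
  · rw [Crossing.flip_ofBool]
    simp only [List.forall_mem_cons] at hf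
    obtain ⟨ha, hb, he, hr⟩ := hf
    have hρ {k : ℕ} (h : k < n) : Equiv.swap n (n + 1) k = k :=
      Equiv.swap_apply_of_ne_of_ne h.ne (by omega)
    have hu : trace [⟨.crossing (.ofBool o), 0⟩, ⟨.min, 1⟩] n ((x, a) :: (y, b) :: (x.opp, e) :: r)
        = ⟨n + 2, (y, n + 1) :: r, {link x a n, link y b (n + 1), link x n e},
          [⟨o, o ^^ (x.isUp ^^ y.isUp), n, n + 1⟩]⟩ := by
      simp
    have hv : trace [⟨.crossing (.ofBool !o), 1⟩, ⟨.min, 0⟩] n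
        ((x, a) :: (y, b) :: (x.opp, e) :: r)
        = ⟨n + 2, (y, n) :: r, {link y b n, link x (n + 1) e, link x a (n + 1)},
          [⟨!o, o ^^ (x.isUp ^^ y.isUp), n, n + 1⟩]⟩ := by
      have : (!(o ^^ (y.isUp ^^ x.opp.isUp))) = (o ^^ (x.isUp ^^ y.isUp)) := by
        cases o <;> cases x <;> cases y <;> rfl
      simp [Multiset.cons_swap, this]
    refine .of_rename (N := n + 2) (Equiv.swap n (n + 1)) (Equiv.injective _) (fun _ => hρ)
      (fun k hk => Equiv.swap_apply_of_ne_of_ne (by omega) (by omega)) (by rw [hu]) (by rw [hv])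
      ?_ ?_ ?_
    · rw [hu, hv]
      simp [relabel_eq_self fun α hα => hρ (hr α hα)]
    · rw [hu, hv]
      simp [hρ ha, hρ hb, hρ he]
      simp only [← Multiset.singleton_add]
      abel
    · intro L C₁ C₂ c _ _ h
      rw [hu] at h
      rw [hv] at h ⊢
      simpa [RealCrossing.map] using h.flip

/-- Three consecutive new strands without crossings are joined to a strand from above. -/
theorem Reps.join_three {L : Multiset (ℕ × ℕ)} {C : List (RealCrossing ℕ)} {c : MarkovClass}
    {d : Dir} {a : ℕ} (ha : a < n) (hC : ∀ x ∈ labels C, x < n ∨ n + 3 ≤ x) {p q : ℕ}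
    (hpq : p = n + 1 ∧ q = n + 2 ∨ p = n + 2 ∧ q = n + 1)
    (h : Reps ({link d a p, link d p n, link d n q} + L) C c) {ρ : ℕ → ℕ}
    (hρ : ρ = merge a n ∘ merge n (n + 1) ∘ merge n (n + 2)) :
    Reps (L.map (Prod.map ρ ρ)) (C.map (RealCrossing.map ρ)) c := by
  have e0 : merge n (n + 2) a = a := merge_of_lt (by omega)
  have e1 : merge n (n + 2) n = n := merge_of_lt (by omega)
  have e2 : merge n (n + 2) (n + 1) = n + 1 := merge_of_lt (by omega)
  have e3 : merge n (n + 1) a = a := merge_of_lt (by omega)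
  have e4 : merge n (n + 1) n = n := merge_of_lt (by omega)
  set ρ₁ := merge n (n + 2)
  have k : ∃ d' z, merge n (n + 1) z = n ∧
      Reps ({link d a z, link d' n (n + 1)} + L.map (Prod.map ρ₁ ρ₁))
        (C.map (RealCrossing.map ρ₁)) c := by
    have hn : n + 2 ∉ labels C := fun h => by have := hC _ h; omega
    rcases hpq with ⟨rfl, rfl⟩ | ⟨rfl, rfl⟩
    · refine ⟨d.opp, n + 1, merge_self, ?_⟩
      have := Reps.join (d := d) (a := n) (p := n + 2) (C := C) (c := c)
        (L := {link d a (n + 1), link d (n + 1) n} + L) (by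
          convert h using 1
          simp only [Multiset.insert_eq_cons, ← Multiset.singleton_add]; abel) (by omega) hn
      simpa [ρ₁, e0, e1, e2] using this
    · refine ⟨d, n, e4, ?_⟩
      have := Reps.join (d := d.opp) (a := n) (p := n + 2) (C := C) (c := c)
        (L := {link d a (n + 2), link d n (n + 1)} + L) (by
          convert h using 1
          simp only [Multiset.insert_eq_cons, ← Multiset.singleton_add, link_opp]; abel)
        (by omega) hn
      simpa [ρ₁, e0, e1, e2] using this
  have hn' : n + 1 ∉ labels (C.map (RealCrossing.map ρ₁)) := by
    rw [labels_map, List.mem_map]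
    rintro ⟨x, hx, hx'⟩
    have := hC x hx
    simp only [ρ₁, merge] at hx'
    split_ifs at hx' <;> omega
  obtain ⟨d', z, hz, k⟩ := k
  have k' := Reps.join (d := d') (a := n) (p := n + 1)
    (L := {link d a z} + L.map (Prod.map ρ₁ ρ₁)) (by
      convert k using 1
      simp only [Multiset.insert_eq_cons, ← Multiset.singleton_add]; abel) (by omega) hn'
  rw [Multiset.map_add, Multiset.map_singleton, map_link, e3, hz, Multiset.singleton_add] at k'
  have := k'.join ha (by
    rw [labels_map, labels_map, List.mem_map]
    rintro ⟨y, hy, hy'⟩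
    obtain ⟨x, hx, rfl⟩ := List.mem_map.1 hy
    have := hC x hx
    simp only [ρ₁, merge] at hy'
    split_ifs at hy' <;> omega)
  rw [Multiset.map_map, Multiset.map_map, List.map_map, List.map_map] at this
  rw [hρ]
  exact this

/-- A kink: the crossing is removed, and the three new labels are joined to that from above. -/
theorem LocalInvariance.of_kink {f : List (Dir × ℕ)} {u v : List Slice} {d : Dir} {a p q k : ℕ}
    {o e : Bool} {r : List (Dir × ℕ)} (ha : a < n) (hr : ∀ α ∈ r, α.2 < n)
    (hpq : p = n + 1 ∧ q = n + 2 ∨ p = n + 2 ∧ q = n + 1) (hk : k = n + 1 ∨ k = n + 2)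
    (hu : trace u n f = ⟨n + 3, (d, k) :: r, {link d a p, link d p n, link d n q},
        [⟨o, e, n + 1, n + 2⟩]⟩)
    (hv : trace v n f = ⟨n, (d, a) :: r, 0, []⟩) :
    LocalInvariance n f u v := by
  have hlt {k} (hk : k < n) : (merge a n ∘ merge n (n + 1) ∘ merge n (n + 2)) k = k := by
    simp only [Function.comp, merge]; split_ifs <;> omega
  refine ⟨merge a n ∘ merge n (n + 1) ∘ merge n (n + 2), fun k => hlt, fun j => ?_, ?_,
    fun L C₁ C₂ c h₁ h₂ h => ?_⟩
  · rw [hu, hv]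
    simp only [Function.comp, merge]; split_ifs <;> omega
  · rw [hu, hv]
    simp only [relabel_cons, relabel_eq_self fun α hα => hlt (hr α hα)]
    congr 2
    simp only [Function.comp, merge]; split_ifs <;> omega
  · rw [hu] at h h₂
    rw [hv]
    have hC {x} (hx : x ∈ labels (C₁ ++ C₂)) : x < n ∨ n + 3 ≤ x := by
      rw [labels_append, List.mem_append] at hx
      exact hx.imp (h₁ x) (h₂ x)
    have k1 : Reps ({link d a p, link d p n, link d n q} + L) (C₁ ++ C₂) c := by
      rcases hpq with ⟨rfl, rfl⟩ | ⟨rfl, rfl⟩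
      · refine h.kink (d := d) (p := n + 1) (q := n) (r := n + 2) (by simp) (by simp) (by simp) ?_ ?_
        · intro x hx; have := h₁ x hx; simp; omega
        · intro x hx; have := h₂ x hx; simp at this ⊢; omega
      · refine h.kink (d := d.opp) (p := n + 1) (q := n) (r := n + 2) (by simp) (by simp) (by simp)
          ?_ ?_
        · intro x hx; have := h₁ x hx; simp; omega
        · intro x hx; have := h₂ x hx; simp at this ⊢; omega
    have := k1.join_three ha (fun x => hC) hpq rfl
    rwa [List.map_append, map_eq_self fun x hx => hlt (h₁ x hx), ← zero_add (L.map _),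
      ← List.append_nil C₁] at this

theorem localInvariance_kink_right (d : Dir) (t : Crossing) {f : List (Dir × ℕ)} {s' : List Dir}
    (hf : ∀ α ∈ f, α.2 < n)
    (h : Run (f.map Prod.fst) [⟨.max d, 1⟩, ⟨.crossing t, 0⟩, ⟨.min, 1⟩] s') :
    LocalInvariance n f [⟨.max d, 1⟩, ⟨.crossing t, 0⟩, ⟨.min, 1⟩] [] := by
  rcases f with _ | ⟨⟨x, a⟩, r⟩
  · simp at h
  · obtain ⟨h, -⟩ : d.opp = x.opp ∧ s' = d :: r.map Prod.fst := by simpa using h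
    obtain rfl : d = x := by rw [← opp_opp d, h, opp_opp]
    simp only [List.forall_mem_cons] at hf
    rcases t.eq_ofBool with rfl | ⟨o, rfl⟩
    · refine .of_merge (d := d) (a := a) hf.1 rfl rfl rfl rfl rfl rfl ?_
      simp [relabel_merge hf.2]
    · refine .of_kink (d := d) (k := n + 2) (r := r) (a := a) (o := o) (e := o) hf.1 hf.2
        (.inl ⟨rfl, rfl⟩) (.inr rfl) ?_ rfl
      simp only [trace, traceAt_one, trace_max]
      simp
      simp only [← Multiset.singleton_add]; abel

theorem localInvariance_kink_left (d : Dir) (t : Crossing) {f : List (Dir × ℕ)} {s' : List Dir}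
    (hf : ∀ α ∈ f, α.2 < n)
    (h : Run (f.map Prod.fst) [⟨.max d, 0⟩, ⟨.crossing t, 1⟩, ⟨.min, 0⟩] s') :
    LocalInvariance n f [⟨.max d, 0⟩, ⟨.crossing t, 1⟩, ⟨.min, 0⟩] [] := by
  rcases f with _ | ⟨⟨x, a⟩, r⟩
  · simp at h
  · obtain ⟨rfl, -⟩ : x = d.opp ∧ d.opp :: r.map Prod.fst = s' := by simpa using h
    simp only [List.forall_mem_cons] at hf
    rcases t.eq_ofBool with rfl | ⟨o, rfl⟩
    · refine .of_merge (d := d.opp) (a := a) hf.1 rfl ?_ rfl rfl rfl rfl ?_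
      · simp
      · simp [relabel_merge hf.2]
    · refine .of_kink (d := d.opp) (k := n + 1) (r := r) (a := a) (o := o) (e := o) hf.1 hf.2
        (.inr ⟨rfl, rfl⟩) (.inl rfl) ?_ rfl
      simp
      simp only [← Multiset.singleton_add]; abel

/-- Two strands, each with two consecutive new labels, are joined to strands from above. -/
theorem Reps.join_bigon {L : Multiset (ℕ × ℕ)} {C : List (RealCrossing ℕ)} {c : MarkovClass}
    {d d' : Dir} {a b : ℕ} (ha : a < n) (hb : b < n) (hC : ∀ x ∈ labels C, x < n ∨ n + 4 ≤ x)
    (h : Reps ({link d a n, link d' b (n + 1), link d' (n + 1) (n + 2), link d n (n + 3)} + L) C c)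
    {ρ : ℕ → ℕ}
    (hρ : ρ = merge a n ∘ merge b (n + 1) ∘ merge (n + 1) (n + 2) ∘ merge n (n + 3)) :
    Reps (L.map (Prod.map ρ ρ)) (C.map (RealCrossing.map ρ)) c := by
  have k₁ := Reps.join (d := d) (a := n) (p := n + 3) (C := C) (c := c)
    (L := {link d a n, link d' b (n + 1), link d' (n + 1) (n + 2)} + L) (by
      convert h using 1
      simp only [Multiset.insert_eq_cons, ← Multiset.singleton_add]; abel) (by omega)
    (fun h => by have := hC _ h; omega)
  set ρ₁ := merge n (n + 3)
  have r₁ {k} (hk : k < n + 3) : ρ₁ k = k := merge_of_lt hk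
  simp only [Multiset.map_add, Multiset.insert_eq_cons, Multiset.map_cons, Multiset.map_singleton,
    map_link] at k₁
  rw [r₁ (k := a) (by omega), r₁ (k := b) (by omega), r₁ (k := n) (by omega),
    r₁ (k := n + 1) (by omega), r₁ (k := n + 2) (by omega)] at k₁
  have k₂ := Reps.join (d := d') (a := n + 1) (p := n + 2)
    (L := {link d a n, link d' b (n + 1)} + L.map (Prod.map ρ₁ ρ₁)) (by
      convert k₁ using 1
      simp only [Multiset.insert_eq_cons, ← Multiset.singleton_add]; abel) (by omega) (by
      rw [labels_map, List.mem_map]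
      rintro ⟨x, hx, hx'⟩
      have := hC x hx
      simp only [ρ₁, merge] at hx'
      split_ifs at hx' <;> omega)
  set ρ₂ := merge (n + 1) (n + 2)
  have r₂ {k} (hk : k < n + 2) : ρ₂ k = k := merge_of_lt hk
  simp only [Multiset.map_add, Multiset.insert_eq_cons, Multiset.map_cons, Multiset.map_singleton,
    map_link] at k₂
  rw [r₂ (k := a) (by omega), r₂ (k := b) (by omega), r₂ (k := n) (by omega),
    r₂ (k := n + 1) (by omega)] at k₂
  have k₃ := Reps.join (d := d') (a := b) (p := n + 1)
    (L := {link d a n} + (L.map (Prod.map ρ₁ ρ₁)).map (Prod.map ρ₂ ρ₂)) (by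
      convert k₂ using 1
      simp only [← Multiset.singleton_add]; abel) (by omega) (by
      rw [labels_map, labels_map, List.map_map, List.mem_map]
      rintro ⟨x, hx, hx'⟩
      have := hC x hx
      simp only [ρ₁, ρ₂, merge, Function.comp] at hx'
      split_ifs at hx' <;> omega)
  set ρ₃ := merge b (n + 1)
  have r₃ {k} (hk : k < n + 1) : ρ₃ k = k := merge_of_lt hk
  rw [Multiset.map_add, Multiset.map_singleton, map_link, r₃ (k := a) (by omega),
    r₃ (k := n) (by omega), Multiset.singleton_add] at k₃
  have := k₃.join ha (by
    rw [labels_map, labels_map, labels_map, List.map_map, List.map_map, List.mem_map]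
    rintro ⟨x, hx, hx'⟩
    have := hC x hx
    simp only [ρ₁, ρ₂, ρ₃, merge, Function.comp] at hx'
    split_ifs at hx' <;> omega)
  rw [Multiset.map_map, Multiset.map_map, Multiset.map_map, List.map_map, List.map_map,
    List.map_map] at this
  rw [hρ]
  exact this

theorem localInvariance_bigon (t : Crossing) {f : List (Dir × ℕ)} {s' : List Dir}
    (hf : ∀ α ∈ f, α.2 < n)
    (h : Run (f.map Prod.fst) [⟨.crossing t, 0⟩, ⟨.crossing t.flip, 0⟩] s') :
    LocalInvariance n f [⟨.crossing t, 0⟩, ⟨.crossing t.flip, 0⟩] [] := by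
  rcases f with _ | ⟨⟨d, a⟩, _ | ⟨⟨d', b⟩, r⟩⟩
  · simp at h
  · simp at h
  clear h
  rcases t.eq_ofBool with rfl | ⟨o, rfl⟩
  · exact .of_eq (by simp [Crossing.flip])
  simp only [List.forall_mem_cons] at hf
  obtain ⟨ha, hb, hr⟩ := hf
  have hu : trace [⟨.crossing (.ofBool o), 0⟩, ⟨.crossing (.ofBool !o), 0⟩] n
      ((d, a) :: (d', b) :: r)
      = ⟨n + 4, (d, n + 3) :: (d', n + 2) :: r, {link d a n, link d' b (n + 1),
        link d' (n + 1) (n + 2), link d n (n + 3)},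
        [⟨o, o ^^ (d.isUp ^^ d'.isUp), n, n + 1⟩,
          ⟨!o, !(o ^^ (d.isUp ^^ d'.isUp)), n + 2, n + 3⟩]⟩ := by
    simp [Bool.xor_comm d'.isUp]
    simp only [← Multiset.singleton_add]; abel
  rw [Crossing.flip_ofBool]
  have hlt {k} (hk : k < n) :
      (merge a n ∘ merge b (n + 1) ∘ merge (n + 1) (n + 2) ∘ merge n (n + 3)) k = k := by
    simp only [Function.comp]
    rw [merge_of_lt (p := n + 3) (by omega), merge_of_lt (p := n + 2) (by omega),
      merge_of_lt (p := n + 1) (by omega), merge_of_lt hk]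
  refine ⟨merge a n ∘ merge b (n + 1) ∘ merge (n + 1) (n + 2) ∘ merge n (n + 3), fun k => hlt,
    fun j => ?_, ?_, fun L C₁ C₂ c h₁ h₂ h => ?_⟩
  · rw [hu]
    simp only [Function.comp, trace]
    rw [merge_of_gt (p := n + 3) (by omega), merge_of_gt (p := n + 2) (by omega),
      merge_of_gt (p := n + 1) (by omega), merge_of_gt (p := n) (by omega)]
    omega
  · rw [hu]
    simp only [trace, relabel_cons, relabel_eq_self fun α hα => hlt (hr α hα)]
    congr 3
    · simp only [Function.comp]
      rw [merge_self, merge_of_lt (p := n + 2) (by omega), merge_of_lt (p := n + 1) (by omega),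
        merge_self]
    · simp only [Function.comp]
      rw [merge_of_lt (p := n + 3) (by omega), merge_self, merge_self, merge_of_lt hb]
  · rw [hu] at h h₂
    have hm₁ : ∀ x ∈ labels C₁, x ∉ [n, n + 3, n + 1, n + 2] := fun x hx => by
      have := h₁ x hx; simp; omega
    have hm₂ : ∀ x ∈ labels C₂, x ∉ [n, n + 3, n + 1, n + 2] := fun x hx => by
      have := h₂ x hx; simp only at this; simp; omega
    have k := h.bigon (d := d) (d' := d') (p := n) (p' := n + 3) (q := n + 1) (q' := n + 2)
      (by simp)
      (by simp) (by simp) hm₁ hm₂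
    have := k.join_bigon ha hb (fun x hx => by
      rw [labels_append, List.mem_append] at hx
      exact hx.imp (h₁ x) (h₂ x)) rfl
    rw [List.map_append, map_eq_self fun x hx => hlt (h₁ x hx)] at this
    simpa using this

end

namespace VB

variable {m : ℕ}

/-- The third Reidemeister move for three strands in arbitrary directions. -/
theorem cl_triangle_all {ν : Equiv.Perm (Fin m)} {A A' B B' C C' : Fin m} {d₁ d₂ d₃ : Bool}
    (hA : d₁ = false ∧ ν A = A' ∨ d₁ = true ∧ ν A' = A)
    (hB : d₂ = false ∧ ν B = B' ∨ d₂ = true ∧ ν B' = B)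
    (hC : d₃ = false ∧ ν C = C' ∨ d₃ = true ∧ ν C' = C)
    (hn : [A, A', B, B', C, C'].Nodup) {a b : VB m} (ha : a ∈ avoid [A, A', B, B', C, C'])
    (hb : b ∈ avoid [A, A', B, B', C, C']) {oa ob oc : Bool}
    (ho : oa = false ∧ ob = false ∨ oa = true ∧ oc = false ∨ ob = true ∧ oc = true) :
    cl (a * (real oa (oa ^^ (d₁ ^^ d₂)) A B * real ob (ob ^^ (d₁ ^^ d₃)) A' C *
        real oc (oc ^^ (d₂ ^^ d₃)) B' C') * b * (ofPerm ν)⁻¹)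
      = cl (a * (real oc (oc ^^ (d₂ ^^ d₃)) B C * real ob (ob ^^ (d₁ ^^ d₃)) A C' *
        real oa (oa ^^ (d₁ ^^ d₂)) A' B') * b * (ofPerm ν)⁻¹) := by
  have key {p p' q q' r r' : Fin m}
      (h : ∀ x, x ∈ [p, p', q, q', r, r'] ↔ x ∈ [A, A', B, B', C, C']) :
      a ∈ avoid [p, p', q, q', r, r'] ∧ b ∈ avoid [p, p', q, q', r, r'] := by
    have : avoid [p, p', q, q', r, r'] = avoid [A, A', B, B', C, C'] := by
      unfold avoid; simp only [h]
    rw [this]; exact ⟨ha, hb⟩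
  have hn' := hn
  simp only [List.nodup_cons, List.mem_cons, List.not_mem_nil, or_false, not_or, List.nodup_nil,
    not_false_eq_true, and_true] at hn'
  obtain ⟨⟨AA', AB, AB', AC, AC'⟩, ⟨A'B, A'B', A'C, A'C'⟩, ⟨BB', BC, BC'⟩, ⟨B'C, B'C'⟩, CC'⟩ := hn'
  -- crossings of different strands commute
  have c1 (o e o' e') := (real_commute o e o' e' AB A'C AA' AC (Ne.symm A'B) BC).eq
  have c2 (o e o' e') := (real_commute o e o' e' AB B'C' AB' AC' BB' BC').eq
  have c3 (o e o' e') := (real_commute o e o' e' A'C B'C' A'B' A'C' (Ne.symm B'C) CC').eq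
  have c4 (o e o' e') := (real_commute o e o' e' BC AC' (Ne.symm AB) BC' (Ne.symm AC) CC').eq
  have c5 (o e o' e') := (real_commute o e o' e' BC A'B' (Ne.symm A'B) BB' (Ne.symm A'C)
    (Ne.symm B'C)).eq
  have c6 (o e o' e') := (real_commute o e o' e' AC' A'B' AA' AB' (Ne.symm A'C') (Ne.symm B'C')).eq
  rcases hA with ⟨rfl, hA⟩ | ⟨rfl, hA⟩ <;> rcases hB with ⟨rfl, hB⟩ | ⟨rfl, hB⟩ <;>
    rcases hC with ⟨rfl, hC⟩ | ⟨rfl, hC⟩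
  -- the strands in the order given by their crossings, if this is not cyclic
  · exact cl_triangle hA hB hC hn ha hb (by clear * - ho; revert oa ob oc; decide)
      (by cases oa <;> cases ob <;> rfl) (by cases oc <;> cases ob <;> rfl)
  · obtain ⟨ha', hb'⟩ := key (p := B) (p' := B') (q := A) (q' := A') (r := C')
      (r' := C) (by grind)
    have := cl_triangle hB hA hC (by grind) ha' hb'
      (o₁ := !oa) (e₁ := oa ^^ (false ^^ false))
      (o₂ := oc) (e₂ := oc ^^ (false ^^ true))
      (o₃ := ob) (e₃ := ob ^^ (false ^^ true))
      (by clear * - ho; revert oa ob oc; decide) (by clear * - ho; revert oa ob oc; decide)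
      (by clear * - ho; revert oa ob oc; decide)
    simp only [real_not_left] at this
    grind
  · obtain ⟨ha', hb'⟩ := key (p := A) (p' := A') (q := B') (q' := B) (r := C)
      (r' := C') (by grind)
    have := cl_triangle_cyclic hA hB hC (by grind) ha' hb'
      (o₁ := oa) (e₁ := oa ^^ (false ^^ true))
      (o₂ := ob) (e₂ := ob ^^ (false ^^ false))
      (o₃ := oc) (e₃ := oc ^^ (true ^^ false))
      (by clear * - ho; revert oa ob oc; decide) (by clear * - ho; revert oa ob oc; decide)
      (by clear * - ho; revert oa ob oc; decide)
    grind
  · obtain ⟨ha', hb'⟩ := key (p := B') (p' := B) (q := C') (q' := C) (r := A)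
      (r' := A') (by grind)
    have := cl_triangle hB hC hA (by grind) ha' hb'
      (o₁ := oc) (e₁ := oc ^^ (true ^^ true))
      (o₂ := !oa) (e₂ := oa ^^ (false ^^ true))
      (o₃ := !ob) (e₃ := ob ^^ (false ^^ true))
      (by clear * - ho; revert oa ob oc; decide) (by clear * - ho; revert oa ob oc; decide)
      (by clear * - ho; revert oa ob oc; decide)
    simp only [real_not_left] at this
    grind
  · obtain ⟨ha', hb'⟩ := key (p := A') (p' := A) (q := C) (q' := C') (r := B)
      (r' := B') (by grind)
    have := cl_triangle hA hC hB (by grind) ha' hb'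
      (o₁ := ob) (e₁ := ob ^^ (true ^^ false))
      (o₂ := oa) (e₂ := oa ^^ (true ^^ false))
      (o₃ := !oc) (e₃ := oc ^^ (false ^^ false))
      (by clear * - ho; revert oa ob oc; decide) (by clear * - ho; revert oa ob oc; decide)
      (by clear * - ho; revert oa ob oc; decide)
    simp only [real_not_left] at this
    grind
  · obtain ⟨ha', hb'⟩ := key (p := A') (p' := A) (q := B) (q' := B') (r := C')
      (r' := C) (by grind)
    have := cl_triangle_cyclic hA hB hC (by grind) ha' hb'
      (o₁ := oa) (e₁ := oa ^^ (true ^^ false))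
      (o₂ := ob) (e₂ := ob ^^ (true ^^ true))
      (o₃ := oc) (e₃ := oc ^^ (false ^^ true))
      (by clear * - ho; revert oa ob oc; decide) (by clear * - ho; revert oa ob oc; decide)
      (by clear * - ho; revert oa ob oc; decide)
    grind
  · obtain ⟨ha', hb'⟩ := key (p := C) (p' := C') (q := A') (q' := A) (r := B')
      (r' := B) (by grind)
    have := cl_triangle hC hA hB (by grind) ha' hb'
      (o₁ := !ob) (e₁ := ob ^^ (true ^^ false))
      (o₂ := !oc) (e₂ := oc ^^ (true ^^ false))
      (o₃ := oa) (e₃ := oa ^^ (true ^^ true))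
      (by clear * - ho; revert oa ob oc; decide) (by clear * - ho; revert oa ob oc; decide)
      (by clear * - ho; revert oa ob oc; decide)
    simp only [real_not_left] at this
    grind
  · obtain ⟨ha', hb'⟩ := key (p := C') (p' := C) (q := B') (q' := B) (r := A')
      (r' := A) (by grind)
    have := cl_triangle hC hB hA (by grind) ha' hb'
      (o₁ := !oc) (e₁ := oc ^^ (true ^^ true))
      (o₂ := !ob) (e₂ := ob ^^ (true ^^ true))
      (o₃ := !oa) (e₃ := oa ^^ (true ^^ true))
      (by clear * - ho; revert oa ob oc; decide) (by clear * - ho; revert oa ob oc; decide)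
      (by clear * - ho; revert oa ob oc; decide)
    simp only [real_not_left] at this
    grind

end VB

/-- The third Reidemeister move for three strands, cut into `A`, `A'`, and so on. -/
theorem Reps.triangle {L : Multiset (ℕ × ℕ)} {C₁ C₂ : List (RealCrossing ℕ)} {c : MarkovClass}
    {A A' B B' C C' : ℕ} {d₁ d₂ d₃ : Dir} {oa ob oc : Bool}
    (h : Reps L (C₁ ++ [⟨oa, oa ^^ (d₁.isUp ^^ d₂.isUp), A, B⟩,
      ⟨ob, ob ^^ (d₁.isUp ^^ d₃.isUp), A', C⟩, ⟨oc, oc ^^ (d₂.isUp ^^ d₃.isUp), B', C'⟩] ++ C₂) c)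
    (hA : link d₁ A A' ∈ L) (hB : link d₂ B B' ∈ L) (hC : link d₃ C C' ∈ L)
    (hn : [A, A', B, B', C, C'].Nodup)
    (h₁ : ∀ x ∈ labels C₁, x ∉ [A, A', B, B', C, C'])
    (h₂ : ∀ x ∈ labels C₂, x ∉ [A, A', B, B', C, C'])
    (ho : oa = false ∧ ob = false ∨ oa = true ∧ oc = false ∨ ob = true ∧ oc = true) :
    Reps L (C₁ ++ [⟨oc, oc ^^ (d₂.isUp ^^ d₃.isUp), B, C⟩,
      ⟨ob, ob ^^ (d₁.isUp ^^ d₃.isUp), A, C'⟩, ⟨oa, oa ^^ (d₁.isUp ^^ d₂.isUp), A', B'⟩] ++ C₂) c := by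
  refine h.replace [A, A', B, B', C, C'] (by simp) ?_ h₁ h₂ (by simp [labels]) ?_
  · simp only [List.mem_cons, List.not_mem_nil, or_false, forall_eq_or_imp, forall_eq]
    have hex {d p p'} (h : link d p p' ∈ L) :
        (∃ y, (p, y) ∈ L ∨ (y, p) ∈ L) ∧ ∃ y, (p', y) ∈ L ∨ (y, p') ∈ L := by
      cases d
      · exact ⟨⟨p', .inl h⟩, ⟨p, .inr h⟩⟩
      · exact ⟨⟨p', .inr h⟩, ⟨p, .inl h⟩⟩
    exact ⟨(hex hA).1, (hex hA).2, (hex hB).1, (hex hB).2, (hex hC).1, (hex hC).2⟩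
  · intro m ν k hk hν a ha b hb
    have hd (d : Dir) {x y : Fin m} (h : d = .down ∧ ν x = y ∨ d = .up ∧ ν y = x) :
        d.isUp = false ∧ ν x = y ∨ d.isUp = true ∧ ν y = x := by
      rcases h with ⟨rfl, h⟩ | ⟨rfl, h⟩
      · exact .inl ⟨rfl, h⟩
      · exact .inr ⟨rfl, h⟩
    have := cl_triangle_all (hd d₁ (map_of_link hν hA (by simp) (by simp)))
      (hd d₂ (map_of_link hν hB (by simp) (by simp)))
      (hd d₃ (map_of_link hν hC (by simp) (by simp))) (nodup_map_of_injOn hn hk) ha hb ho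
    simpa only [List.map_cons, List.map_nil, RealCrossing.map, word_cons, word_nil, mul_one,
      mul_assoc] using this

section

variable {n : ℕ}

attribute [local simp] run_cons_iff run_nil_iff step_max_iff step_min_iff step_crossing_iff
  step_one_iff trace trace_max trace_min trace_virt trace_real traceAt_zero traceAt_one Trace.left
  relabel_cons merge_self opp_opp map_link link_opp

theorem localInvariance_crossing_max (d : Dir) (t : Crossing) {f : List (Dir × ℕ)} {s' : List Dir}
    (hf : ∀ α ∈ f, α.2 < n) (h : Run (f.map Prod.fst) [⟨.max d, 0⟩, ⟨.crossing t, 1⟩] s') :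
    LocalInvariance n f [⟨.max d, 0⟩, ⟨.crossing t, 1⟩] [⟨.max d, 1⟩, ⟨.crossing t.flip, 0⟩] := by
  rcases f with _ | ⟨⟨x, b⟩, r⟩
  · simp at h
  clear h
  rcases t.eq_ofBool with rfl | ⟨o, rfl⟩
  · exact .of_eq (by simp [Crossing.flip])
  rw [Crossing.flip_ofBool]
  simp only [List.forall_mem_cons] at hf
  obtain ⟨hb, hr⟩ := hf
  have hu : trace [⟨.max d, 0⟩, ⟨.crossing (.ofBool o), 1⟩] n ((x, b) :: r)
      = ⟨n + 3, (d, n) :: (x, n + 2) :: (d.opp, n + 1) :: r,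
        {link d (n + 1) n, link x b (n + 2)}, [⟨o, o ^^ (d.opp.isUp ^^ x.isUp), n + 1, n + 2⟩]⟩ := by
    simp
  have hv : trace [⟨.max d, 1⟩, ⟨.crossing (.ofBool !o), 0⟩] n ((x, b) :: r)
      = ⟨n + 3, (d, n + 2) :: (x, n + 1) :: (d.opp, n) :: r,
        {link d n (n + 2), link x b (n + 1)},
        [⟨!o, o ^^ (d.opp.isUp ^^ x.isUp), n + 1, n + 2⟩]⟩ := by
    have : (!(o ^^ (x.isUp ^^ d.isUp))) = (o ^^ (d.opp.isUp ^^ x.isUp)) := by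
      cases o <;> cases x <;> cases d <;> rfl
    simp [this]
    exact Multiset.pair_comm _ _
  set ρ : ℕ → ℕ := fun k => if k = n then n + 2 else if k = n + 1 then n else
    if k = n + 2 then n + 1 else k with hρ
  have hlt {k} (hk : k < n) : ρ k = k := by simp only [ρ]; split_ifs <;> omega
  have r0 : ρ n = n + 2 := by simp [ρ]
  have r1 : ρ (n + 1) = n := by simp [ρ]
  have r2 : ρ (n + 2) = n + 1 := by simp [ρ]
  refine .of_rename (N := n + 3) ρ ?_ (fun _ => hlt) ?_ (by rw [hu]) (by rw [hv]) ?_ ?_ ?_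
  · intro k l h; simp only [ρ] at h; split_ifs at h <;> omega
  · intro k hk; simp only [ρ]; split_ifs <;> omega
  · rw [hu, hv]
    simp only [relabel_cons, r0, r1, r2, relabel_eq_self fun α hα => hlt (hr α hα)]
  · rw [hu, hv]
    simp [r0, r1, r2, hlt hb]
  · intro L C₁ C₂ c h₁ h₂ h
    rw [hu] at h
    rw [hv] at h ⊢
    simp only [List.map_cons, List.map_nil, RealCrossing.map, r1, r2] at h
    refine (h.slide (d := d) (q := n + 2) (by simp) ?_ (by simp) ?_ ?_).flip
    · cases x
      · exact ⟨b, .inr (by simp [link])⟩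
      · exact ⟨b, .inl (by simp [link])⟩
    · intro y hy; have := h₁ y hy; simp; omega
    · intro y hy; have := h₂ y hy; simp; omega

theorem triangle_ofBool {a b c : Crossing} (h : Triangle a b c) :
    (a = .virt ∧ b = .virt) ∨ (a = .virt ∧ c = .virt) ∨ (b = .virt ∧ c = .virt) ∨
      ∃ oa ob oc, a = .ofBool oa ∧ b = .ofBool ob ∧ c = .ofBool oc ∧
        (oa = false ∧ ob = false ∨ oa = true ∧ oc = false ∨ ob = true ∧ oc = true) := by
  cases h with
  | real₁ c hc =>
    obtain ⟨o, rfl⟩ := c.eq_ofBool.resolve_left hc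
    exact .inr (.inr (.inr ⟨false, false, o, rfl, rfl, rfl, by simp⟩))
  | real₂ b hb =>
    obtain ⟨o, rfl⟩ := b.eq_ofBool.resolve_left hb
    exact .inr (.inr (.inr ⟨true, o, false, rfl, rfl, rfl, by simp⟩))
  | real₃ a ha =>
    obtain ⟨o, rfl⟩ := a.eq_ofBool.resolve_left ha
    exact .inr (.inr (.inr ⟨o, true, true, rfl, rfl, rfl, by simp⟩))
  | virt₁ => exact .inl ⟨rfl, rfl⟩
  | virt₂ => exact .inr (.inl ⟨rfl, rfl⟩)
  | virt₃ => exact .inr (.inr (.inl ⟨rfl, rfl⟩))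

theorem localInvariance_triangle {a b c : Crossing} (ht : Triangle a b c) {f : List (Dir × ℕ)}
    {s' : List Dir} (hf : ∀ α ∈ f, α.2 < n)
    (h : Run (f.map Prod.fst) [⟨.crossing a, 0⟩, ⟨.crossing b, 1⟩, ⟨.crossing c, 0⟩] s') :
    LocalInvariance n f [⟨.crossing a, 0⟩, ⟨.crossing b, 1⟩, ⟨.crossing c, 0⟩]
      [⟨.crossing c, 1⟩, ⟨.crossing b, 0⟩, ⟨.crossing a, 1⟩] := by
  rcases f with _ | ⟨⟨d₁, x₁⟩, _ | ⟨⟨d₂, x₂⟩, _ | ⟨⟨d₃, x₃⟩, r⟩⟩⟩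
  · simp at h
  · simp at h
  · simp at h
  clear h
  rcases triangle_ofBool ht with ⟨rfl, rfl⟩ | ⟨rfl, rfl⟩ | ⟨rfl, rfl⟩ | ⟨oa, ob, oc, rfl, rfl, rfl, ho⟩
  · exact .of_eq (by rcases c.eq_ofBool with rfl | ⟨o, rfl⟩ <;> simp)
  · exact .of_eq (by rcases b.eq_ofBool with rfl | ⟨o, rfl⟩ <;> simp)
  · exact .of_eq (by rcases a.eq_ofBool with rfl | ⟨o, rfl⟩ <;> simp)
  clear ht
  simp only [List.forall_mem_cons] at hf
  obtain ⟨hx₁, hx₂, hx₃, hr⟩ := hf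
  have hu : trace [⟨.crossing (.ofBool oa), 0⟩, ⟨.crossing (.ofBool ob), 1⟩,
      ⟨.crossing (.ofBool oc), 0⟩] n ((d₁, x₁) :: (d₂, x₂) :: (d₃, x₃) :: r)
      = ⟨n + 6, (d₃, n + 5) :: (d₂, n + 4) :: (d₁, n + 2) :: r,
        {link d₁ x₁ n, link d₁ n (n + 2), link d₂ x₂ (n + 1), link d₂ (n + 1) (n + 4),
          link d₃ x₃ (n + 3), link d₃ (n + 3) (n + 5)},
        [⟨oa, oa ^^ (d₁.isUp ^^ d₂.isUp), n, n + 1⟩, ⟨ob, ob ^^ (d₁.isUp ^^ d₃.isUp), n + 2, n + 3⟩,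
          ⟨oc, oc ^^ (d₂.isUp ^^ d₃.isUp), n + 4, n + 5⟩]⟩ := by
    simp
    simp only [← Multiset.singleton_add]; abel
  have hv : trace [⟨.crossing (.ofBool oc), 1⟩, ⟨.crossing (.ofBool ob), 0⟩,
      ⟨.crossing (.ofBool oa), 1⟩] n ((d₁, x₁) :: (d₂, x₂) :: (d₃, x₃) :: r)
      = ⟨n + 6, (d₃, n + 3) :: (d₂, n + 5) :: (d₁, n + 4) :: r,
        {link d₁ x₁ (n + 2), link d₁ (n + 2) (n + 4), link d₂ x₂ n, link d₂ n (n + 5),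
          link d₃ x₃ (n + 1), link d₃ (n + 1) (n + 3)},
        [⟨oc, oc ^^ (d₂.isUp ^^ d₃.isUp), n, n + 1⟩, ⟨ob, ob ^^ (d₁.isUp ^^ d₃.isUp), n + 2, n + 3⟩,
          ⟨oa, oa ^^ (d₁.isUp ^^ d₂.isUp), n + 4, n + 5⟩]⟩ := by
    simp
    simp only [← Multiset.singleton_add]; abel
  set ρ : ℕ → ℕ := fun k => if k = n then n + 2 else if k = n + 1 then n else
    if k = n + 2 then n + 4 else if k = n + 3 then n + 1 else if k = n + 4 then n + 5 else
    if k = n + 5 then n + 3 else k with hρ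
  have hlt {k} (hk : k < n) : ρ k = k := by simp only [ρ]; split_ifs <;> omega
  have hge {k} (hk : n + 6 ≤ k) : ρ k = k := by simp only [ρ]; split_ifs <;> omega
  have r0 : ρ n = n + 2 := by simp [ρ]
  have r1 : ρ (n + 1) = n := by simp [ρ]
  have r2 : ρ (n + 2) = n + 4 := by simp [ρ]
  have r3 : ρ (n + 3) = n + 1 := by simp [ρ]
  have r4 : ρ (n + 4) = n + 5 := by simp [ρ]
  have r5 : ρ (n + 5) = n + 3 := by simp [ρ]
  refine .of_rename (N := n + 6) ρ ?_ (fun _ => hlt) ?_ (by rw [hu]) (by rw [hv]) ?_ ?_ ?_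
  · refine Function.LeftInverse.injective (g := fun k => if k = n then n + 1 else
      if k = n + 1 then n + 3 else if k = n + 2 then n else if k = n + 3 then n + 5 else
      if k = n + 4 then n + 2 else if k = n + 5 then n + 4 else k) fun k => ?_
    have : k < n ∨ k = n ∨ k = n + 1 ∨ k = n + 2 ∨ k = n + 3 ∨ k = n + 4 ∨ k = n + 5 ∨ n + 6 ≤ k := by
      omega
    rcases this with hk | rfl | rfl | rfl | rfl | rfl | rfl | hk
    · rw [hlt hk]; dsimp only; split_ifs <;> omega
    · simp [r0]
    · simp [r1]
    · simp [r2]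
    · simp [r3]
    · simp [r4]
    · simp [r5]
    · rw [hge hk]; dsimp only; split_ifs <;> omega
  · exact fun k => hge
  · rw [hu, hv]
    simp only [relabel_cons, r2, r4, r5, relabel_eq_self fun α hα => hlt (hr α hα)]
  · rw [hu, hv]
    simp [r0, r1, r2, r3, r4, r5, hlt hx₁, hlt hx₂, hlt hx₃]
  · intro L C₁ C₂ c h₁ h₂ h
    rw [hu] at h
    rw [hv] at h ⊢
    simp only [List.map_cons, List.map_nil, RealCrossing.map, r0, r1, r2, r3, r4, r5] at h
    refine h.triangle (by simp) (by simp) (by simp) (by simp) ?_ ?_ ho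
    · intro y hy; have := h₁ y hy; simp; omega
    · intro y hy; have := h₂ y hy; simp; omega

theorem length_eq_of_step {p : Piece} {s t : List Dir} (h : Slice.Step s ⟨p, 0⟩ t) :
    ∃ S T r, s = S ++ r ∧ t = T ++ r ∧ S.length = p.top ∧ T.length = p.bot ∧
      Slice.Step S ⟨p, 0⟩ T := by
  cases p with
  | crossing c =>
    obtain ⟨a, b, r, rfl, rfl⟩ := step_crossing_iff.1 h
    exact ⟨[a, b], [b, a], r, rfl, rfl, rfl, rfl, step_crossing_iff.2 ⟨a, b, [], rfl, rfl⟩⟩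
  | max d =>
    obtain rfl := step_max_iff.1 h
    exact ⟨[], [d, d.opp], s, rfl, rfl, rfl, rfl, step_max_iff.2 rfl⟩
  | min =>
    obtain ⟨d, rfl⟩ := step_min_iff.1 h
    exact ⟨[d, d.opp], [], t, rfl, rfl, rfl, rfl, step_min_iff.2 ⟨d, rfl⟩⟩

theorem trace_append_right (p : Piece) (n : ℕ) {P : List (Dir × ℕ)} (hP : P.length = p.top)
    (r : List (Dir × ℕ)) : p.trace n (P ++ r) = { p.trace n P with ends := (p.trace n P).ends ++ r } := by
  cases p with
  | crossing c =>
    obtain ⟨⟨d, a⟩, ⟨d', b⟩, rfl⟩ := List.length_eq_two.1 hP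
    rcases c.eq_ofBool with rfl | ⟨o, rfl⟩ <;> simp
  | max d =>
    obtain rfl := List.length_eq_zero_iff.1 hP
    simp
  | min =>
    obtain ⟨⟨d, a⟩, ⟨d', b⟩, rfl⟩ := List.length_eq_two.1 hP
    simp

theorem piece_crossings (p : Piece) (n : ℕ) (f : List (Dir × ℕ)) : (p.trace n f).crossings = [] ∨
    ∃ o e, (p.trace n f).n = n + 2 ∧ (p.trace n f).crossings = [⟨o, e, n, n + 1⟩] ∧
      (∃ y, (n, y) ∈ (p.trace n f).links ∨ (y, n) ∈ (p.trace n f).links) ∧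
      ∃ y, (n + 1, y) ∈ (p.trace n f).links ∨ (y, n + 1) ∈ (p.trace n f).links := by
  cases p with
  | max d => exact .inl rfl
  | min => match f with
    | [] => exact .inl rfl
    | [_] => exact .inl rfl
    | _ :: _ :: _ => exact .inl rfl
  | crossing t =>
    rcases t.eq_ofBool with rfl | ⟨o, rfl⟩
    · match f with
      | [] => exact .inl rfl
      | [_] => exact .inl rfl
      | _ :: _ :: _ => exact .inl rfl
    · match f with
      | [] => cases o <;> exact .inl rfl
      | [_] => cases o <;> exact .inl rfl
      | (d, a) :: (d', b) :: f =>
        refine .inr ⟨o, _, by rw [trace_real], by rw [trace_real], ?_, ?_⟩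
        · refine ⟨a, ?_⟩
          rw [trace_real]
          cases d <;> simp [link]
        · refine ⟨b, ?_⟩
          rw [trace_real]
          cases d' <;> simp [link]

/-- Pieces side by side create their labels in a different order after the move, and their crossings
are listed in a different order; the former is a renaming, and the latter exchanges crossings on
disjoint sets of strands. -/
theorem localInvariance_heights (p q : Piece) (k : ℕ) {f : List (Dir × ℕ)} {s' : List Dir}
    (hf : ∀ α ∈ f, α.2 < n)
    (h : Run (f.map Prod.fst) [⟨p, 0⟩, ⟨q, 0 + p.bot + k⟩] s') :
    LocalInvariance n f [⟨p, 0⟩, ⟨q, 0 + p.bot + k⟩] [⟨q, 0 + p.top + k⟩, ⟨p, 0⟩] := by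
  rw [Nat.zero_add, Nat.zero_add] at *
  simp only [run_cons_iff, run_nil_iff] at h
  obtain ⟨t, ht, t', ht', rfl⟩ := h
  obtain ⟨S, T, r, hs, rfl, hS, hT, hst⟩ := length_eq_of_step ht
  obtain ⟨P, g, rfl, rfl, rfl⟩ := List.map_eq_append_iff.1 hs
  rw [← hT] at ht'
  obtain ⟨r', hr', -⟩ := step_right_iff.1 ht'
  obtain ⟨K, G, rfl, rfl⟩ : ∃ K G, g = K ++ G ∧ K.length = k :=
    ⟨g.take k, g.drop k, (List.take_append_drop k g).symm, by
      have := step_le hr'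
      simp at this ⊢; omega⟩
  rw [List.map_append, show K.length = (K.map Prod.fst).length + 0 by simp] at hr'
  obtain ⟨r'', hr'', -⟩ := step_right_iff.1 hr'
  rw [List.length_map] at hS
  have hP : ∀ α ∈ P, α.2 < n := fun α hα => hf α (by simp [hα])
  have hK : ∀ α ∈ K, α.2 < n := fun α hα => hf α (by simp [hα])
  have hG : ∀ α ∈ G, α.2 < n := fun α hα => hf α (by simp [hα])
  -- the two pieces, each of them at the top
  obtain ⟨hp, hp'⟩ := hst.counts rfl n
  obtain ⟨-, hq'⟩ := hr''.counts rfl n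
  simp only [traceAt_zero] at hp hp' hq'
  have np := (traceAt_crossings p 0 n P).1
  have nq := (traceAt_crossings q 0 n G).1
  obtain ⟨bp, bp'⟩ := hp'.lt hP np
  obtain ⟨bq, bq'⟩ := hq'.lt hG nq
  have cp := (traceAt_crossings p 0 n P).2
  have cq := (traceAt_crossings q 0 n G).2
  simp only [traceAt_zero] at np nq cp cq
  have lp : (p.trace n P).ends.length = p.bot := by
    rw [← hT, ← hp, List.length_map]
  have sP := piece_crossings p (q.trace n G).n P
  have sQ := piece_crossings q n G
  have eu : trace [⟨p, 0⟩, ⟨q, p.bot + K.length⟩] n (P ++ (K ++ G))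
      = ⟨(q.trace (p.trace n P).n G).n, (p.trace n P).ends ++ K ++ (q.trace (p.trace n P).n G).ends,
        (p.trace n P).links + (q.trace (p.trace n P).n G).links,
        (p.trace n P).crossings ++ (q.trace (p.trace n P).n G).crossings⟩ := by
    simp only [trace, traceAt_zero, trace_append_right p n hS]
    have := traceAt_append q ((p.trace n P).ends ++ K) 0 (p.trace n P).n G
    rw [List.length_append, lp, List.append_assoc, Nat.add_zero] at this
    rw [this]
    simp
  have ev : trace [⟨q, p.top + K.length⟩, ⟨p, 0⟩] n (P ++ (K ++ G))
      = ⟨(p.trace (q.trace n G).n P).n, (p.trace (q.trace n G).n P).ends ++ K ++ (q.trace n G).ends,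
        (q.trace n G).links + (p.trace (q.trace n G).n P).links,
        (q.trace n G).crossings ++ (p.trace (q.trace n G).n P).crossings⟩ := by
    have := traceAt_append q (P ++ K) 0 n G
    rw [List.length_append, hS, List.append_assoc, Nat.add_zero] at this
    simp only [trace, this, traceAt_zero, Trace.left]
    rw [List.append_assoc, trace_append_right p _ hS]
    simp
  generalize htp : p.trace n P = tp at *
  generalize htq : q.trace n G = tq at *
  generalize htp' : p.trace tq.n P = tp' at *
  generalize htq' : q.trace tp.n G = tq' at *
  -- the lower piece, with the labels shifted
  set A : ℕ → ℕ := fun k => if k < n then k else k + (tq.n - n) with hA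
  set B : ℕ → ℕ := fun k => if k < n then k else k + (tp.n - n) with hB
  have A0 {k} (h : k < n) : A k = k := by simp only [A]; split_ifs; rfl
  have B0 {k} (h : k < n) : B k = k := by simp only [B]; split_ifs; rfl
  obtain ⟨a1, a2, a3, a4⟩ := subst_piece p (ρ := A) (n := n) (n' := tq.n)
    (fun j => by simp only [A]; split_ifs <;> omega) P
  rw [relabel_eq_self fun α hα => A0 (hP α hα), htp, htp'] at a1 a2 a3 a4
  obtain ⟨b1, b2, b3, b4⟩ := subst_piece q (ρ := B) (n := n) (n' := tp.n)
    (fun j => by simp only [B]; split_ifs <;> omega) G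
  rw [relabel_eq_self fun α hα => B0 (hG α hα), htq, htq'] at b1 b2 b3 b4
  have hN : tp'.n = tp.n + tq.n - n := by
    have := a1 0
    simp only [A] at this
    split_ifs at this <;> omega
  have hN' : tq'.n = tp.n + tq.n - n := by
    have := b1 0
    simp only [B] at this
    split_ifs at this <;> omega
  set ρ : ℕ → ℕ := fun k => if k < n then k else if k < tp.n then k + (tq.n - n) else
    if k < tp.n + tq.n - n then k - (tp.n - n) else k with hρ
  have hlt {k} (hk : k < n) : ρ k = k := by simp only [ρ]; split_ifs; rfl
  have hρA {k} (hk : k < tp.n) : ρ k = A k := by simp only [ρ, A]; split_ifs <;> omega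
  have hρB {k} (hk : k < tq.n) : ρ (B k) = k := by simp only [ρ, B]; split_ifs <;> omega
  refine .of_rename (N := tp.n + tq.n - n) ρ ?_ (fun _ => hlt) ?_ (by rw [eu, hN'])
    (by rw [ev, hN]) ?_ ?_ ?_
  · intro k l h; simp only [ρ] at h; split_ifs at h <;> omega
  · intro k hk; simp only [ρ]; split_ifs <;> omega
  · rw [eu, ev]
    simp only [relabel_append, a2, b2]
    rw [relabel_eq_self fun α hα => hlt (hK α hα)]
    congr 2
    · exact List.map_congr_left fun α hα => Prod.ext rfl (hρA (bp α hα)).symm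
    · rw [relabel, relabel, List.map_map]
      refine ((List.map_congr_left fun α hα => ?_).trans (List.map_id _)).symm
      exact Prod.ext rfl (hρB (bq α hα))
  · rw [eu, ev]
    simp only [Multiset.map_add, a3, b3, Multiset.map_map]
    rw [add_comm]
    congr 1
    · exact Multiset.map_congr rfl fun y hy => Prod.ext (hρA (bp' y hy).1).symm (hρA (bp' y hy).2).symm
    · refine ((Multiset.map_congr rfl fun y hy => ?_).trans (Multiset.map_id _)).symm
      exact Prod.ext (hρB (bq' y hy).1) (hρB (bq' y hy).2)
  · intro L C₁ C₂ c h₁ h₂ h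
    rw [eu] at h
    rw [ev] at h ⊢
    have e1 : tp.crossings.map (RealCrossing.map ρ) = tp'.crossings := by
      rw [a4]
      exact map_eq_of_labels fun x hx => hρA (cp x hx).2
    have e2 : tq'.crossings.map (RealCrossing.map ρ) = tq.crossings := by
      rw [b4, List.map_map]
      exact map_eq_self (f := ρ ∘ B) fun x hx => hρB (cq x hx).2
    simp only [List.map_append, e1, e2] at h
    -- the crossings are interchanged, if there are two
    rcases sP with sP | ⟨o, e, sP1, sP2, sP3, sP4⟩
    · simpa [sP] using h
    rcases sQ with sQ | ⟨o', e', sQ1, sQ2, sQ3, sQ4⟩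
    · simpa [sQ] using h
    rw [sP2, sQ2] at h ⊢
    have hex {L₁ L₂ : Multiset (ℕ × ℕ)} {x : ℕ} (hL : L₁ ≤ L₂)
        (h : ∃ y, (x, y) ∈ L₁ ∨ (y, x) ∈ L₁) : ∃ y, (x, y) ∈ L₂ ∨ (y, x) ∈ L₂ :=
      h.imp fun _ h => h.imp (Multiset.mem_of_le hL) (Multiset.mem_of_le hL)
    have l1 : tq.links ≤ tq.links + tp'.links + L := by
      rw [add_assoc]; exact Multiset.le_add_right _ _
    have l2 : tp'.links ≤ tq.links + tp'.links + L := by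
      rw [add_comm tq.links, add_assoc]; exact Multiset.le_add_right _ _
    refine Reps.swap h ?_ ?_ ?_ ?_
    · simp only [List.mem_cons, List.not_mem_nil, or_false, forall_eq_or_imp, forall_eq]
      exact ⟨hex l2 sP3, hex l2 sP4, hex l1 sQ3, hex l1 sQ4⟩
    · simp; omega
    · intro y hy; have := h₁ y hy; simp; omega
    · intro y hy; have := h₂ y hy; simp; omega

end

/-- The Markov class of a diagram does not change under the moves. -/
theorem LinkDiagram.HasClass.move {K K' : LinkDiagram} {c : MarkovClass} (hK : K.HasClass c)
    (h : K.Move K') : K'.HasClass c := by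
  obtain ⟨x, u, v, y, s, s', h, hx, hu, -, -, e, e'⟩ := h
  refine hK.replace hx e e' fun n f hf hlt => ?_
  subst hf
  have hlen (p : Piece) (i : ℕ) (w : List Slice) (h : Run (f.map Prod.fst) (⟨p, i⟩ :: w) s') :
      i ≤ f.length := by
    obtain ⟨t, ht, -⟩ := run_cons_iff.1 h
    have := step_le ht
    simp at this; omega
  rcases h with h | h
  · cases h with
    | heights p q i k =>
      have e (j) : i + j + k = i + (0 + j + k) := by omega
      rw [e] at hu ⊢
      rw [e]
      exact .of_right (u := [⟨p, 0⟩, ⟨q, 0 + p.bot + k⟩]) (v := [⟨q, 0 + p.top + k⟩, ⟨p, 0⟩])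
        (hlen _ _ _ hu) hlt hu fun _ _ hf' hr => localInvariance_heights p q k hf' hr
    | zigzag_left i d =>
      have := hlen _ _ _ hu
      exact .of_right (u := [⟨.max d, 1⟩, ⟨.min, 0⟩]) (v := [])
        (by omega) hlt hu fun _ _ hf' hr => localInvariance_zigzag_left d hf' hr
    | zigzag_right i d =>
      exact .of_right (u := [⟨.max d, 0⟩, ⟨.min, 1⟩]) (v := []) (hlen _ _ _ hu) hlt hu
        fun _ _ hf' hr => localInvariance_zigzag_right d hf' hr
    | crossing_min i t =>
      exact .of_right (u := [⟨.crossing t, 0⟩, ⟨.min, 1⟩]) (v := [⟨.crossing t.flip, 1⟩, ⟨.min, 0⟩])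
        (hlen _ _ _ hu) hlt hu fun _ _ hf' hr => localInvariance_crossing_min t hf' hr
    | crossing_max i d t =>
      exact .of_right (u := [⟨.max d, 0⟩, ⟨.crossing t, 1⟩])
        (v := [⟨.max d, 1⟩, ⟨.crossing t.flip, 0⟩])
        (hlen _ _ _ hu) hlt hu fun _ _ hf' hr => localInvariance_crossing_max d t hf' hr
  · cases h with
    | kink_right i d t =>
      have := hlen _ _ _ hu
      exact .of_right (u := [⟨.max d, 1⟩, ⟨.crossing t, 0⟩, ⟨.min, 1⟩]) (v := [])
        (by omega) hlt hu fun _ _ hf' hr => localInvariance_kink_right d t hf' hr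
    | kink_left i d t =>
      exact .of_right (u := [⟨.max d, 0⟩, ⟨.crossing t, 1⟩, ⟨.min, 0⟩]) (v := [])
        (hlen _ _ _ hu) hlt hu fun _ _ hf' hr => localInvariance_kink_left d t hf' hr
    | bigon i t =>
      exact .of_right (u := [⟨.crossing t, 0⟩, ⟨.crossing t.flip, 0⟩]) (v := [])
        (hlen _ _ _ hu) hlt hu fun _ _ hf' hr => localInvariance_bigon t hf' hr
    | triangle i a b c ht =>
      exact .of_right (u := [⟨.crossing a, 0⟩, ⟨.crossing b, 1⟩, ⟨.crossing c, 0⟩])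
        (v := [⟨.crossing c, 1⟩, ⟨.crossing b, 0⟩, ⟨.crossing a, 1⟩])
        (hlen _ _ _ hu) hlt hu fun _ _ hf' hr => localInvariance_triangle ht hf' hr

/-- The Markov class is an invariant of virtual links. -/
theorem LinkDiagram.hasClass_congr {K K' : LinkDiagram} (h : K.link = K'.link)
    (c : MarkovClass) : K.HasClass c ↔ K'.HasClass c := by
  have h' : Relation.EqvGen LinkDiagram.Move K K' := Quotient.exact h
  clear h
  induction h' generalizing c with
  | rel K K' h =>
    refine ⟨fun hc => hc.move h, fun hc => ?_⟩
    obtain ⟨c', hc'⟩ := K.exists_hasClass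
    rwa [(hc'.move h).unique hc] at hc'
  | refl => exact Iff.rfl
  | symm _ _ _ ih => exact (ih c).symm
  | trans _ _ _ _ _ ih ih' => exact (ih c).trans (ih' c)

/-! ### The Markov class of a closure -/

theorem trace_maxima (m : ℕ) : trace (BraidDiagram.maxima m) 0 [] =
    ⟨m, (List.range m).map (fun k => (Dir.down, k)) ++
      ((List.range m).map fun k => (Dir.up, k)).reverse, 0, []⟩ := by
  induction m with
  | zero => rfl
  | succ m ih =>
    rw [BraidDiagram.maxima, List.range_succ, List.map_append, ← BraidDiagram.maxima, trace_append,
      ih]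
    have := traceAt_append (.max .down) ((List.range m).map fun k => (Dir.down, k)) 0 m
      ((List.range m).map fun k => (Dir.up, k)).reverse
    rw [List.length_map, List.length_range, Nat.add_zero] at this
    simp [trace, this, Trace.left, Piece.traceAt, Piece.trace, Dir.opp]

theorem trace_minima (m n : ℕ) (a b : ℕ → ℕ) :
    trace (BraidDiagram.minima m) n ((List.range m).map (fun k => (Dir.down, a k)) ++
      ((List.range m).map fun k => (Dir.up, b k)).reverse)
      = ⟨n, [], (Multiset.range m).map fun k => (a k, b k), []⟩ := by
  induction m with
  | zero => rfl
  | succ m ih =>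
    have e : BraidDiagram.minima (m + 1) = ⟨.min, m⟩ :: BraidDiagram.minima m := by
      simp [BraidDiagram.minima, List.range_succ]
    have := traceAt_append .min ((List.range m).map fun k => (Dir.down, a k)) 0 n
      ((Dir.down, a m) :: (Dir.up, b m) :: ((List.range m).map fun k => (Dir.up, b k)).reverse)
    rw [List.length_map, List.length_range, Nat.add_zero] at this
    rw [e, List.range_succ]
    simp only [trace, List.map_append, List.map_cons, List.map_nil, List.reverse_append,
      List.reverse_cons, List.reverse_nil, List.nil_append, List.append_assoc, List.cons_append,
      this]
    simp only [Trace.left, Piece.traceAt, Piece.trace, ih]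
    simp [link, Multiset.range_succ]

theorem map_range_eq {α : Type*} {m i : ℕ} (h : i + 1 < m) (F : ℕ → α) :
    ∃ l r, l.length = i ∧ (List.range m).map F = l ++ F i :: F (i + 1) :: r ∧
      (List.range m).map (F ∘ Equiv.swap i (i + 1)) = l ++ F (i + 1) :: F i :: r := by
  obtain ⟨k, rfl⟩ : ∃ k, m = i + (k + 1 + 1) := ⟨m - (i + 2), by omega⟩
  refine ⟨(List.range i).map F, (List.range k).map fun j => F (i + (j + 1 + 1)), by simp, ?_, ?_⟩
  · rw [List.range_add, List.range_succ_eq_map, List.range_succ_eq_map]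
    simp [Function.comp_def]
  · rw [List.range_add, List.range_succ_eq_map, List.range_succ_eq_map]
    simp only [List.map_append, List.map_cons, List.map_map, Nat.add_zero, Function.comp_apply,
      Equiv.swap_apply_left, Equiv.swap_apply_right]
    congr 1
    · refine List.map_congr_left fun j hj => ?_
      rw [List.mem_range] at hj
      rw [Function.comp_apply, Equiv.swap_apply_of_ne_of_ne (by omega) (by omega)]
    · congr 2
      refine List.map_congr_left fun j hj => ?_
      simp only [Function.comp_apply]
      rw [Equiv.swap_apply_of_ne_of_ne (by omega) (by omega)]

theorem relabel_ups {ρ : ℕ → ℕ} {m : ℕ} (h : ∀ k < m, ρ k = k) :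
    relabel ρ ((List.range m).map fun k => (Dir.up, k)).reverse
      = ((List.range m).map fun k => (Dir.up, k)).reverse :=
  relabel_eq_self fun α hα => by
    simp only [List.mem_reverse, List.mem_map, List.mem_range] at hα
    obtain ⟨k, hk, rfl⟩ := hα
    exact h k hk

/-- The class of a closure, when the crossings `D` have been read off already and the strands of
the remaining braid diagram are permuted by `g` accordingly. -/
theorem class_eq_of_closing {m : ℕ} (w : BraidDiagram m) (g : Equiv.Perm (Fin m)) (a : ℕ → ℕ)
    (ha : ∀ k : Fin m, a k = g k) (D : List (RealCrossing (Fin m))) (c : MarkovClass)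
    (h : Reps (trace (BraidDiagram.slices w ++ BraidDiagram.minima m) m
        ((List.range m).map (fun k => (Dir.down, a k)) ++
          ((List.range m).map fun k => (Dir.up, k)).reverse)).links
      (D.map (RealCrossing.map Fin.val) ++ (trace (BraidDiagram.slices w ++ BraidDiagram.minima m) m
        ((List.range m).map (fun k => (Dir.down, a k)) ++
          ((List.range m).map fun k => (Dir.up, k)).reverse)).crossings) c) :
    c = cl (word D * ofPerm g * VB.mk w) := by
  induction w using FreeMonoid.inductionOn' generalizing g a D with
  | one =>
    have e : (1 : BraidDiagram m).slices = [] := rfl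
    rw [e, List.nil_append, trace_minima m m a fun k => k] at h
    refine h.unique ⟨m, Fin.val, g⁻¹, D, Fin.val_injective, ?_, by simp, ?_⟩
    · simp only
      have : Multiset.range m = Finset.univ.val.map (Fin.val : Fin m → ℕ) := by
        rw [Fin.univ_val_map]
        simp [Multiset.range]
        rw [← List.map_coe_finRange_eq_range, List.ofFn_eq_map]
      rw [this, Multiset.map_map]
      conv_rhs => rw [← Multiset.map_univ_val_equiv g, Multiset.map_map]
      exact Multiset.map_congr rfl fun k _ => by simp [ha]
    · rw [map_one, mul_one, map_inv, inv_inv]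
  | of_mul l w ih =>
    have hD : ∀ x ∈ labels (D.map (RealCrossing.map Fin.val)), x < m := by
      intro x hx
      rw [labels_map, List.mem_map] at hx
      obtain ⟨y, -, rfl⟩ := hx
      exact y.2
    have key (i : ℕ) (hi : i + 1 < m) (t : Crossing)
        (hl : BraidDiagram.slices (FreeMonoid.of l) = [⟨.crossing t, i⟩]) :
        ∃ L R, L.length = i ∧ (List.range m).map (fun k => (Dir.down, a k))
          = L ++ (Dir.down, a i) :: (Dir.down, a (i + 1)) :: R ∧
        (List.range m).map (fun k => (Dir.down, (a ∘ Equiv.swap i (i + 1)) k))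
          = L ++ (Dir.down, a (i + 1)) :: (Dir.down, a i) :: R ∧
        (∀ n f f', trace (BraidDiagram.slices (FreeMonoid.of l * w) ++ BraidDiagram.minima m) n (L ++ f ++ f') =
          trace (⟨.crossing t, L.length + 0⟩ :: (BraidDiagram.slices w ++ BraidDiagram.minima m)) n (L ++ (f ++ f'))) ∧
        (∀ k : Fin m, (a ∘ Equiv.swap i (i + 1)) k = (g * adjSwap i hi) k) := by
      obtain ⟨L, R, h1, h2, h3⟩ := map_range_eq hi fun k => (Dir.down, a k)
      refine ⟨L, R, h1, h2, h3, fun n f f' => ?_, fun k => ?_⟩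
      · rw [BraidDiagram.slices_mul, hl, h1, List.append_assoc, List.append_assoc]; rfl
      · rw [Equiv.Perm.mul_apply, ← ha, adjSwap_val]
        simp [Equiv.swap_apply_def]
    have hσ (i : ℕ) (hi : i + 1 < m) (o : Bool)
        (hl : BraidDiagram.slices (FreeMonoid.of l) = [⟨.crossing (.ofBool o), i⟩])
        (hm : VB.mk (FreeMonoid.of l) = real o o ⟨i, by omega⟩ ⟨i + 1, hi⟩ * τ i hi) :
        c = cl (word D * ofPerm g * VB.mk (FreeMonoid.of l * w)) := by
      obtain ⟨L, R, h1, h2, h3, h4, h5⟩ := key i hi _ hl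
      have hL : ∀ α ∈ L ++ R, α.2 < m := by
        intro α hα
        have : α ∈ (List.range m).map fun k => (Dir.down, a k) := by
          rw [h2]; simp at hα ⊢; tauto
        obtain ⟨k, hk, rfl⟩ := List.mem_map.1 this
        rw [List.mem_range] at hk
        simp only [ha ⟨k, hk⟩]
        exact (g ⟨k, hk⟩).2
      have i1 : a i < m := by rw [ha ⟨i, by omega⟩]; exact (g _).2
      have i2 : a (i + 1) < m := by rw [ha ⟨i + 1, hi⟩]; exact (g _).2
      rw [h2, h4] at h
      simp only [trace, traceAt_append, Piece.traceAt, List.cons_append, trace_real, Trace.left] at h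
      set U := ((List.range m).map fun k => (Dir.up, k)).reverse with hU
      set T := trace (BraidDiagram.slices w ++ BraidDiagram.minima m) (m + 2)
        (L ++ (Dir.down, m + 1) :: (Dir.down, m) :: (R ++ U)) with hT
      have hTl := (trace_crossings (BraidDiagram.slices w ++ BraidDiagram.minima m) (m + 2)
        (L ++ (Dir.down, m + 1) :: (Dir.down, m) :: (R ++ U))).2
      rw [← hT] at hTl
      -- the new labels are united with the old ones above them
      have hr1 : Reps ((a i, m) ::ₘ ((a (i + 1), m + 1) ::ₘ T.links))
          (D.map (RealCrossing.map Fin.val) ++ (⟨o, o, m, m + 1⟩ :: T.crossings)) c := by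
        simpa [link, Dir.isUp] using h
      have hr2 := hr1.contract (ρ := merge (a i) m) (by omega)
        (notMem_labels_of_lt hD le_rfl) (by
          simp only [labels_cons, List.mem_cons, not_or]
          exact ⟨by omega, by omega, fun hx => by have := hTl _ hx; omega⟩)
        (by rw [merge_self, merge_of_lt i1]) (fun x y => merge_eq i1)
      rw [List.map_append, List.map_cons, Multiset.map_cons] at hr2
      have hDr {j} : (D.map (RealCrossing.map Fin.val)).map (RealCrossing.map (merge j m))
          = D.map (RealCrossing.map Fin.val) := map_eq_self fun x hx => merge_of_lt (hD x hx)
      have e1 : merge (a i) m (m + 1) = m := by simp [merge_of_gt]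
      simp only [Prod.map, RealCrossing.map, merge_self, merge_of_lt i2, e1] at hr2
      rw [hDr] at hr2
      have hai : a (i + 1) ≠ a i := by
        rw [ha ⟨i, by omega⟩, ha ⟨i + 1, hi⟩]
        intro h
        have := g.injective (Fin.ext h)
        simp at this
      have hr3 := hr2.contract (ρ := merge (a (i + 1)) m) (by omega)
        (notMem_labels_of_lt hD le_rfl) (by
          simp only [labels_cons, labels_map, List.mem_cons, List.mem_map, not_or]
          refine ⟨hai, by omega, ?_⟩
          rintro ⟨y, hy, hy'⟩
          rw [merge_of_gt (by have := hTl _ hy; omega)] at hy'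
          have := hTl _ hy; omega)
        (by rw [merge_self, merge_of_lt i2]) (fun x y => merge_eq i2)
      rw [List.map_append, List.map_cons, hDr] at hr3
      simp only [RealCrossing.map, merge_self, merge_of_lt i1] at hr3
      -- the rest of the diagram, with the labels shifted
      obtain ⟨-, -, t3, t4⟩ := subst_trace (BraidDiagram.slices w ++ BraidDiagram.minima m)
        (ρ := merge (a (i + 1)) m ∘ merge (a i) m) (n := m + 2) (n' := m)
        (fun j => by
          rw [Function.comp_apply, merge_of_gt (k := m + 2 + j) (by omega),
            merge_of_gt (by omega)]
          omega)
        (L ++ (Dir.down, m + 1) :: (Dir.down, m) :: (R ++ U))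
      have hrel : relabel (merge (a (i + 1)) m ∘ merge (a i) m)
          (L ++ (Dir.down, m + 1) :: (Dir.down, m) :: (R ++ U))
          = (List.range m).map (fun k => (Dir.down, (a ∘ Equiv.swap i (i + 1)) k)) ++ U := by
        have hlt {k} (hk : k < m) : (merge (a (i + 1)) m ∘ merge (a i) m) k = k := by
          rw [Function.comp_apply, merge_of_lt hk, merge_of_lt hk]
        rw [h3, relabel_append, relabel_eq_self (f := L) fun α hα => hlt (hL α (by simp [hα])),
          List.append_assoc]
        congr 1
        have : relabel (merge (a (i + 1)) m ∘ merge (a i) m) (R ++ U) = R ++ U := by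
          rw [relabel_append, relabel_eq_self fun α hα => hlt (hL α (by simp [hα])), hU,
            relabel_ups fun k hk => hlt hk]
        simp only [relabel, List.map_cons] at this ⊢
        rw [this]
        simp [e1, merge_self, merge_of_lt i1]
      rw [hrel, ← hT] at t3 t4
      have := ih (g * adjSwap i hi) _ h5 (D ++ [⟨o, o, g ⟨i, by omega⟩, g ⟨i + 1, hi⟩⟩]) ?_
      · rw [this, map_mul, map_mul, hm, word_append, word_cons, word_nil, mul_one,
          ← ofPerm_conj_real, ofPerm_adjSwap]
        congr 1
        group
      · rw [t3, t4]
        rw [Multiset.map_map, List.map_map] at hr3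
        simp only [List.map_append, List.map_cons, List.map_nil, RealCrossing.map, ← ha,
          List.append_assoc, List.singleton_append]
        exact hr3
    cases l with
    | τ i hi =>
      obtain ⟨L, R, h1, h2, h3, h4, h5⟩ := key i hi .virt rfl
      rw [h2, h4] at h
      rw [map_mul]
      have := ih (g * adjSwap i hi) _ h5 D ?_
      · rw [this, map_mul, ofPerm_adjSwap]
        simp only [mul_assoc]
        rfl
      · rw [h3]
        simp only [trace, traceAt_append, List.cons_append] at h
        simpa [Piece.traceAt, Piece.trace, Trace.left] using h
    | σ i hi =>
      refine hσ i hi true rfl ?_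
      have := σ_eq_x i hi
      rw [show Equiv.swap _ _ = adjSwap i hi from rfl, ofPerm_adjSwap] at this
      exact this
    | σinv i hi =>
      refine hσ i hi false rfl ?_
      have := σ_inv_eq_x i hi
      rw [show Equiv.swap _ _ = adjSwap i hi from rfl, ofPerm_adjSwap, ← mk_σinv] at this
      exact this

/-- A braid belongs to the Markov class of its own closure. -/
theorem hasClass_closure {m : ℕ} (b : BraidDiagram m) : b.closure.HasClass (cl (VB.mk b)) := by
  obtain ⟨c, hc⟩ := b.closure.exists_hasClass
  have h := hc
  simp only [LinkDiagram.HasClass, BraidDiagram.closure, List.append_assoc] at h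
  rw [trace_append, trace_maxima] at h
  have := class_eq_of_closing b 1 (fun k => k) (fun _ => rfl) [] c (by simpa using h)
  rw [word_nil, map_one, mul_one, one_mul] at this
  exact this ▸ hc

/-- Braids with equivalent closures have the same Markov class, that of the common closure. -/
theorem eqvGen_of_closure_eq {m n : ℕ} {b : VB m} {b' : VB n} (h : b.closure = b'.closure) :
    Relation.EqvGen BraidMove ⟨m, b⟩ ⟨n, b'⟩ := by
  obtain ⟨w, rfl⟩ := VB.mk_surjective b
  obtain ⟨w', rfl⟩ := VB.mk_surjective b'
  rw [VB.closure_mk, VB.closure_mk] at h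
  have := ((LinkDiagram.hasClass_congr h _).1 (hasClass_closure w)).unique (hasClass_closure w')
  exact Quot.eqvGen_exact this

end VirtualKnot

namespace VirtualKnot

/-! ### Equivalence of tangles -/

/-- The diagrams `a` and `b` of tangles, with strands of directions `s` on the top line and `s'` on
the bottom line, differ by one local move. -/
def TangleMove (s s' : List Dir) (a b : List Slice) : Prop :=
  ∃ (x u v y : List Slice) (t t' : List Dir), (IsotopyMove u v ∨ ReidemeisterMove u v) ∧
    Run s x t ∧ Run t u t' ∧ Run t v t' ∧ Run t' y s' ∧ a = x ++ u ++ y ∧ b = x ++ v ++ y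

/-- Equivalence of tangles: finite sequences of local moves. -/
def TangleEquiv (s s' : List Dir) : List Slice → List Slice → Prop :=
  Relation.EqvGen (TangleMove s s')

namespace TangleEquiv

variable {s s' t t' r r' : List Dir} {u v w x y : List Slice}

@[refl] theorem refl (s s' : List Dir) (u : List Slice) : TangleEquiv s s' u u :=
  Relation.EqvGen.refl u

theorem symm (h : TangleEquiv s s' u v) : TangleEquiv s s' v u := Relation.EqvGen.symm _ _ h

theorem trans (h : TangleEquiv s s' u v) (h' : TangleEquiv s s' v w) : TangleEquiv s s' u w :=
  Relation.EqvGen.trans _ _ _ h h'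

theorem of_isotopy (h : IsotopyMove u v) (hu : Run s u s') (hv : Run s v s') :
    TangleEquiv s s' u v :=
  .rel _ _ ⟨[], u, v, [], s, s', .inl h, .nil _, hu, hv, .nil _, by simp, by simp⟩

theorem of_reidemeister (h : ReidemeisterMove u v) (hu : Run s u s') (hv : Run s v s') :
    TangleEquiv s s' u v :=
  .rel _ _ ⟨[], u, v, [], s, s', .inr h, .nil _, hu, hv, .nil _, by simp, by simp⟩

theorem map {s s' t t' : List Dir} {f : List Slice → List Slice}
    (hf : ∀ a b, TangleMove s s' a b → TangleMove t t' (f a) (f b)) {u v : List Slice}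
    (h : TangleEquiv s s' u v) : TangleEquiv t t' (f u) (f v) := by
  induction h with
  | rel _ _ h => exact .rel _ _ (hf _ _ h)
  | refl => exact Relation.EqvGen.refl _
  | symm _ _ _ ih => exact Relation.EqvGen.symm _ _ ih
  | trans _ _ _ _ _ ih ih' => exact Relation.EqvGen.trans _ _ _ ih ih'

/-- Equivalent tangles may be interchanged inside a tangle. -/
theorem congr (h : TangleEquiv s s' u v) (hx : Run t x s) (hy : Run s' y t') :
    TangleEquiv t t' (x ++ u ++ y) (x ++ v ++ y) := by
  refine h.map (f := fun u => x ++ u ++ y) ?_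
  rintro _ _ ⟨x', u, v, y', p, p', h, hx', hu, hv, hy', rfl, rfl⟩
  exact ⟨x ++ x', u, v, y' ++ y, p, p', h, hx.append hx', hu, hv, hy'.append hy, by simp, by simp⟩

theorem append_left (h : TangleEquiv s s' u v) (hx : Run t x s) :
    TangleEquiv t s' (x ++ u) (x ++ v) := by
  simpa using h.congr hx (.nil s')

theorem append_right (h : TangleEquiv s s' u v) (hy : Run s' y t) :
    TangleEquiv s t (u ++ y) (v ++ y) := by
  simpa using h.congr (.nil s) hy

end TangleEquiv

theorem step_add_right {s s' : List Dir} {c : Slice} (h : c.Step s s') (r : List Dir) :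
    c.Step (s ++ r) (s' ++ r) := by
  cases h with
  | crossing l r' a b t => simpa using Slice.Step.crossing l (r' ++ r) a b t
  | max l r' d => simpa using Slice.Step.max l (r' ++ r) d
  | min l r' d => simpa using Slice.Step.min l (r' ++ r) d

theorem Run.add_right {s s' : List Dir} {w : List Slice} (h : Run s w s') (r : List Dir) :
    Run (s ++ r) w (s' ++ r) := by
  induction h with
  | nil s => exact .nil _
  | cons h _ ih => exact .cons (step_add_right h r) ih

theorem Run.add_left {s s' : List Dir} {w : List Slice} (h : Run s w s') (l : List Dir) :
    Run (l ++ s) (w.map (Slice.right l.length)) (l ++ s') := run_right_iff.2 ⟨s', h, rfl⟩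

theorem IsotopyMove.right {u v : List Slice} (h : IsotopyMove u v) (i : ℕ) :
    IsotopyMove (u.map (Slice.right i)) (v.map (Slice.right i)) := by
  cases h with
  | heights p q j k =>
    simpa [Slice.right, add_assoc] using IsotopyMove.heights p q (i + j) k
  | zigzag_left j d => exact .zigzag_left (i + j) d
  | zigzag_right j d => exact .zigzag_right (i + j) d
  | crossing_min j t => exact .crossing_min (i + j) t
  | crossing_max j d t => exact .crossing_max (i + j) d t

theorem ReidemeisterMove.right {u v : List Slice} (h : ReidemeisterMove u v) (i : ℕ) :
    ReidemeisterMove (u.map (Slice.right i)) (v.map (Slice.right i)) := by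
  cases h with
  | kink_right j d t => exact .kink_right (i + j) d t
  | kink_left j d t => exact .kink_left (i + j) d t
  | bigon j t => exact .bigon (i + j) t
  | triangle j a b c h => exact .triangle (i + j) a b c h

namespace TangleEquiv

variable {s s' t t' r r' : List Dir} {u v w x y : List Slice}

theorem add_right (h : TangleEquiv s s' u v) (r : List Dir) :
    TangleEquiv (s ++ r) (s' ++ r) u v := by
  refine h.map (f := id) ?_
  rintro _ _ ⟨x, u, v, y, p, p', h, hx, hu, hv, hy, rfl, rfl⟩
  exact ⟨x, u, v, y, p ++ r, p' ++ r, h, hx.add_right r, hu.add_right r, hv.add_right r,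
    hy.add_right r, rfl, rfl⟩

theorem add_left (h : TangleEquiv s s' u v) (l : List Dir) :
    TangleEquiv (l ++ s) (l ++ s') (u.map (Slice.right l.length))
      (v.map (Slice.right l.length)) := by
  refine h.map ?_
  rintro _ _ ⟨x, u, v, y, p, p', h, hx, hu, hv, hy, rfl, rfl⟩
  exact ⟨_, _, _, _, l ++ p, l ++ p', h.imp (·.right _) (·.right _), hx.add_left l, hu.add_left l,
    hv.add_left l, hy.add_left l, by simp, by simp⟩

theorem run_iff (h : TangleEquiv s s' u v) : Run s u s' ↔ Run s v s' := by
  induction h with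
  | rel _ _ h =>
    obtain ⟨x, u, v, y, p, p', -, hx, hu, hv, hy, rfl, rfl⟩ := h
    exact ⟨fun _ => (hx.append hv).append hy, fun _ => (hx.append hu).append hy⟩
  | refl => exact Iff.rfl
  | symm _ _ _ ih => exact ih.symm
  | trans _ _ _ _ _ ih ih' => exact ih.trans ih'

theorem link_eq (h : TangleEquiv [] [] u v) (hu : Run [] u []) (hv : Run [] v []) :
    LinkDiagram.link ⟨u, hu⟩ = LinkDiagram.link ⟨v, hv⟩ := by
  induction h with
  | rel _ _ h => exact Quotient.sound (.rel _ _ h)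
  | refl => rfl
  | symm _ _ _ ih => exact (ih hv hu).symm
  | trans _ _ _ h _ ih ih' =>
    have := (run_iff h).1 hu
    exact (ih hu this).trans (ih' this hv)

theorem step_interchange {c d : Slice} (hc : c.Step s s') (hd : d.Step r r') :
    TangleEquiv (s ++ r) (s' ++ r') [c, d.right s'.length] [d.right s.length, c] := by
  have key : ∃ k, s.length = c.pos + c.piece.top + k ∧ s'.length = c.pos + c.piece.bot + k := by
    cases hc with
    | crossing l r a b t => exact ⟨r.length, by simp [Piece.top]; omega, by simp [Piece.bot]; omega⟩
    | max l r d => exact ⟨r.length, by simp [Piece.top], by simp [Piece.bot]; omega⟩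
    | min l r d => exact ⟨r.length, by simp [Piece.top]; omega, by simp [Piece.bot]⟩
  obtain ⟨k, h1, h2⟩ := key
  refine of_isotopy ?_ ?_ ?_
  · rw [h1, h2]
    have := IsotopyMove.heights c.piece d.piece c.pos (k + d.pos)
    simpa [Slice.right, add_assoc] using this
  · exact .cons (step_add_right hc r) (.cons (step_right_iff.2 ⟨r', hd, rfl⟩) (.nil _))
  · exact .cons (step_right_iff.2 ⟨r', hd, rfl⟩) (.cons (step_add_right hc r') (.nil _))

theorem step_run_interchange {c : Slice} (hc : c.Step s s') (hw : Run r w r') :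
    TangleEquiv (s ++ r) (s' ++ r') (c :: w.map (Slice.right s'.length))
      (w.map (Slice.right s.length) ++ [c]) := by
  induction hw with
  | nil r => exact .refl _ _ _
  | @cons r₁ r₂ r₃ d w hd hw ih =>
    refine ((step_interchange hc hd).append_right (y := w.map (Slice.right s'.length))
      (hw.add_left s')).trans ?_
    exact ih.append_left (.cons (step_right_iff.2 ⟨r₂, hd, rfl⟩) (.nil _))

/-- Tangles side by side may be moved past each other. -/
theorem interchange (hv : Run s v s') (hw : Run r w r') :
    TangleEquiv (s ++ r) (s' ++ r') (v ++ w.map (Slice.right s'.length))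
      (w.map (Slice.right s.length) ++ v) := by
  induction hv with
  | nil s => simpa using TangleEquiv.refl _ _ _
  | @cons s₁ s₂ s₃ c v hc hv ih =>
    have h1 := ih.append_left (.cons (step_add_right hc r) (.nil _))
    have h2 := (step_run_interchange hc hw).append_right (hv.add_right r')
    refine h1.trans ?_
    simpa using h2

end TangleEquiv

section

attribute [local simp] run_cons_iff run_nil_iff step_succ_iff step_one_iff step_crossing_iff
  step_max_iff step_min_iff Dir.opp

/-- A curl at a maximum, formed by a virtual crossing, can be removed. -/
theorem tangleEquiv_twisted_max :
    TangleEquiv [] [.up, .down] [⟨.max .down, 0⟩, ⟨.crossing .virt, 0⟩] [⟨.max .up, 0⟩] := by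
  have h1 : TangleEquiv [.up, .down] [.up, .down]
      [⟨.max .down, 0⟩, ⟨.crossing .virt, 1⟩, ⟨.min, 0⟩] [] :=
    .of_reidemeister (.kink_left 0 .down .virt) (by simp) (by simp)
  have h2 : TangleEquiv [] [.down, .up, .up, .down] [⟨.max .down, 0⟩, ⟨.max .up, 2⟩]
      [⟨.max .up, 0⟩, ⟨.max .down, 0⟩] :=
    .of_isotopy (.heights (.max .down) (.max .up) 0 0) (by simp) (by simp)
  have h3 : TangleEquiv [.down, .up, .up, .down] [.up, .down]
      [⟨.crossing .virt, 0⟩, ⟨.min, 1⟩] [⟨.crossing .virt, 1⟩, ⟨.min, 0⟩] :=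
    .of_isotopy (.crossing_min 0 .virt) (by simp) (by simp)
  have h4 : TangleEquiv [.down, .up] [.up, .down, .up, .down]
      [⟨.crossing .virt, 0⟩, ⟨.max .up, 2⟩] [⟨.max .up, 2⟩, ⟨.crossing .virt, 0⟩] :=
    .of_isotopy (.heights (.crossing .virt) (.max .up) 0 0) (by simp) (by simp)
  have h5 : TangleEquiv [.up, .down] [.up, .down] [⟨.max .up, 2⟩, ⟨.min, 1⟩] [] :=
    .of_isotopy (.zigzag_left 1 .up) (by simp) (by simp)
  refine .symm ((h1.symm.append_left (x := [⟨.max .up, 0⟩]) (by simp)).trans ?_)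
  refine (h2.symm.append_right (y := [⟨.crossing .virt, 1⟩, ⟨.min, 0⟩]) (by simp)).trans ?_
  refine (h3.symm.append_left (x := [⟨.max .down, 0⟩, ⟨.max .up, 2⟩]) (by simp)).trans ?_
  refine (h4.symm.congr (x := [⟨.max .down, 0⟩]) (y := [⟨.min, 1⟩]) (by simp) (by simp)).trans ?_
  exact h5.append_left (x := [⟨.max .down, 0⟩, ⟨.crossing .virt, 0⟩]) (by simp)

/-- A curl at a minimum, formed by a virtual crossing, can be removed. -/
theorem tangleEquiv_twisted_min :
    TangleEquiv [.up, .down] [] [⟨.crossing .virt, 0⟩, ⟨.min, 0⟩] [⟨.min, 0⟩] := by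
  have h1 : TangleEquiv [.up, .down] [.up, .down]
      [⟨.max .down, 0⟩, ⟨.crossing .virt, 1⟩, ⟨.min, 0⟩] [] :=
    .of_reidemeister (.kink_left 0 .down .virt) (by simp) (by simp)
  have h2 : TangleEquiv [.up, .down] [.down, .up, .up, .down]
      [⟨.max .down, 0⟩, ⟨.crossing .virt, 1⟩] [⟨.max .down, 1⟩, ⟨.crossing .virt, 0⟩] :=
    .of_isotopy (.crossing_max 0 .down .virt) (by simp) (by simp)
  have h3 : TangleEquiv [.down, .up, .up, .down] [] [⟨.min, 0⟩, ⟨.min, 0⟩]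
      [⟨.min, 2⟩, ⟨.min, 0⟩] :=
    .of_isotopy (.heights .min .min 0 0) (by simp) (by simp)
  have h4 : TangleEquiv [.up, .down, .up, .down] [.down, .up]
      [⟨.crossing .virt, 0⟩, ⟨.min, 2⟩] [⟨.min, 2⟩, ⟨.crossing .virt, 0⟩] :=
    .of_isotopy (.heights (.crossing .virt) .min 0 0) (by simp) (by simp)
  have h5 : TangleEquiv [.up, .down] [.up, .down] [⟨.max .down, 1⟩, ⟨.min, 2⟩] [] :=
    .of_isotopy (.zigzag_right 1 .down) (by simp) (by simp)
  refine .symm ((h1.symm.append_right (y := [⟨.min, 0⟩]) (by simp)).trans ?_)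
  refine (h2.append_right (y := [⟨.min, 0⟩, ⟨.min, 0⟩]) (by simp)).trans ?_
  refine (h3.append_left (x := [⟨.max .down, 1⟩, ⟨.crossing .virt, 0⟩]) (by simp)).trans ?_
  refine (h4.congr (x := [⟨.max .down, 1⟩]) (y := [⟨.min, 0⟩]) (by simp) (by simp)).trans ?_
  exact h5.append_right (y := [⟨.crossing .virt, 0⟩, ⟨.min, 0⟩]) (by simp)

/-! ### Sweeping a strand across a tangle -/

/-- A strand to the right of `k` strands crosses all of them virtually. -/
def sweep : ℕ → List Slice
  | 0 => []
  | k + 1 => (sweep k).map (Slice.right 1) ++ [⟨.crossing .virt, 0⟩]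

theorem right_right (i j : ℕ) (w : List Slice) :
    (w.map (Slice.right i)).map (Slice.right j) = w.map (Slice.right (j + i)) := by
  simp [Slice.right, Function.comp_def, add_assoc]

theorem right_zero (w : List Slice) : w.map (Slice.right 0) = w :=
  (List.map_congr_left fun c _ => by simp [Slice.right]).trans (List.map_id _)

theorem sweep_add (k j : ℕ) : sweep (k + j) = (sweep j).map (Slice.right k) ++ sweep k := by
  induction k with
  | zero => simp [sweep, right_zero]
  | succ k ih =>
    rw [Nat.add_right_comm, sweep, ih, List.map_append, right_right, sweep, List.append_assoc,
      add_comm 1 k]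

theorem run_sweep (s : List Dir) (d : Dir) : Run (s ++ [d]) (sweep s.length) (d :: s) := by
  induction s with
  | nil => exact .nil _
  | cons x s ih =>
    exact (ih.add_left [x]).append (by simp)

/-- A strand sweeps virtually across a single piece. -/
theorem tangleEquiv_sweep_piece (p : Piece) {s s' : List Dir} (h : Slice.Step s ⟨p, 0⟩ s')
    (hs : s.length = p.top) (d : Dir) :
    TangleEquiv (s ++ [d]) (d :: s') (⟨p, 0⟩ :: sweep s'.length)
      (sweep s.length ++ [⟨p, 1⟩]) := by
  cases p with
  | crossing t =>
    obtain ⟨a, b, r, rfl, rfl⟩ := step_crossing_iff.1 h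
    obtain rfl := List.length_eq_zero_iff.1 (show r.length = 0 by simpa [Piece.top] using hs)
    exact .of_reidemeister (.triangle 0 t .virt .virt (.virt₃ t)) (by simp [sweep, Slice.right])
      (by simp [sweep, Slice.right])
  | max e =>
    obtain rfl := step_max_iff.1 h
    obtain rfl := List.length_eq_zero_iff.1 (show s.length = 0 by simpa [Piece.top] using hs)
    have h1 : TangleEquiv [d] [e, d, e.opp] [⟨.max e, 0⟩, ⟨.crossing .virt, 1⟩]
      [⟨.max e, 1⟩, ⟨.crossing .virt, 0⟩] :=
      .of_isotopy (.crossing_max 0 e .virt) (by simp) (by simp)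
    have h2 : TangleEquiv [d, e, e.opp] [d, e, e.opp]
      [⟨.crossing .virt, 0⟩, ⟨.crossing .virt, 0⟩] [] :=
      .of_reidemeister (.bigon 0 .virt) (by simp) (by simp)
    exact (h1.append_right (y := [⟨.crossing .virt, 0⟩]) (by simp)).trans
      (h2.append_left (x := [⟨.max e, 1⟩]) (by simp))
  | min =>
    obtain ⟨e, rfl⟩ := step_min_iff.1 h
    obtain rfl := List.length_eq_zero_iff.1 (show s'.length = 0 by simpa [Piece.top] using hs)
    have h1 : TangleEquiv [e, d, e.opp] [d] [⟨.crossing .virt, 0⟩, ⟨.min, 1⟩]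
      [⟨.crossing .virt, 1⟩, ⟨.min, 0⟩] :=
      .of_isotopy (.crossing_min 0 .virt) (by simp) (by simp)
    have h2 : TangleEquiv [e, e.opp, d] [e, e.opp, d]
      [⟨.crossing .virt, 1⟩, ⟨.crossing .virt, 1⟩] [] :=
      .of_reidemeister (.bigon 1 .virt) (by simp) (by simp)
    exact .symm ((h1.append_left (x := [⟨.crossing .virt, 1⟩]) (by simp)).trans
      (h2.append_right (y := [⟨.min, 0⟩]) (by simp)))

theorem tangleEquiv_sweep_step (p : Piece) (i : ℕ) {s s' : List Dir}
    (h : Slice.Step s ⟨p, i⟩ s') (d : Dir) :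
    TangleEquiv (s ++ [d]) (d :: s') (⟨p, i⟩ :: sweep s'.length)
      (sweep s.length ++ [⟨p, 1 + i⟩]) := by
  induction i generalizing s s' with
  | zero =>
    obtain ⟨S, T, r, rfl, rfl, hS, hT, hst⟩ := length_eq_of_step h
    have h1 := TangleEquiv.step_run_interchange hst (run_sweep r d)
    have h2 := (tangleEquiv_sweep_piece p hst hS d).add_right r
    rw [List.length_append, List.length_append, sweep_add, sweep_add, List.append_assoc]
    have r1 := (run_sweep T d).add_right r
    have r2 := (run_sweep r d).add_left S
    refine (h1.append_right (y := sweep T.length) (by simpa using r1)).trans ?_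
    have := h2.append_left (x := (sweep r.length).map (Slice.right S.length)) (by simpa using r2)
    simpa using this
  | succ i ih =>
    obtain ⟨x, r, r', rfl, rfl, hr⟩ := step_succ_iff.1 h
    have h1 := (ih hr).add_left [x]
    have h2 := TangleEquiv.step_interchange (c := ⟨.crossing .virt, 0⟩) (s := [x, d])
      (s' := [d, x]) (by simp) hr
    have h3 := h1.append_right (y := [⟨.crossing .virt, 0⟩]) (t := d :: x :: r') (by simp)
    have h4 := h2.symm.append_left ((run_sweep r d).add_left [x])
    simp only [Slice.right, List.map_cons, List.map_append, List.map_nil, List.length_cons,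
      List.length_nil, List.append_assoc, List.cons_append, List.nil_append, sweep] at h3 h4 ⊢
    rw [add_comm i 1, ← add_assoc 1 1 i] at *
    exact h3.trans h4

/-- A strand sweeps virtually across a tangle: it crosses all strands below the tangle, or all
strands above it. -/
theorem tangleEquiv_sweep {s s' : List Dir} {w : List Slice} (h : Run s w s') (d : Dir) :
    TangleEquiv (s ++ [d]) (d :: s') (w ++ sweep s'.length)
      (sweep s.length ++ w.map (Slice.right 1)) := by
  induction h with
  | nil s => simpa using .refl _ _ _
  | @cons s₁ s₂ s₃ c w hc hw ih =>
    have h1 := (tangleEquiv_sweep_step c.piece c.pos hc d).append_right (hw.add_left [d])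
    refine (ih.append_left (.cons (step_add_right hc [d]) (.nil _))).trans ?_
    rw [List.append_assoc] at h1
    exact h1

/-- A strand that closes a tangle on the right may close it on the left instead. -/
theorem tangleEquiv_close_left {w : List Slice} (h : Run [.down] w [.down]) :
    TangleEquiv [] [] ([⟨.max .down, 0⟩] ++ w ++ [⟨.min, 0⟩])
      ([⟨.max .up, 0⟩] ++ w.map (Slice.right 1) ++ [⟨.min, 0⟩]) := by
  have h1 : TangleEquiv [.down, .up] [.down, .up]
      [⟨.crossing .virt, 0⟩, ⟨.crossing .virt, 0⟩] [] :=
    .of_reidemeister (.bigon 0 .virt) (by simp) (by simp)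
  have h2 := tangleEquiv_sweep h .up
  have hw : Run [.down, .up] w [.down, .up] := h.add_right [.up]
  have hw' : Run [.up, .down] (w.map (Slice.right 1)) [.up, .down] := h.add_left [.up]
  have k1 := h1.symm.congr (x := [⟨.max .down, 0⟩] ++ w) (y := [⟨.min, 0⟩]) (t := []) (t' := [])
    (Run.append (by simp) hw) (by simp)
  have k2 := h2.congr (x := [⟨.max .down, 0⟩]) (y := [⟨.crossing .virt, 0⟩, ⟨.min, 0⟩])
    (t := []) (t' := []) (by simp) (by simp)
  have k3 := tangleEquiv_twisted_max.append_right
    (hw'.append (v := [⟨.crossing .virt, 0⟩, ⟨.min, 0⟩]) (s'' := []) (by simp))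
  have k4 := tangleEquiv_twisted_min.append_left (x := [⟨.max .up, 0⟩] ++ w.map (Slice.right 1))
    (t := []) (Run.append (by simp) hw')
  simp only [List.append_assoc, List.cons_append, List.nil_append, sweep, List.map_nil,
    List.length_cons, List.length_nil, List.append_nil] at k1 k2 k3 k4 ⊢
  exact ((k1.trans k2).trans k3).trans k4

end

open BraidDiagram

/-! ### Moves on closures -/

theorem TangleEquiv.within {s s' : List Dir} {u v : List Slice} (h : TangleEquiv s s' u v)
    (l r : List Dir) : TangleEquiv (l ++ (s ++ r)) (l ++ (s' ++ r))
      (u.map (Slice.right l.length)) (v.map (Slice.right l.length)) :=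
  (h.add_right r).add_left l

theorem Crossing.flip_flip (t : Crossing) : t.flip.flip = t := by cases t <;> rfl

section

attribute [local simp] run_cons_iff run_nil_iff step_succ_iff step_one_iff step_crossing_iff
  step_max_iff step_min_iff Dir.opp

/-- The crossing of two strands that come from nested maxima slides to the other sides of the
maxima. -/
theorem maxima_crossing_two (t : Crossing) :
    TangleEquiv [] [.down, .down, .up, .up]
      [⟨.max .down, 0⟩, ⟨.max .down, 1⟩, ⟨.crossing t, 0⟩]
      [⟨.max .down, 0⟩, ⟨.max .down, 1⟩, ⟨.crossing t, 2⟩] := by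
  have h1 : TangleEquiv [.down, .up] [.down, .down, .up, .up]
      [⟨.max .down, 0⟩, ⟨.crossing t.flip, 1⟩] [⟨.max .down, 1⟩, ⟨.crossing t, 0⟩] :=
    .of_isotopy (by simpa only [t.flip_flip] using IsotopyMove.crossing_max 0 .down t.flip)
      (by simp) (by simp)
  have h2 : TangleEquiv [] [.down, .up, .down, .up] [⟨.max .down, 0⟩, ⟨.max .down, 2⟩]
      [⟨.max .down, 0⟩, ⟨.max .down, 0⟩] :=
    .of_isotopy (.heights (.max .down) (.max .down) 0 0) (by simp) (by simp)
  have h3 : TangleEquiv [.down, .up] [.down, .down, .up, .up]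
      [⟨.max .down, 1⟩, ⟨.crossing t, 2⟩] [⟨.max .down, 2⟩, ⟨.crossing t.flip, 1⟩] :=
    .of_isotopy (.crossing_max 1 .down t) (by simp) (by simp)
  refine (h1.symm.append_left (x := [⟨.max .down, 0⟩]) (by simp)).trans ?_
  refine (h2.symm.append_right (y := [⟨.crossing t.flip, 1⟩]) (by simp)).trans ?_
  exact h3.symm.append_left (x := [⟨.max .down, 0⟩]) (by simp)

theorem minima_crossing_two (t : Crossing) :
    TangleEquiv [.down, .down, .up, .up] []
      [⟨.crossing t, 0⟩, ⟨.min, 1⟩, ⟨.min, 0⟩] [⟨.crossing t, 2⟩, ⟨.min, 1⟩, ⟨.min, 0⟩] := by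
  have h1 : TangleEquiv [.down, .down, .up, .up] [.down, .up]
      [⟨.crossing t, 0⟩, ⟨.min, 1⟩] [⟨.crossing t.flip, 1⟩, ⟨.min, 0⟩] :=
    .of_isotopy (.crossing_min 0 t) (by simp) (by simp)
  have h2 : TangleEquiv [.down, .up, .down, .up] [] [⟨.min, 0⟩, ⟨.min, 0⟩]
      [⟨.min, 2⟩, ⟨.min, 0⟩] :=
    .of_isotopy (.heights .min .min 0 0) (by simp) (by simp)
  have h3 : TangleEquiv [.down, .down, .up, .up] [.down, .up]
      [⟨.crossing t.flip, 1⟩, ⟨.min, 2⟩] [⟨.crossing t, 2⟩, ⟨.min, 1⟩] :=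
    .of_isotopy (by simpa only [t.flip_flip] using IsotopyMove.crossing_min 1 t.flip)
      (by simp) (by simp)
  refine (h1.append_right (y := [⟨.min, 0⟩]) (by simp)).trans ?_
  refine (h2.append_left (x := [⟨.crossing t.flip, 1⟩]) (by simp)).trans ?_
  exact h3.append_right (y := [⟨.min, 0⟩]) (by simp)

end

theorem maxima_succ (m : ℕ) : maxima (m + 1) = maxima m ++ [⟨.max .down, m⟩] := by
  simp [maxima, List.range_succ]

theorem minima_succ (m : ℕ) : minima (m + 1) = ⟨.min, m⟩ :: minima m := by
  simp [minima, List.range_succ]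

theorem maxima_succ' (m : ℕ) :
    maxima (m + 1) = ⟨.max .down, 0⟩ :: (maxima m).map (Slice.right 1) := by
  simp [maxima, List.range_succ_eq_map, Slice.right, Function.comp_def, add_comm]

theorem minima_succ' (m : ℕ) :
    minima (m + 1) = (minima m).map (Slice.right 1) ++ [⟨.min, 0⟩] := by
  simp [minima, List.range_succ_eq_map, Slice.right, Function.comp_def, add_comm]

theorem step_replicate {m i : ℕ} (h : i + 1 < m) (d : Dir) (t : Crossing) :
    Slice.Step (List.replicate m d) ⟨.crossing t, i⟩ (List.replicate m d) := by
  obtain ⟨k, rfl⟩ : ∃ k, m = i + (2 + k) := ⟨m - (i + 2), by omega⟩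
  have := Slice.Step.crossing (List.replicate i d) (List.replicate k d) d d t
  rw [List.length_replicate] at this
  rw [List.replicate_add, List.replicate_add 2]
  exact this

theorem step_up_strands {m i j : ℕ} (h : i + 1 < m) (hj : j + i + 2 = 2 * m) (t : Crossing) :
    Slice.Step (strands m) ⟨.crossing t, j⟩ (strands m) := by
  have e : j = (List.replicate m Dir.down).length + (m - 2 - i) := by
    rw [List.length_replicate]; omega
  rw [e]
  exact step_right_iff.2 ⟨_, step_replicate (by omega) _ _, rfl⟩

theorem run_single_iff {s s' : List Dir} {c : Slice} : Run s [c] s' ↔ c.Step s s' := by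
  simp [run_cons_iff, run_nil_iff]

theorem step_max_strands (m : ℕ) : Slice.Step (strands m) ⟨.max .down, m⟩ (strands (m + 1)) := by
  rw [strands_succ]
  simpa [strands, Dir.opp] using
    Slice.Step.max (List.replicate m .down) (List.replicate m .up) .down

theorem step_min_strands (m : ℕ) : Slice.Step (strands (m + 1)) ⟨.min, m⟩ (strands m) := by
  rw [strands_succ]
  simpa [strands, Dir.opp] using
    Slice.Step.min (List.replicate m .down) (List.replicate m .up) .down

/-- The strands of a closure, as the `i` outer ones of each side around the other ones. -/
theorem strands_add (k i : ℕ) :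
    strands (i + k) = List.replicate i .down ++ (strands k ++ List.replicate i .up) := by
  simp only [strands, List.append_assoc]
  rw [List.replicate_add i k, Nat.add_comm i k, List.replicate_add k i, List.append_assoc]

/-- A crossing below nested maxima slides along the two arcs from their left legs to their right
legs. -/
theorem maxima_crossing {m i j : ℕ} (h : i + 1 < m) (hj : j + i + 2 = 2 * m) (t : Crossing) :
    TangleEquiv [] (strands m) (maxima m ++ [⟨.crossing t, i⟩])
      (maxima m ++ [⟨.crossing t, j⟩]) := by
  obtain ⟨k, rfl⟩ : ∃ k, m = i + 2 + k := ⟨m - (i + 2), by omega⟩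
  clear h
  induction k generalizing j with
  | zero =>
    obtain rfl : j = i + 2 := by omega
    have := ((maxima_crossing_two t).within (List.replicate i .down)
      (List.replicate i .up)).append_left (run_maxima i)
    rw [List.length_replicate] at this
    rw [Nat.add_zero, strands_add, show strands 2 = [.down, .down, .up, .up] from rfl, maxima_succ, maxima_succ]
    simpa [Slice.right] using this
  | succ k ih =>
    obtain ⟨j, rfl⟩ : ∃ j', j = j' + 2 := ⟨j - 2, by omega⟩
    have ih := ih (j := j) (by omega)
    set m := i + 2 + k with hm
    have h1 : TangleEquiv (strands m) (strands (m + 1))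
        [⟨.crossing t, i⟩, ⟨.max .down, m⟩] [⟨.max .down, m⟩, ⟨.crossing t, i⟩] :=
      .of_isotopy (.heights (.crossing t) (.max .down) i k)
        (.cons (step_crossing i (by omega) t) (run_single_iff.2 (step_max_strands m)))
        (.cons (step_max_strands m) (run_single_iff.2 (step_crossing i (by omega) t)))
    have h2 : TangleEquiv (strands m) (strands (m + 1))
        [⟨.max .down, m⟩, ⟨.crossing t, j + 2⟩] [⟨.crossing t, j⟩, ⟨.max .down, m⟩] := by
      have := IsotopyMove.heights (.max .down) (.crossing t) m k
      rw [show m + (Piece.max .down).bot + k = j + 2 by simp [Piece.bot]; omega,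
        show m + (Piece.max .down).top + k = j by simp [Piece.top]; omega] at this
      exact .of_isotopy this
        (.cons (step_max_strands m) (run_single_iff.2 (step_up_strands (i := i) (by omega) (by omega) t)))
        (.cons (step_up_strands (i := i) (by omega) (by omega) t) (run_single_iff.2 (step_max_strands m)))
    have h3 := ih.append_right (run_single_iff.2 (step_max_strands m))
    have k1 := h1.append_left (run_maxima m)
    have k2 := h2.append_left (run_maxima m)
    rw [show i + 2 + (k + 1) = m + 1 by omega, maxima_succ]
    simp only [List.append_assoc, List.cons_append, List.nil_append] at *
    exact (k1.symm.trans h3).trans k2.symm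

/-- A crossing above nested minima slides along the two arcs from their left legs to their right
legs. -/
theorem minima_crossing {m i j : ℕ} (h : i + 1 < m) (hj : j + i + 2 = 2 * m) (t : Crossing) :
    TangleEquiv (strands m) [] (⟨.crossing t, i⟩ :: minima m) (⟨.crossing t, j⟩ :: minima m) := by
  obtain ⟨k, rfl⟩ : ∃ k, m = i + 2 + k := ⟨m - (i + 2), by omega⟩
  clear h
  induction k generalizing j with
  | zero =>
    obtain rfl : j = i + 2 := by omega
    have := ((minima_crossing_two t).within (List.replicate i .down)
      (List.replicate i .up)).append_right (run_minima i)
    rw [List.length_replicate] at this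
    rw [Nat.add_zero, strands_add, show strands 2 = [.down, .down, .up, .up] from rfl, minima_succ, minima_succ]
    simpa [Slice.right] using this
  | succ k ih =>
    obtain ⟨j, rfl⟩ : ∃ j', j = j' + 2 := ⟨j - 2, by omega⟩
    have ih := ih (j := j) (by omega)
    set m := i + 2 + k with hm
    have h1 : TangleEquiv (strands (m + 1)) (strands m)
        [⟨.crossing t, i⟩, ⟨.min, m⟩] [⟨.min, m⟩, ⟨.crossing t, i⟩] :=
      .of_isotopy (.heights (.crossing t) .min i k)
        (.cons (step_crossing i (by omega) t) (run_single_iff.2 (step_min_strands m)))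
        (.cons (step_min_strands m) (run_single_iff.2 (step_crossing i (by omega) t)))
    have h2 : TangleEquiv (strands (m + 1)) (strands m)
        [⟨.min, m⟩, ⟨.crossing t, j⟩] [⟨.crossing t, j + 2⟩, ⟨.min, m⟩] := by
      have := IsotopyMove.heights .min (.crossing t) m k
      rw [show m + Piece.min.bot + k = j by simp [Piece.bot]; omega,
        show m + Piece.min.top + k = j + 2 by simp [Piece.top]; omega] at this
      exact .of_isotopy this
        (.cons (step_min_strands m) (run_single_iff.2 (step_up_strands (i := i) (by omega) (by omega) t)))
        (.cons (step_up_strands (i := i) (by omega) (by omega) t) (run_single_iff.2 (step_min_strands m)))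
    have h3 := ih.append_left (run_single_iff.2 (step_min_strands m))
    have k1 := h1.append_right (run_minima m)
    have k2 := h2.append_right (run_minima m)
    rw [show i + 2 + (k + 1) = m + 1 by omega, minima_succ]
    simp only [List.cons_append, List.nil_append] at *
    exact (k1.trans h3).trans k2

theorem exists_slice {m : ℕ} (l : BraidLetter m) : ∃ t i, i + 1 < m ∧ l.slice = ⟨.crossing t, i⟩ := by
  cases l <;> exact ⟨_, _, ‹_›, rfl⟩

theorem run_slices_down {m : ℕ} (b : BraidDiagram m) :
    Run (List.replicate m .down) b.slices (List.replicate m .down) := by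
  induction b using FreeMonoid.inductionOn' with
  | one => exact .nil _
  | of_mul l w ih =>
    rw [slices_mul]
    obtain ⟨t, i, hi, e⟩ := exists_slice l
    have : slices (FreeMonoid.of l) = [⟨.crossing t, i⟩] := by rw [← e]; rfl
    rw [this]
    exact .cons (step_replicate hi _ t) ih

/-- A braid diagram may be moved past a tangle on its right. -/
theorem slices_interchange {m : ℕ} (b : BraidDiagram m) {s s' : List Dir} {w : List Slice}
    (h : Run s w s') : TangleEquiv (List.replicate m .down ++ s) (List.replicate m .down ++ s')
      (b.slices ++ w.map (Slice.right m)) (w.map (Slice.right m) ++ b.slices) := by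
  simpa using TangleEquiv.interchange (run_slices_down b) h

theorem link_closure_eq {m n : ℕ} {b : BraidDiagram m} {b' : BraidDiagram n}
    (h : TangleEquiv [] [] (maxima m ++ b.slices ++ minima m) (maxima n ++ b'.slices ++ minima n)) :
    b.closure.link = b'.closure.link :=
  h.link_eq b.closure.2 b'.closure.2

/-- The first letter of a braid travels through the closing arcs to the end of the braid. -/
theorem link_closure_of_mul {m : ℕ} (l : BraidLetter m) (w : BraidDiagram m) :
    (closure (FreeMonoid.of l * w)).link = (closure (w * FreeMonoid.of l)).link := by
  obtain ⟨t, i, hi, e⟩ := exists_slice l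
  have e : slices (FreeMonoid.of l) = [⟨.crossing t, i⟩] := by rw [← e]; rfl
  apply link_closure_eq
  obtain ⟨j, hj⟩ : ∃ j, j + i + 2 = 2 * m := ⟨2 * m - (i + 2), by omega⟩
  have h1 := (maxima_crossing hi hj t).append_right ((run_slices w).append (run_minima m))
  have h2 := ((slices_interchange w (run_single_iff.2 (step_replicate (m := m) (i := m - 2 - i)
    (by omega) .up t))).congr (run_maxima m) (run_minima m))
  have h3 := (minima_crossing hi hj t).append_left ((run_maxima m).append (run_slices w))
  have e' : m + (m - 2 - i) = j := by omega
  simp only [List.map_cons, List.map_nil, Slice.right, e', slices_mul, e, List.append_assoc,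
    List.cons_append, List.nil_append] at *
  exact (h1.trans h2.symm).trans h3.symm

theorem link_closure_mul_comm {m : ℕ} (u w : BraidDiagram m) :
    (closure (u * w)).link = (closure (w * u)).link := by
  induction u using FreeMonoid.inductionOn' generalizing w with
  | one => simp
  | of_mul l u ih =>
    rw [mul_assoc, link_closure_of_mul, mul_assoc, ih, mul_assoc]

section

attribute [local simp] run_cons_iff run_nil_iff step_succ_iff step_one_iff step_crossing_iff
  step_max_iff step_min_iff Dir.opp

theorem slices_ι_right {m : ℕ} (b : BraidDiagram m) : slices (ι 0 1 b) = b.slices := by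
  simp only [slices, ι, FreeMonoid.toList_map, List.map_map]
  exact List.map_congr_left fun l _ => by cases l <;> rfl

theorem slices_ι_left {m : ℕ} (b : BraidDiagram m) :
    slices (ι 1 0 b) = b.slices.map (Slice.right 1) := by
  simp only [slices, ι, FreeMonoid.toList_map, List.map_map]
  refine List.map_congr_left fun l _ => ?_
  cases l <;> simp [BraidLetter.slice, BraidLetter.shift, Slice.right, Nat.add_comm]

theorem run_max_up (m : ℕ) : Run (List.replicate m .up) [⟨.max .down, 0⟩]
    (.down :: .up :: List.replicate m .up) := by simp

/-- A kink of the innermost strand of a closure. -/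
theorem kink_strands (i : ℕ) (t : Crossing) : TangleEquiv (strands (i + 1)) (strands (i + 1))
    [⟨.max .down, i + 1⟩, ⟨.crossing t, i⟩, ⟨.min, i + 1⟩] [] := by
  have h : TangleEquiv [.down] [.down] [⟨.max .down, 1⟩, ⟨.crossing t, 0⟩, ⟨.min, 1⟩] [] :=
    .of_reidemeister (.kink_right 0 .down t) (by simp) (by simp)
  have := h.within (List.replicate i .down) (List.replicate (i + 1) .up)
  rw [List.length_replicate] at this
  rw [strands, List.replicate_succ']
  simpa [Slice.right] using this

/-- The maximum of an innermost closing arc may be placed below the braid. -/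
theorem max_slices {m : ℕ} (b : BraidDiagram m) : TangleEquiv (strands m) (strands (m + 1))
    (b.slices ++ [⟨.max .down, m⟩]) (⟨.max .down, m⟩ :: b.slices) := by
  have := slices_interchange b (run_max_up m)
  rw [strands_succ]
  simpa [Slice.right, strands] using this

/-- The innermost closing arc of a stabilized braid is a kink. -/
theorem link_closure_stab {m : ℕ} (b : BraidDiagram m) (x : BraidDiagram (m + 1)) (t : Crossing)
    (i : ℕ) (hi : i + 1 = m) (hx : x.slices = b.slices ++ [⟨.crossing t, i⟩]) :
    b.closure.link = x.closure.link := by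
  subst hi
  have h1 := (max_slices b).congr (run_maxima (i + 1))
    (y := [⟨.crossing t, i⟩, ⟨.min, i + 1⟩] ++ minima (i + 1)) (t' := [])
    (Run.append (.cons (step_crossing i (by omega) t) (run_single_iff.2 (step_min_strands _)))
      (run_minima _))
  have h2 := (kink_strands i t).congr ((run_maxima (i + 1)).append (run_slices b)) (run_minima _)
  apply link_closure_eq
  rw [hx, maxima_succ (i + 1), minima_succ (i + 1)]
  simp only [List.append_assoc, List.cons_append, List.nil_append] at *
  exact h2.symm.trans h1

/-- The crossings of the innermost strand of the closure in a right exchange move are moved to the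
other sides of its maximum and its minimum, where they cancel. -/
theorem tangleEquiv_exchange_right {i : ℕ} (b₁ b₂ : BraidDiagram (i + 1)) (t : Crossing) :
    TangleEquiv [] [] (maxima (i + 1 + 1) ++ (b₁.slices ++ [⟨.crossing t.flip, i⟩] ++ b₂.slices ++
        [⟨.crossing t, i⟩]) ++ minima (i + 1 + 1))
      (maxima (i + 1) ++ b₁.slices ++ [⟨.max .down, i⟩] ++ b₂.slices ++ [⟨.min, i⟩] ++
        minima (i + 1)) := by
  have a1 : TangleEquiv [.down] [.down, .down, .up] [⟨.max .down, 0⟩, ⟨.crossing t, 1⟩]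
      [⟨.max .down, 1⟩, ⟨.crossing t.flip, 0⟩] :=
    .of_isotopy (.crossing_max 0 .down t) (by simp) (by simp)
  have a2 : TangleEquiv [.down, .down, .up] [.down] [⟨.crossing t, 0⟩, ⟨.min, 1⟩]
      [⟨.crossing t.flip, 1⟩, ⟨.min, 0⟩] :=
    .of_isotopy (.crossing_min 0 t) (by simp) (by simp)
  have a3 : TangleEquiv [.down, .up, .down] [.down, .up, .down]
      [⟨.crossing t, 1⟩, ⟨.crossing t.flip, 1⟩] [] :=
    .of_reidemeister (.bigon 1 t) (by simp) (by simp)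
  have r1 : Run [.down] [⟨.max .down, 0⟩] [.down, .up, .down] := by simp
  have r2 : Run [.down, .up, .down] [⟨.min, 0⟩] [.down] := by simp
  have r3 : Run [.down, .up, .down] [⟨.crossing t, 1⟩] [.down, .down, .up] := by simp
  replace a1 := a1.within (List.replicate i .down) (List.replicate (i + 1) .up)
  replace a2 := a2.within (List.replicate i .down) (List.replicate (i + 1) .up)
  replace a3 := a3.within (List.replicate i .down) (List.replicate (i + 1) .up)
  replace r1 := (r1.add_right (List.replicate (i + 1) .up)).add_left (List.replicate i .down)
  replace r2 := (r2.add_right (List.replicate (i + 1) .up)).add_left (List.replicate i .down)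
  replace r3 := (r3.add_right (List.replicate (i + 1) .up)).add_left (List.replicate i .down)
  have a4 := slices_interchange b₂ (s := .down :: .up :: List.replicate (i + 1) .up) (s' :=
    .up :: .down :: List.replicate (i + 1) .up) (w := [⟨.crossing t.flip, 0⟩]) (by simp)
  have f1 : List.replicate i Dir.down ++ ([.down] ++ List.replicate (i + 1) .up)
      = strands (i + 1) := by
    rw [strands, List.replicate_succ' (a := Dir.down), List.append_assoc]
  have f2 : List.replicate i Dir.down ++ ([.down, .down, .up] ++ List.replicate (i + 1) .up)
      = strands (i + 1 + 1) := by
    rw [strands_succ, List.replicate_succ' (a := Dir.down), List.append_assoc]; rfl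
  have f3 : List.replicate (i + 1) Dir.down ++ .up :: .down :: List.replicate (i + 1) .up
      = List.replicate i Dir.down ++ ([.down, .up, .down] ++ List.replicate (i + 1) .up) := by
    rw [List.replicate_succ' (a := Dir.down), List.append_assoc]; rfl
  have r4 := (run_slices_down b₂).add_right (.up :: .down :: List.replicate (i + 1) .up)
  have r5 := (run_slices_down b₂).add_right (.down :: .up :: List.replicate (i + 1) .up)
  rw [f3] at r4 a4
  rw [← strands_succ] at r5 a4
  rw [f1, f2] at a1 a2
  rw [f1] at r1 r2
  rw [f2] at r3
  have hl := (run_maxima (i + 1)).append (run_slices b₁)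
  have hr := run_minima (i + 1)
  have c1 := run_single_iff.2 (step_crossing (m := i + 1 + 1) i (by omega) t)
  have c2 := run_single_iff.2 (step_crossing (m := i + 1 + 1) i (by omega) t.flip)
  have s1 := (max_slices b₁).symm.congr (run_maxima (i + 1))
    (c2.append (r5.append (c1.append (Run.cons (step_min_strands _) hr))))
  have s2 := a1.symm.congr hl (r5.append (c1.append (Run.cons (step_min_strands _) hr)))
  have s3 := a2.congr (hl.append (r1.append (r3.append r5))) hr
  have s4 := a4.congr (hl.append (r1.append r3)) (r2.append hr)
  have s5 := a3.congr (hl.append r1) (r4.append (r2.append hr))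
  rw [maxima_succ (i + 1), minima_succ (i + 1)]
  simp only [List.append_assoc, List.cons_append, List.nil_append, List.map_cons, List.map_nil,
    Slice.right, List.length_replicate, Nat.add_zero] at *
  exact (((s1.trans s2).trans s3).trans s4).trans s5

theorem link_closure_exchange_right {m : ℕ} (b₁ b₂ : BraidDiagram m) (x x' : BraidDiagram (m + 1))
    (t t' : Crossing) (i : ℕ) (hi : i + 1 = m)
    (hx : x.slices = b₁.slices ++ [⟨.crossing t.flip, i⟩] ++ b₂.slices ++ [⟨.crossing t, i⟩])
    (hx' : x'.slices = b₁.slices ++ [⟨.crossing t'.flip, i⟩] ++ b₂.slices ++ [⟨.crossing t', i⟩]) :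
    x.closure.link = x'.closure.link := by
  subst hi
  apply link_closure_eq
  rw [hx, hx']
  exact (tangleEquiv_exchange_right b₁ b₂ t).trans (tangleEquiv_exchange_right b₁ b₂ t').symm

/-- The closing arc of the leftmost strand is swept to the left side; then the crossings in a left
exchange move are moved to the other sides of the maximum and the minimum, where they cancel. -/
theorem tangleEquiv_exchange_left {i : ℕ} (b₁ b₂ : BraidDiagram (i + 1)) (t : Crossing) :
    TangleEquiv [] [] (maxima (i + 1 + 1) ++ (b₁.slices.map (Slice.right 1) ++
        [⟨.crossing t.flip, 0⟩] ++ b₂.slices.map (Slice.right 1) ++ [⟨.crossing t, 0⟩]) ++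
        minima (i + 1 + 1))
      (maxima (i + 1) ++ b₁.slices ++ [⟨.max .up, 1⟩] ++ b₂.slices.map (Slice.right 2) ++
        [⟨.min, 1⟩] ++ minima (i + 1)) := by
  set r := List.replicate i Dir.down ++ List.replicate (i + 1) Dir.up with hr
  have f : strands (i + 1) = .down :: r := by rw [strands, List.replicate_succ]; rfl
  have g1 := run_maxima (i + 1)
  have g2 := run_slices b₁
  have g3 := run_slices b₂
  have g4 := run_minima (i + 1)
  rw [f] at g1 g2 g3 g4
  have hw : Run [.down] ((maxima (i + 1)).map (Slice.right 1) ++ (b₁.slices.map (Slice.right 1) ++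
        ([⟨.crossing t.flip, 0⟩] ++ (b₂.slices.map (Slice.right 1) ++ ([⟨.crossing t, 0⟩] ++
        (minima (i + 1)).map (Slice.right 1)))))) [.down] :=
    (g1.add_left [.down]).append <| (g2.add_left [.down]).append <|
      Run.append (s' := .down :: .down :: r) (by simp) <| (g3.add_left [.down]).append <|
      Run.append (s' := .down :: .down :: r) (by simp) (g4.add_left [.down])
  have s0 := tangleEquiv_close_left hw
  have s1 := (TangleEquiv.interchange (show Run [] [⟨.max .up, 0⟩] [.up, .down] by simp)
    (g1.append g2)).append_right
      (y := [⟨.crossing t.flip, 1⟩] ++ (b₂.slices.map (Slice.right 2) ++ ([⟨.crossing t, 1⟩] ++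
        ((minima (i + 1)).map (Slice.right 2) ++ [⟨.min, 0⟩])))) (t := [])
      (Run.append (s' := .up :: .down :: .down :: r) (by simp) <|
        (g3.add_left [.up, .down]).append <|
        Run.append (s' := .up :: .down :: .down :: r) (by simp) <|
        (g4.add_left [.up, .down]).append (by simp))
  have s2 := (TangleEquiv.interchange (show Run [.up, .down] [⟨.min, 0⟩] [] by simp)
    g4).symm.append_left (t := [])
      (x := maxima (i + 1) ++ (b₁.slices ++ ([⟨.max .up, 0⟩] ++ ([⟨.crossing t.flip, 1⟩] ++
        (b₂.slices.map (Slice.right 2) ++ [⟨.crossing t, 1⟩])))))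
      (g1.append <| g2.append <| Run.append (s' := .up :: .down :: .down :: r) (by simp) <|
        Run.append (s' := .up :: .down :: .down :: r) (by simp) <|
        (g3.add_left [.up, .down]).append (by simp))
  have a1 : TangleEquiv [.down] [.up, .down, .down] [⟨.max .up, 0⟩, ⟨.crossing t.flip, 1⟩]
      [⟨.max .up, 1⟩, ⟨.crossing t, 0⟩] :=
    .of_isotopy (by simpa only [t.flip_flip] using IsotopyMove.crossing_max 0 .up t.flip)
      (by simp) (by simp)
  have a2 : TangleEquiv [.up, .down, .down] [.down] [⟨.crossing t.flip, 0⟩, ⟨.min, 1⟩]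
      [⟨.crossing t, 1⟩, ⟨.min, 0⟩] :=
    .of_isotopy (by simpa only [t.flip_flip] using IsotopyMove.crossing_min 0 t.flip)
      (by simp) (by simp)
  have a3 : TangleEquiv [.down, .up, .down] [.down, .up, .down]
      [⟨.crossing t, 0⟩, ⟨.crossing t.flip, 0⟩] [] :=
    .of_reidemeister (.bigon 0 t) (by simp) (by simp)
  have s3 := (a1.add_right r).congr (g1.append g2) (t' := [])
    (y := b₂.slices.map (Slice.right 2) ++ ([⟨.crossing t, 1⟩] ++ ([⟨.min, 0⟩] ++ minima (i + 1))))
    ((g3.add_left [.up, .down]).append <|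
      Run.append (s' := .up :: .down :: .down :: r) (by simp) <|
      Run.append (s' := .down :: r) (by simp) g4)
  have s4 := (a2.symm.add_right r).congr (t := [])
    (x := maxima (i + 1) ++ (b₁.slices ++ ([⟨.max .up, 1⟩] ++ ([⟨.crossing t, 0⟩] ++
      b₂.slices.map (Slice.right 2)))))
    (g1.append <| g2.append <| Run.append (s' := .down :: .up :: .down :: r) (by simp) <|
      Run.append (s' := .up :: .down :: .down :: r) (by simp) (g3.add_left [.up, .down])) g4
  have s5 := (TangleEquiv.interchange (show Run [.up, .down] [⟨.crossing t.flip, 0⟩] [.down, .up] by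
    simp) g3).symm.congr (t := []) (t' := [])
    (x := maxima (i + 1) ++ (b₁.slices ++ ([⟨.max .up, 1⟩] ++ [⟨.crossing t, 0⟩])))
    (y := [⟨.min, 1⟩] ++ minima (i + 1))
    (g1.append <| g2.append <| Run.append (s' := .down :: .up :: .down :: r) (by simp) (by simp))
    (Run.append (s' := .down :: r) (by simp) g4)
  have s6 := (a3.add_right r).congr (t := []) (t' := [])
    (x := maxima (i + 1) ++ (b₁.slices ++ [⟨.max .up, 1⟩]))
    (y := b₂.slices.map (Slice.right 2) ++ ([⟨.min, 1⟩] ++ minima (i + 1)))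
    (g1.append <| g2.append <| by simp)
    ((g3.add_left [.down, .up]).append <| Run.append (s' := .down :: r) (by simp) g4)
  rw [maxima_succ' (i + 1), minima_succ' (i + 1)]
  simp only [List.append_assoc, List.cons_append, List.nil_append, List.map_cons,
    List.map_append, right_right, right_zero, List.length_cons, List.length_nil, Nat.reduceAdd,
    show ∀ (i : ℕ) (p : Piece) (j : ℕ), Slice.right i ⟨p, j⟩ = ⟨p, i + j⟩ from fun _ _ _ => rfl]
    at *
  exact (((((s0.trans s1).trans s2).trans s3).trans s4).trans s5).trans s6

theorem link_closure_exchange_left {m : ℕ} (b₁ b₂ : BraidDiagram m) (x x' : BraidDiagram (m + 1))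
    (t t' : Crossing) (hm : 0 < m)
    (hx : x.slices = b₁.slices.map (Slice.right 1) ++ [⟨.crossing t.flip, 0⟩] ++
      b₂.slices.map (Slice.right 1) ++ [⟨.crossing t, 0⟩])
    (hx' : x'.slices = b₁.slices.map (Slice.right 1) ++ [⟨.crossing t'.flip, 0⟩] ++
      b₂.slices.map (Slice.right 1) ++ [⟨.crossing t', 0⟩]) :
    x.closure.link = x'.closure.link := by
  obtain ⟨i, rfl⟩ : ∃ i, m = i + 1 := ⟨m - 1, by omega⟩
  apply link_closure_eq
  rw [hx, hx']
  exact (tangleEquiv_exchange_left b₁ b₂ t).trans (tangleEquiv_exchange_left b₁ b₂ t').symm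

end

/-! ### The moves on braids do not change the closure -/

/-- Braids related by a move have equivalent closures. -/
theorem closure_eq_of_braidMove {x y : Σ m, VB m} (h : BraidMove x y) :
    x.2.closure = y.2.closure := by
  have comm {m : ℕ} (a b : VB m) : (a * b).closure = (b * a).closure := by
    obtain ⟨u, rfl⟩ := VB.mk_surjective a
    obtain ⟨v, rfl⟩ := VB.mk_surjective b
    exact link_closure_mul_comm u v
  cases h with
  | conj b g =>
    change b.closure = (g⁻¹ * b * g).closure
    rw [comm, mul_inv_cancel_left]
  | stab_pos i hi b =>
    obtain ⟨w, rfl⟩ := VB.mk_surjective b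
    exact link_closure_stab w (ι 0 1 w * σ i (by omega)) .risingOver i hi
      (by rw [slices_mul, slices_ι_right]; rfl)
  | stab_neg i hi b =>
    obtain ⟨w, rfl⟩ := VB.mk_surjective b
    simp only [← VB.mk_σinv]
    exact link_closure_stab w (ι 0 1 w * σinv i (by omega)) .fallingOver i hi
      (by rw [slices_mul, slices_ι_right]; rfl)
  | stab_virt i hi b =>
    obtain ⟨w, rfl⟩ := VB.mk_surjective b
    exact link_closure_stab w (ι 0 1 w * τ i (by omega)) .virt i hi
      (by rw [slices_mul, slices_ι_right]; rfl)
  | exchange_right i hi b₁ b₂ =>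
    obtain ⟨w₁, rfl⟩ := VB.mk_surjective b₁
    obtain ⟨w₂, rfl⟩ := VB.mk_surjective b₂
    simp only [← VB.mk_σinv]
    exact link_closure_exchange_right w₁ w₂
      (ι 0 1 w₁ * σinv i (by omega) * ι 0 1 w₂ * σ i (by omega))
      (ι 0 1 w₁ * τ i (by omega) * ι 0 1 w₂ * τ i (by omega)) .risingOver .virt i hi
      (by rw [slices_mul, slices_mul, slices_mul, slices_ι_right, slices_ι_right]; rfl)
      (by rw [slices_mul, slices_mul, slices_mul, slices_ι_right, slices_ι_right]; rfl)
  | exchange_left hm b₁ b₂ =>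
    obtain ⟨w₁, rfl⟩ := VB.mk_surjective b₁
    obtain ⟨w₂, rfl⟩ := VB.mk_surjective b₂
    simp only [← VB.mk_σinv]
    exact link_closure_exchange_left w₁ w₂
      (ι 1 0 w₁ * σinv 0 (by omega) * ι 1 0 w₂ * σ 0 (by omega))
      (ι 1 0 w₁ * τ 0 (by omega) * ι 1 0 w₂ * τ 0 (by omega)) .risingOver .virt hm
      (by rw [slices_mul, slices_mul, slices_mul, slices_ι_left, slices_ι_left]; rfl)
      (by rw [slices_mul, slices_mul, slices_mul, slices_ι_left, slices_ι_left]; rfl)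

/-! ### Moves on diagrams and moves on braids -/

theorem mk_inv {m : ℕ} (b : BraidDiagram m) : VB.mk b.inv = (VB.mk b)⁻¹ := by
  induction b using FreeMonoid.inductionOn' with
  | one => rw [map_one, inv_one]; rfl
  | of_mul l w ih =>
    have e : inv (FreeMonoid.of l * w) = inv w * FreeMonoid.of l.inv := by
      simp only [inv, FreeMonoid.toList_of_mul, List.map_cons, List.reverse_cons,
        FreeMonoid.ofList_append]
      rfl
    have hl : VB.mk (FreeMonoid.of l.inv) = (VB.mk (FreeMonoid.of l))⁻¹ := by
      cases l with
      | σ i h => exact VB.mk_σinv i h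
      | σinv i h => exact (inv_eq_iff_eq_inv.2 (VB.mk_σinv i h)).symm
      | τ i h => exact (VB.τ_inv i h).symm
    rw [e, map_mul, map_mul, mul_inv_rev, ih, hl]

/-- The virtual braid represented by a diagram, of any degree. -/
def toBraid (x : Σ m, BraidDiagram m) : Σ m, VB m := ⟨x.1, VB.mk x.2⟩

theorem toBraid_surjective : Function.Surjective toBraid := by
  rintro ⟨m, b⟩
  obtain ⟨w, rfl⟩ := VB.mk_surjective b
  exact ⟨⟨m, w⟩, rfl⟩

theorem eqvGen_toBraid {x y : Σ m, BraidDiagram m} (h : Relation.EqvGen BraidDiagramMove x y) :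
    Relation.EqvGen BraidMove (toBraid x) (toBraid y) := by
  induction h with
  | refl => exact .refl _
  | symm _ _ _ ih => exact .symm _ _ ih
  | trans _ _ _ _ _ ih ih' => exact .trans _ _ _ ih ih'
  | rel _ _ h =>
    cases h with
    | braid x y u v h =>
      simp only [toBraid, map_mul, VB.mk_eq_of_rel h]
      exact .refl _
    | conj b g =>
      simp only [toBraid, map_mul, mk_inv]
      exact .rel _ _ (.conj _ _)
    | stab_pos i hi b => exact .rel _ _ (.stab_pos i hi (VB.mk b))
    | stab_neg i hi b =>
      have := BraidMove.stab_neg i hi (VB.mk b)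
      simp only [← VB.mk_σinv] at this
      exact .rel _ _ this
    | stab_virt i hi b => exact .rel _ _ (.stab_virt i hi (VB.mk b))
    | exchange_right i hi b₁ b₂ =>
      have := BraidMove.exchange_right i hi (VB.mk b₁) (VB.mk b₂)
      simp only [← VB.mk_σinv] at this
      exact .rel _ _ this
    | exchange_left hm b₁ b₂ =>
      have := BraidMove.exchange_left hm (VB.mk b₁) (VB.mk b₂)
      simp only [← VB.mk_σinv] at this
      exact .rel _ _ this

/-- The congruence of diagrams that are interchangeable, inside a diagram, by means of moves. -/
def moveCon (m : ℕ) : Con (BraidDiagram m) where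
  r u v := ∀ x y, Relation.EqvGen BraidDiagramMove ⟨m, x * u * y⟩ ⟨m, x * v * y⟩
  iseqv := ⟨fun _ _ _ => .refl _, fun h x y => .symm _ _ (h x y),
    fun h h' x y => .trans _ _ _ (h x y) (h' x y)⟩
  mul' {u v u' v'} h h' x y := by
    have h1 := h x (u' * y)
    have h2 := h' (x * v) y
    simp only [mul_assoc] at h1 h2 ⊢
    exact .trans _ _ _ h1 h2

theorem eqvGen_of_toBraid_eq {x y : Σ m, BraidDiagram m} (h : toBraid x = toBraid y) :
    Relation.EqvGen BraidDiagramMove x y := by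
  obtain ⟨m, u⟩ := x
  obtain ⟨n, v⟩ := y
  obtain rfl : m = n := congrArg Sigma.fst h
  have h : VB.mk u = VB.mk v := eq_of_heq (Sigma.mk.inj h).2
  have hle : conGen (BraidRel m) ≤ moveCon m :=
    Con.conGen_le.2 fun u v h x y => .rel _ _ (.braid x y u v h)
  simpa using hle ((Con.eq _).1 h) 1 1

/-- Every move on braids lifts to a move on diagrams. -/
theorem exists_diagramMove {x y : Σ m, VB m} (h : BraidMove x y) :
    ∃ a b, toBraid a = x ∧ toBraid b = y ∧ BraidDiagramMove a b := by
  cases h with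
  | conj b g =>
    obtain ⟨b, rfl⟩ := VB.mk_surjective b
    obtain ⟨g, rfl⟩ := VB.mk_surjective g
    refine ⟨_, _, rfl, ?_, .conj b g⟩
    simp only [toBraid, map_mul, mk_inv]
  | stab_pos i hi b =>
    obtain ⟨b, rfl⟩ := VB.mk_surjective b
    exact ⟨_, _, rfl, rfl, .stab_pos i hi b⟩
  | stab_neg i hi b =>
    obtain ⟨b, rfl⟩ := VB.mk_surjective b
    simp only [← VB.mk_σinv]
    exact ⟨_, _, rfl, rfl, .stab_neg i hi b⟩
  | stab_virt i hi b =>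
    obtain ⟨b, rfl⟩ := VB.mk_surjective b
    exact ⟨_, _, rfl, rfl, .stab_virt i hi b⟩
  | exchange_right i hi b₁ b₂ =>
    obtain ⟨b₁, rfl⟩ := VB.mk_surjective b₁
    obtain ⟨b₂, rfl⟩ := VB.mk_surjective b₂
    simp only [← VB.mk_σinv]
    exact ⟨_, _, rfl, rfl, .exchange_right i hi b₁ b₂⟩
  | exchange_left hm b₁ b₂ =>
    obtain ⟨b₁, rfl⟩ := VB.mk_surjective b₁
    obtain ⟨b₂, rfl⟩ := VB.mk_surjective b₂
    simp only [← VB.mk_σinv]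
    exact ⟨_, _, rfl, rfl, .exchange_left hm b₁ b₂⟩

/-- Braid moves account exactly for the choice of the diagrams that represent given braids. -/
theorem eqvGen_toBraid_iff {x y : Σ m, BraidDiagram m} :
    Relation.EqvGen BraidMove (toBraid x) (toBraid y) ↔ Relation.EqvGen BraidDiagramMove x y := by
  refine ⟨fun h => ?_, eqvGen_toBraid⟩
  have key {X Y : Σ m, VB m} (h : Relation.EqvGen BraidMove X Y) :
      ∀ x y, toBraid x = X → toBraid y = Y → Relation.EqvGen BraidDiagramMove x y := by
    induction h with
    | rel _ _ h =>
      rintro x y hx hy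
      obtain ⟨a, b, ha, hb, h⟩ := exists_diagramMove h
      exact .trans _ _ _ (eqvGen_of_toBraid_eq (hx.trans ha.symm))
        (.trans _ _ _ (.rel _ _ h) (eqvGen_of_toBraid_eq (hb.trans hy.symm)))
    | refl => exact fun x y hx hy => eqvGen_of_toBraid_eq (hx.trans hy.symm)
    | symm _ _ _ ih => exact fun x y hx hy => .symm _ _ (ih y x hy hx)
    | trans _ Y _ _ _ ih ih' =>
      intro x y hx hy
      obtain ⟨z, hz⟩ := toBraid_surjective Y
      exact .trans _ _ _ (ih x z hx hz) (ih' z y hz hy)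
  exact key h x y rfl rfl

theorem closure_eq_iff {m n : ℕ} (b : VB m) (b' : VB n) :
    b.closure = b'.closure ↔ Relation.EqvGen BraidMove ⟨m, b⟩ ⟨n, b'⟩ := by
  refine ⟨eqvGen_of_closure_eq, fun h => ?_⟩
  have key {x y : Σ m, VB m} (h : Relation.EqvGen BraidMove x y) :
      x.2.closure = y.2.closure := by
    induction h with
    | rel _ _ h => exact closure_eq_of_braidMove h
    | refl => rfl
    | symm _ _ _ ih => exact ih.symm
    | trans _ _ _ _ _ ih ih' => exact ih.trans ih'
  exact key h

end VirtualKnot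

open VirtualKnot in
theorem theorem3p2 (m n : ℕ) (hm : 0 < m) (hn : 0 < n) :
    (∀ (b : VB m) (b' : VB n),
      b.closure = b'.closure ↔ Relation.EqvGen BraidMove ⟨m, b⟩ ⟨n, b'⟩) ∧
    (∀ (b : BraidDiagram m) (b' : BraidDiagram n),
      b.closure.link = b'.closure.link ↔
        Relation.EqvGen BraidDiagramMove ⟨m, b⟩ ⟨n, b'⟩) := by
  refine ⟨closure_eq_iff, fun b b' => ?_⟩
  rw [← eqvGen_toBraid_iff, ← VB.closure_mk, ← VB.closure_mk]
  exact closure_eq_iff _ _
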